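/- An instance of Max-$(\le 2,*)$-Lin2-B$[W]$ consists of a nonnegative integer $k$ (the parameter) and a list of $m$ equations $\sum_{i\in I_j}x_i=b_j$ $(j=1,\dots,m)$ over $\mathbb{F}_2$ in variables $x_1,\dots,x_n$, where $I_j\subseteq\{1,\dots,n\}$, $|I_j|\le 2$, $b_j\in\mathbb{F}_2$, and the $j$-th equation has a positive integral weight $w_j$. Let $W=\sum_{j=1}^m w_j$. The question is whether there is an assignment of values in $\mathbb{F}_2$ to the variables that satisfies equations of total weight at least $W-k$. Theorem. Max-$(\le 2,*)$-Lin2-B$[W]$ can be solved in time $O(2^k(km)^2)$, where for $k=0$ or $m=0$ the corresponding factor is read as $1$. That is, there are a constant $C$ and an algorithm on a word RAM that decides every instance within $C\cdot 2^k\,(\max(k,1)\cdot\max(m,1))^2$ steps. Here the RAM performs additions, truncated subtractions, comparisons, constant assignments, and indirect loads and stores, each in one step, on machine words of $O(\log N)$ bits, where $N$ is the number of words of the input plus the sum of the numbers in it plus $2$; the input lists $k$, $n$, $m$ and the equations with their weights. In particular, the problem parameterized by $k$ is fixed-parameter tractable: it can be solved in time $f(k)\cdot|x|^{c}$ for a computable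 function $f$ and a constant $c$, where $|x|$ is the bit length of the instance. -/

import Mathlib

/-! ### The machine model: a word RAM

A machine has registers and a random-access memory, both holding natural numbers that fit in a
machine word.  Programs are structured; every elementary instruction and every evaluation of a test
takes one time step.  There is addition, truncated subtraction, comparison and indirect
addressing, but no multiplication. -/

namespace RAM

/-- The contents of the registers and of the memory. -/
structure State where
  reg : ℕ → ℕ
  mem : ℕ → ℕ

/-- Programs.  Arguments `r`, `a`, `b` are (fixed) register numbers. -/
inductive Prog : Type
  /-- do nothing -/
  | skip : Prog
  /-- `reg r := c` -/
  | const (r c : ℕ) : Prog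
  /-- `reg r := reg a + reg b` -/
  | add (r a b : ℕ) : Prog
  /-- `reg r := max (reg a - reg b) 0` -/
  | sub (r a b : ℕ) : Prog
  /-- `reg r := mem (reg a)` -/
  | load (r a : ℕ) : Prog
  /-- `mem (reg a) := reg b` -/
  | store (a b : ℕ) : Prog
  /-- `p; q` -/
  | seq (p q : Prog) : Prog
  /-- `if reg a < reg b then p else q` -/
  | ite (a b : ℕ) (p q : Prog) : Prog
  /-- `while reg a < reg b do p` -/
  | loop (a b : ℕ) (p : Prog) : Prog

/-- The state after writing `v` to register `r`. -/
def State.setReg (s : State) (r v : ℕ) : State :=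
  { s with reg := Function.update s.reg r v }

/-- The state after writing `v` to memory cell `a`. -/
def State.setMem (s : State) (a v : ℕ) : State :=
  { s with mem := Function.update s.mem a v }

/-- `Run B p s t s'`: on a machine whose words hold the numbers `0, …, B`, the program `p`, started
in the state `s`, halts after exactly `t` time steps in the state `s'`.  An instruction whose result
would exceed `B` cannot be executed, so a program that overflows has no run. -/
inductive Run (B : ℕ) : Prog → State → ℕ → State → Prop
  | skip (s : State) : Run B Prog.skip s 1 s
  | const (s : State) (r c : ℕ) (h : c ≤ B) : Run B (Prog.const r c) s 1 (s.setReg r c)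
  | add (s : State) (r a b : ℕ) (h : s.reg a + s.reg b ≤ B) :
      Run B (Prog.add r a b) s 1 (s.setReg r (s.reg a + s.reg b))
  | sub (s : State) (r a b : ℕ) : Run B (Prog.sub r a b) s 1 (s.setReg r (s.reg a - s.reg b))
  | load (s : State) (r a : ℕ) : Run B (Prog.load r a) s 1 (s.setReg r (s.mem (s.reg a)))
  | store (s : State) (a b : ℕ) : Run B (Prog.store a b) s 1 (s.setMem (s.reg a) (s.reg b))
  | seq {p q : Prog} {s s' s'' : State} {t t' : ℕ} (h₁ : Run B p s t s') (h₂ : Run B q s' t' s'') :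
      Run B (Prog.seq p q) s (t + t') s''
  | ite_true {a b : ℕ} {p : Prog} (q : Prog) {s s' : State} {t : ℕ} (h : s.reg a < s.reg b)
      (h₁ : Run B p s t s') : Run B (Prog.ite a b p q) s (t + 1) s'
  | ite_false {a b : ℕ} (p : Prog) {q : Prog} {s s' : State} {t : ℕ} (h : ¬ s.reg a < s.reg b)
      (h₁ : Run B q s t s') : Run B (Prog.ite a b p q) s (t + 1) s'
  | loop_true {a b : ℕ} {p : Prog} {s s' s'' : State} {t t' : ℕ} (h : s.reg a < s.reg b)
      (h₁ : Run B p s t s') (h₂ : Run B (Prog.loop a b p) s' t' s'') :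
      Run B (Prog.loop a b p) s (t + t' + 1) s''
  | loop_false {a b : ℕ} (p : Prog) {s : State} (h : ¬ s.reg a < s.reg b) :
      Run B (Prog.loop a b p) s 1 s

/-- Runs are deterministic. -/
theorem Run.deterministic {B : ℕ} {p : Prog} {s s₁ s₂ : State} {t₁ t₂ : ℕ}
    (h₁ : Run B p s t₁ s₁) (h₂ : Run B p s t₂ s₂) : t₁ = t₂ ∧ s₁ = s₂ := by
  induction h₁ generalizing t₂ s₂ with
  | skip | const | add | sub | load | store => cases h₂; exact ⟨rfl, rfl⟩
  | seq _ _ ih ih' =>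
    cases h₂ with
    | seq g g' =>
      obtain ⟨rfl, rfl⟩ := ih g
      obtain ⟨rfl, rfl⟩ := ih' g'
      exact ⟨rfl, rfl⟩
  | ite_true _ h _ ih =>
    cases h₂ with
    | ite_true _ _ g => obtain ⟨rfl, rfl⟩ := ih g; exact ⟨rfl, rfl⟩
    | ite_false _ h' _ => exact absurd h h'
  | ite_false _ h _ ih =>
    cases h₂ with
    | ite_true _ h' _ => exact absurd h' h
    | ite_false _ _ g => obtain ⟨rfl, rfl⟩ := ih g; exact ⟨rfl, rfl⟩
  | loop_true h _ _ ih ih' =>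
    cases h₂ with
    | loop_true _ g g' =>
      obtain ⟨rfl, rfl⟩ := ih g
      obtain ⟨rfl, rfl⟩ := ih' g'
      exact ⟨rfl, rfl⟩
    | loop_false _ h' => exact absurd h h'
  | loop_false _ h =>
    cases h₂ with
    | loop_true h' _ _ => exact absurd h' h
    | loop_false => exact ⟨rfl, rfl⟩

/-- The initial state: the input stands in the memory cells `0, 1, 2, …`; all else is `0`. -/
def init (input : List ℕ) : State where
  reg := fun _ => 0
  mem := fun i => input.getD i 0

/-- The largest number in a machine word is polynomial (with exponent `c + 1`) in the number of
input words and the numbers in them: words have `O(log (length + largest input number))` bits. -/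
def wordBound (c : ℕ) (input : List ℕ) : ℕ :=
  (input.length + input.sum + 2) ^ (c + 1)

end RAM

/-! ### Parameterized decision problems -/

/-- A parameterized decision problem: instances, their encoding as a sequence of numbers,
the parameter, and the set of `Yes`-instances. -/
structure ParamProblem where
  Inst : Type
  encode : Inst → List ℕ
  param : Inst → ℕ
  Yes : Inst → Prop

namespace ParamProblem

/-- Some program decides the problem, halting on every instance `x` within `T x` steps, with the
answer (`1` for `Yes`, `0` for `No`) in register `0`. -/
def SolvableInTime (L : ParamProblem) (T : L.Inst → ℕ) : Prop :=
  ∃ (p : RAM.Prog) (c : ℕ), ∀ x : L.Inst, ∃ (t : ℕ) (s : RAM.State),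
    RAM.Run (RAM.wordBound c (L.encode x)) p (RAM.init (L.encode x)) t s ∧
    t ≤ T x ∧ (L.Yes x → s.reg 0 = 1) ∧ (¬ L.Yes x → s.reg 0 = 0)

/-- The length of an instance: the number of bits of its encoding (with one separator per word). -/
def size (L : ParamProblem) (x : L.Inst) : ℕ :=
  ((L.encode x).map fun w => Nat.size w + 1).sum

/-- Fixed-parameter tractability: solvable in time `f(k) · |x| ^ c` with `f` computable. -/
def FixedParameterTractable (L : ParamProblem) : Prop :=
  ∃ (f : ℕ → ℕ) (c : ℕ), Computable f ∧
    L.SolvableInTime fun x => f (L.param x) * L.size x ^ c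

end ParamProblem

/-! ### Weighted systems of linear equations over the field with two elements -/

/-- An equation `∑ i ∈ vars, x i = rhs` over `𝔽₂` with a positive integral weight. -/
structure LinEq2 (n : ℕ) where
  vars : Finset (Fin n)
  rhs : ZMod 2
  weight : ℕ
  weight_pos : 0 < weight

/-- The equation holds under the assignment `x`. -/
def LinEq2.Holds {n : ℕ} (e : LinEq2 n) (x : Fin n → ZMod 2) : Prop :=
  ∑ i ∈ e.vars, x i = e.rhs

instance {n : ℕ} (e : LinEq2 n) (x : Fin n → ZMod 2) : Decidable (e.Holds x) :=
  inferInstanceAs (Decidable (∑ i ∈ e.vars, x i = e.rhs))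

/-- A system of `m = eqs.length` weighted equations in `n` variables.  Equations may repeat. -/
structure LinSystem2 where
  n : ℕ
  eqs : List (LinEq2 n)

namespace LinSystem2

/-- The number of equations. -/
def m (S : LinSystem2) : ℕ := S.eqs.length

/-- The total weight `W` of all equations. -/
def totalWeight (S : LinSystem2) : ℕ := (S.eqs.map LinEq2.weight).sum

/-- The total weight of the equations satisfied by the assignment `x`. -/
def satWeight (S : LinSystem2) (x : Fin S.n → ZMod 2) : ℕ :=
  ((S.eqs.filter fun e => e.Holds x).map LinEq2.weight).sum

end LinSystem2

/-- The words describing an equation: the number of variables, the (indices of the) variables,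
the right-hand side, and the weight. -/
def LinEq2.encode {n : ℕ} (e : LinEq2 n) : List ℕ :=
  e.vars.card :: ((e.vars.sort (· ≤ ·)).map Fin.val ++ [e.rhs.val, e.weight])

/-- The instances of `Max-(≤ r, *)-Lin2-B[W]`: a number `k` and a system in which every equation has
at most `r` variables. -/
structure MaxLin2BInst (r : ℕ) where
  k : ℕ
  S : LinSystem2
  card_le : ∀ e ∈ S.eqs, e.vars.card ≤ r

/-- The problem `Max-(≤ r, *)-Lin2-B[W]` with parameter `k`: is there an assignment satisfying
equations of total weight at least `W - k`? -/
def maxLin2B (r : ℕ) : ParamProblem where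
  Inst := MaxLin2BInst r
  encode I := [I.k, I.S.n, I.S.m] ++ I.S.eqs.flatMap LinEq2.encode
  param I := I.k
  Yes I := ∃ x : Fin I.S.n → ZMod 2, (I.S.totalWeight : ℤ) - I.k ≤ I.S.satWeight x

/-! The proof is iterative compression with a guess of orientations and a minimum cut. An equation
in at most two variables is an edge of a graph; an extra vertex `n` stands in for each missing
variable, and its label is added to all others to recover an assignment. The question becomes
whether some 0/1 labelling violates equations of weight at most `k` (`exists_satWeight_iff`).

Equations are added one at a time. Suppose `lab` violates weight at most `k` among the first `j`. As
weights are positive, at most `k + 1` of the first `j + 1` equations are violated. Any other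
labelling arises from `lab` by flipping a set `Z`. A satisfied equation becomes violated exactly if
`Z` separates its ends, and a violated one becomes satisfied under the same condition. For each
violated equation one guesses which end lies in `Z`, joins this end to `s` and the other one to `t`,
both by edges of the weight of the equation. For every guess a cut weighs at least what the flipped
labelling violates (`cost_flip_le`), and for the right guess the two are equal (`exists_cut`). So a
good labelling exists if and only if one of `2 ^ (k + 1)` networks has a cut of capacity at most
`k`. If none has, the prefix is already a No-instance and so is the whole.

Each network is decided by at most `k + 1` searches of the residual graph, each pushing one unit of
flow or yielding a small cut. No flow is defined: it suffices that, for every cut, residual capacity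
plus number of units pushed equals the original capacity. Searches and clean-up touch only ends of
arcs, so the time does not depend on the number of variables, and the total is `m` rounds times `2 ^
(k + 1)` guesses times `k + 1` searches of `O(m)` steps.

The program is written with named variables and arrays, compiled to the word RAM, and verified by
Hoare triples `Tri` that also bound the running time. -/

/-! ### A language of named variables and arrays on top of the word RAM -/

namespace RAM

/-- Names of the variables of the algorithm. -/
inductive Var
  | ans | k | n | m | s | t | j | go | found | p | i | A | rk | fl | qh | qt | cur
  | x | y | b | w | d | p₀ | q₀ | p₁ | q₁
  deriving DecidableEq

/-- Names of the arrays of the algorithm. -/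
inductive Arr
  | inp | U | V | R | W | X | O | src | tgt | rv | rs | nx | hd | vis | pa | q
  deriving DecidableEq

/-- The register that holds a variable. -/
def Var.idx : Var → ℕ
  | ans => 0 | k => 1 | n => 2 | m => 3 | s => 4 | t => 5 | j => 6 | go => 7 | found => 8
  | p => 9 | i => 10 | A => 11 | rk => 12 | fl => 13 | qh => 14 | qt => 15 | cur => 16
  | x => 17 | y => 18 | b => 19 | w => 20 | d => 21 | p₀ => 22 | q₀ => 23 | p₁ => 24 | q₁ => 25

/-- The number of an array. -/
def Arr.idx : Arr → ℕ
  | inp => 0 | U => 1 | V => 2 | R => 3 | W => 4 | X => 5 | O => 6 | src => 7 | tgt => 8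
  | rv => 9 | rs => 10 | nx => 11 | hd => 12 | vis => 13 | pa => 14 | q => 15

theorem Var.idx_injective : Function.Injective Var.idx := by
  intro r r' h
  cases r <;> cases r' <;> first | rfl | (exact absurd h (by decide))

theorem Arr.idx_injective : Function.Injective Arr.idx := by
  intro r r' h
  cases r <;> cases r' <;> first | rfl | (exact absurd h (by decide))

theorem Var.idx_lt (r : Var) : r.idx < 39 := by cases r <;> decide

theorem Arr.idx_lt (f : Arr) : f.idx < 16 := by cases f <;> decide

/-- A state with named variables and arrays. -/
structure Store where
  v : Var → ℕ
  a : Arr → ℕ → ℕ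

namespace Store

/-- Assignment to a variable. -/
def set (h : Store) (r : Var) (x : ℕ) : Store := ⟨Function.update h.v r x, h.a⟩

/-- Assignment to an array cell. -/
def put (h : Store) (f : Arr) (i x : ℕ) : Store :=
  ⟨h.v, Function.update h.a f (Function.update (h.a f) i x)⟩

@[simp] theorem set_v (h : Store) (r r' : Var) (x : ℕ) :
    (h.set r x).v r' = if r' = r then x else h.v r' := by
  simp [set, Function.update_apply]

@[simp] theorem set_a (h : Store) (r : Var) (x : ℕ) : (h.set r x).a = h.a := rfl

@[simp] theorem put_v (h : Store) (f : Arr) (i x : ℕ) : (h.put f i x).v = h.v := rfl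

@[simp] theorem put_a (h : Store) (f f' : Arr) (i x : ℕ) :
    (h.put f i x).a f' = if f' = f then Function.update (h.a f') i x else h.a f' := by
  by_cases e : f' = f
  · subst e; simp [put]
  · simp [put, e]

end Store

/-- The machine state `s` represents the store `h`, arrays having length `D`. -/
structure Rep (D : ℕ) (s : State) (h : Store) : Prop where
  var : ∀ r : Var, s.reg r.idx = h.v r
  zero : s.reg 39 = 0
  base : ∀ f < 16, s.reg (40 + f) = f * D
  arr : ∀ f : Arr, ∀ i < D, s.mem (f.idx * D + i) = h.a f i

/-- Expressions. -/
inductive Expr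
  | c (n : ℕ)
  | v (r : Var)
  | add (e e' : Expr)
  | sub (e e' : Expr)
  | a (f : Arr) (e : Expr)

namespace Expr

/-- The value of an expression. -/
def val (h : Store) : Expr → ℕ
  | c n => n
  | v r => h.v r
  | add e e' => e.val h + e'.val h
  | sub e e' => e.val h - e'.val h
  | a f e => h.a f (e.val h)

/-- The expression can be evaluated without overflow or access outside an array. -/
def ok (D B : ℕ) (h : Store) : Expr → Prop
  | c n => n ≤ B
  | v _ => True
  | add e e' => e.ok D B h ∧ e'.ok D B h ∧ e.val h + e'.val h ≤ B
  | sub e e' => e.ok D B h ∧ e'.ok D B h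
  | a _ e => e.ok D B h ∧ e.val h < D

/-- The time it takes to evaluate an expression. -/
def cost : Expr → ℕ
  | c _ => 1
  | v _ => 1
  | add e e' => e.cost + e'.cost + 1
  | sub e e' => e.cost + e'.cost + 1
  | a _ e => e.cost + 2

/-- Code that evaluates an expression into the register `t`, using the registers above `t`. -/
def code : Expr → ℕ → Prog
  | c n, t => .const t n
  | v r, t => .sub t r.idx 39
  | add e e', t => .seq (.seq (e.code t) (e'.code (t + 1))) (.add t t (t + 1))
  | sub e e', t => .seq (.seq (e.code t) (e'.code (t + 1))) (.sub t t (t + 1))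
  | a f e, t => .seq (e.code t) (.seq (.add t t (40 + f.idx)) (.load t t))

end Expr

/-- Registers below 39 are reserved for variables, 39 is constantly 0, 40 to 55 hold the base
addresses of the 16 arrays. Everything from 56 on is scratch space. -/
theorem Rep.congr {D : ℕ} {s s' : State} {h : Store} (hs : Rep D s h)
    (hr : ∀ r < 56, s'.reg r = s.reg r) (hm : s'.mem = s.mem) : Rep D s' h where
  var r := by rw [hr _ (by have := r.idx_lt; omega), hs.var]
  zero := by rw [hr _ (by omega), hs.zero]
  base f hf := by rw [hr _ (by omega), hs.base f hf]
  arr f i hi := by rw [hm, hs.arr f i hi]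

/-- The scratch registers act as a stack: a value computed into `t` survives the evaluation of the
next operand, which starts at `t + 1`. The 16 arrays of length `D` occupy addresses below `16 * D`,
so address computations do not overflow. -/
theorem Expr.run_code {D B : ℕ} (hB : 16 * D ≤ B) {h : Store} (e : Expr) :
    ∀ (t : ℕ) (s : State), 56 ≤ t → Rep D s h → e.ok D B h →
      ∃ s', Run B (e.code t) s e.cost s' ∧ s'.reg t = e.val h ∧
        (∀ r < t, s'.reg r = s.reg r) ∧ s'.mem = s.mem := by
  induction e with
  | c n =>
    intro t s ht hs hok
    refine ⟨_, Run.const s t n hok, by simp [State.setReg, val], ?_, rfl⟩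
    intro r hr
    simp [State.setReg, Function.update_of_ne hr.ne]
  | v r =>
    intro t s ht hs hok
    refine ⟨_, Run.sub s t r.idx 39, by simp [State.setReg, val, hs.var, hs.zero], ?_, rfl⟩
    intro r hr
    simp [State.setReg, Function.update_of_ne hr.ne]
  | add e e' ih ih' =>
    intro t s ht hs ⟨h1, h2, h3⟩
    obtain ⟨s₁, r₁, v₁, f₁, m₁⟩ := ih t s ht hs h1
    obtain ⟨s₂, r₂, v₂, f₂, m₂⟩ := ih' (t + 1) s₁ (by omega)
      (hs.congr (fun r hr => f₁ r (by omega)) m₁) h2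
    have e1 : s₂.reg t = e.val h := by rw [f₂ t (by omega), v₁]
    refine ⟨_, Run.seq (Run.seq r₁ r₂) (Run.add s₂ t t (t + 1) (by rw [e1, v₂]; exact h3)),
      by simp [State.setReg, val, e1, v₂], ?_, by simp [State.setReg, m₂, m₁]⟩
    intro r hr
    simp [State.setReg, Function.update_of_ne hr.ne, f₁ r hr, f₂ r (by omega)]
  | sub e e' ih ih' =>
    intro t s ht hs ⟨h1, h2⟩
    obtain ⟨s₁, r₁, v₁, f₁, m₁⟩ := ih t s ht hs h1
    obtain ⟨s₂, r₂, v₂, f₂, m₂⟩ := ih' (t + 1) s₁ (by omega)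
      (hs.congr (fun r hr => f₁ r (by omega)) m₁) h2
    have e1 : s₂.reg t = e.val h := by rw [f₂ t (by omega), v₁]
    refine ⟨_, Run.seq (Run.seq r₁ r₂) (Run.sub s₂ t t (t + 1)),
      by simp [State.setReg, val, e1, v₂], ?_, by simp [State.setReg, m₂, m₁]⟩
    intro r hr
    simp [State.setReg, Function.update_of_ne hr.ne, f₁ r hr, f₂ r (by omega)]
  | a f e ih =>
    intro t s ht hs ⟨h1, h2⟩
    obtain ⟨s₁, r₁, v₁, f₁, m₁⟩ := ih t s ht hs h1
    have hf := f.idx_lt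
    have hs₁ : Rep D s₁ h := hs.congr (fun r hr => f₁ r (by omega)) m₁
    have hle : s₁.reg t + s₁.reg (40 + f.idx) ≤ B := by
      rw [v₁, hs₁.base _ hf]
      have : (f.idx + 1) * D ≤ 16 * D := Nat.mul_le_mul_right _ hf
      linarith
    refine ⟨_, Run.seq r₁ (Run.seq (Run.add s₁ t t (40 + f.idx) hle) (Run.load _ t t)), ?_, ?_,
      by simp [State.setReg, m₁]⟩
    · simp [State.setReg, v₁, hs₁.base _ hf, val, ← hs₁.arr f _ h2, add_comm]
    · intro r hr
      simp [State.setReg, Function.update_of_ne hr.ne, f₁ r hr]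

/-! ### Timed Hoare triples, loop-free commands and loops -/

/-- `Tri D B p T h Q`: started in a state that represents `h`, the program `p` halts within `T`
steps in a state that represents a store with the property `Q`. -/
def Tri (D B : ℕ) (p : Prog) (T : ℕ) (h : Store) (Q : Store → Prop) : Prop :=
  ∀ s, Rep D s h → ∃ t s' h', Run B p s t s' ∧ t ≤ T ∧ Rep D s' h' ∧ Q h'

namespace Tri

variable {D B : ℕ} {h : Store} {Q Q' : Store → Prop} {T T' : ℕ} {p p' : Prog}

theorem mono (H : Tri D B p T h Q) (hT : T ≤ T') (hQ : ∀ h', Q h' → Q' h') :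
    Tri D B p T' h Q' := by
  intro s hs
  obtain ⟨t, s', h', hr, ht, hs', hq⟩ := H s hs
  exact ⟨t, s', h', hr, ht.trans hT, hs', hQ _ hq⟩

theorem seq (H : Tri D B p T h fun h' => Tri D B p' T' h' Q) :
    Tri D B (.seq p p') (T + T') h Q := by
  intro s hs
  obtain ⟨t, s', h', hr, ht, hs', hq⟩ := H s hs
  obtain ⟨t', s'', h'', hr', ht', hs'', hq'⟩ := hq s' hs'
  exact ⟨_, _, h'', Run.seq hr hr', by omega, hs'', hq'⟩

/-- Sequencing with an intermediate assertion. -/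
theorem seq' {P : Store → Prop} (H : Tri D B p T h P) (H' : ∀ h', P h' → Tri D B p' T' h' Q) :
    Tri D B (.seq p p') (T + T') h Q :=
  seq (H.mono le_rfl H')

end Tri

/-- Loop-free commands. -/
inductive Cmd
  | skip
  | set (r : Var) (e : Expr)
  | put (f : Arr) (e e' : Expr)
  | seq (c c' : Cmd)
  | ite (e e' : Expr) (c c' : Cmd)

/-- `c; c'` -/
infixr:60 " ;; " => Cmd.seq

namespace Cmd

/-- The code of a command. -/
def code : Cmd → Prog
  | skip => .skip
  | set r e => .seq (e.code 56) (.sub r.idx 56 39)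
  | put f e e' =>
    .seq (e.code 56) (.seq (.add 56 56 (40 + f.idx)) (.seq (e'.code 57) (.store 56 57)))
  | seq c c' => .seq c.code c'.code
  | ite e e' c c' => .seq (e.code 56) (.seq (e'.code 57) (.ite 56 57 c.code c'.code))

/-- A bound on the running time of a command. -/
def cost : Cmd → ℕ
  | skip => 1
  | set _ e => e.cost + 1
  | put _ e e' => e.cost + e'.cost + 2
  | seq c c' => c.cost + c'.cost
  | ite e e' c c' => e.cost + e'.cost + max c.cost c'.cost + 1

/-- The weakest precondition of a command. -/
def wp (D B : ℕ) : Cmd → (Store → Prop) → Store → Prop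
  | skip, Q, h => Q h
  | set r e, Q, h => e.ok D B h ∧ Q (h.set r (e.val h))
  | put f e e', Q, h => e.ok D B h ∧ e'.ok D B h ∧ e.val h < D ∧ Q (h.put f (e.val h) (e'.val h))
  | seq c c', Q, h => c.wp D B (fun h' => c'.wp D B Q h') h
  | ite e e' c c', Q, h => e.ok D B h ∧ e'.ok D B h ∧
      (e.val h < e'.val h → c.wp D B Q h) ∧ (¬ e.val h < e'.val h → c'.wp D B Q h)

end Cmd

theorem Cmd.wp_mono {D B : ℕ} (c : Cmd) {Q Q' : Store → Prop} (hQ : ∀ h, Q h → Q' h) {h : Store}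
    (H : c.wp D B Q h) : c.wp D B Q' h := by
  induction c generalizing Q Q' h with
  | skip => exact hQ _ H
  | set r e => exact ⟨H.1, hQ _ H.2⟩
  | put f e e' => exact ⟨H.1, H.2.1, H.2.2.1, hQ _ H.2.2.2⟩
  | seq c c' ih ih' => exact ih (fun h' H' => ih' hQ H') H
  | ite e e' c c' ih ih' =>
    exact ⟨H.1, H.2.1, fun h' => ih hQ (H.2.2.1 h'), fun h' => ih' hQ (H.2.2.2 h')⟩

theorem Rep.set {D : ℕ} {s : State} {h : Store} (hs : Rep D s h) (r : Var) (x : ℕ) :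
    Rep D (s.setReg r.idx x) (h.set r x) where
  var r' := by
    by_cases e : r' = r
    · subst e; simp [State.setReg]
    · simp [State.setReg, e, Function.update_of_ne (Var.idx_injective.ne e), hs.var]
  zero := by
    have := r.idx_lt
    simp [State.setReg, Function.update_of_ne (show 39 ≠ r.idx by omega), hs.zero]
  base f hf := by
    have := r.idx_lt
    simp [State.setReg, Function.update_of_ne (show 40 + f ≠ r.idx by omega), hs.base f hf]
  arr f i hi := by simp [State.setReg, hs.arr f i hi]

theorem Rep.put {D : ℕ} {s : State} {h : Store} (hs : Rep D s h) (f : Arr) {i : ℕ} (hi : i < D)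
    (x : ℕ) : Rep D (s.setMem (f.idx * D + i) x) (h.put f i x) where
  var r' := by simp [State.setMem, hs.var]
  zero := by simp [State.setMem, hs.zero]
  base f hf := by simp [State.setMem, hs.base f hf]
  arr g j hj := by
    by_cases e : g = f
    · subst e
      by_cases e' : j = i
      · subst e'; simp [State.setMem]
      · simp [State.setMem, e', hs.arr g j hj]
    -- Distinct arrays lie in disjoint blocks of length `D`: the array number is recovered from an
    -- address by division by `D`.
    · have : g.idx * D + j ≠ f.idx * D + i := by
        intro H
        have h1 : (g.idx * D + j) / D = g.idx := by
          rw [mul_comm, Nat.mul_add_div (by omega), Nat.div_eq_of_lt hj, add_zero]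
        have h2 : (f.idx * D + i) / D = f.idx := by
          rw [mul_comm, Nat.mul_add_div (by omega), Nat.div_eq_of_lt hi, add_zero]
        rw [H, h2] at h1
        exact e (Arr.idx_injective h1).symm
      simp [State.setMem, this, e, hs.arr g j hj]

namespace Tri

variable {D B : ℕ} {h : Store} {Q : Store → Prop} {T : ℕ}

/-- Soundness of the weakest precondition: correctness of loop-free code reduces to a proposition
that `simp` computes and `omega` mostly settles. -/
theorem of_wp (hB : 16 * D ≤ B) (c : Cmd) :
    ∀ {Q : Store → Prop} {h : Store}, c.wp D B Q h → Tri D B c.code c.cost h Q := by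
  induction c with
  | skip => intro Q h H s hs; exact ⟨1, s, h, Run.skip s, le_rfl, hs, H⟩
  | set r e =>
    intro Q h H s hs
    obtain ⟨s₁, r₁, v₁, f₁, m₁⟩ := e.run_code hB 56 s le_rfl hs H.1
    have hs₁ : Rep D s₁ h := hs.congr f₁ m₁
    refine ⟨_, _, _, Run.seq r₁ (Run.sub s₁ r.idx 56 39), le_rfl, ?_, H.2⟩
    rw [v₁, hs₁.zero]
    exact hs₁.set r _
  | put f e e' =>
    intro Q h ⟨h1, h2, h3, h4⟩ s hs
    have hf := f.idx_lt
    obtain ⟨s₁, r₁, v₁, f₁, m₁⟩ := e.run_code hB 56 s le_rfl hs h1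
    have hs₁ : Rep D s₁ h := hs.congr f₁ m₁
    have hle : s₁.reg 56 + s₁.reg (40 + f.idx) ≤ B := by
      rw [v₁, hs₁.base _ hf]
      have : (f.idx + 1) * D ≤ 16 * D := Nat.mul_le_mul_right _ hf
      linarith
    have r₂ := Run.add s₁ 56 56 (40 + f.idx) hle
    set s₂ := s₁.setReg 56 (s₁.reg 56 + s₁.reg (40 + f.idx)) with hs₂
    have hr₂ : Rep D s₂ h := hs₁.congr
      (fun r hr => by simp [hs₂, State.setReg, Function.update_of_ne hr.ne]) rfl
    obtain ⟨s₃, r₃, v₃, f₃, m₃⟩ := e'.run_code hB 57 s₂ (by omega) hr₂ h2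
    have hr₃ : Rep D s₃ h := hr₂.congr (fun r hr => f₃ r (by omega)) m₃
    refine ⟨_, _, _, Run.seq r₁ (Run.seq r₂ (Run.seq r₃ (Run.store s₃ 56 57))), ?_, ?_, h4⟩
    · simp only [Cmd.cost]; omega
    · have : s₃.reg 56 = f.idx * D + e.val h := by
        rw [f₃ 56 (by omega)]
        simp [hs₂, State.setReg, v₁, hs₁.base _ hf, add_comm]
      rw [this, v₃]
      exact hr₃.put f h3 _
  | seq c c' ih ih' =>
    intro Q h H
    exact Tri.seq ((ih H).mono le_rfl fun h' H' => ih' H')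
  | ite e e' c c' ih ih' =>
    intro Q h ⟨h1, h2, h3, h4⟩ s hs
    obtain ⟨s₁, r₁, v₁, f₁, m₁⟩ := e.run_code hB 56 s le_rfl hs h1
    have hs₁ : Rep D s₁ h := hs.congr f₁ m₁
    obtain ⟨s₂, r₂, v₂, f₂, m₂⟩ := e'.run_code hB 57 s₁ (by omega) hs₁ h2
    have hs₂ : Rep D s₂ h := hs₁.congr (fun r hr => f₂ r (by omega)) m₂
    have e1 : s₂.reg 56 = e.val h := by rw [f₂ 56 (by omega), v₁]
    by_cases hc : e.val h < e'.val h
    · obtain ⟨t, s', h', hr, ht, hs', hq⟩ := ih (h3 hc) s₂ hs₂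
      refine ⟨_, _, h', Run.seq r₁ (Run.seq r₂ (Run.ite_true _ (by rwa [e1, v₂]) hr)), ?_, hs', hq⟩
      simp only [Cmd.cost]; omega
    · obtain ⟨t, s', h', hr, ht, hs', hq⟩ := ih' (h4 hc) s₂ hs₂
      refine ⟨_, _, h', Run.seq r₁ (Run.seq r₂ (Run.ite_false _ (by rwa [e1, v₂]) hr)), ?_, hs', hq⟩
      simp only [Cmd.cost]; omega

end Tri

/-- `if e < e' then p else p'`. -/
def ifLt (e e' : Expr) (p p' : Prog) : Prog :=
  .seq (e.code 56) (.seq (e'.code 57) (.ite 56 57 p p'))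

/-- `while e < e' do p`. -/
def whileLt (e e' : Expr) (p : Prog) : Prog :=
  .seq (.seq (e.code 56) (e'.code 57))
    (.loop 56 57 (.seq p (.seq (e.code 56) (e'.code 57))))

namespace Tri

variable {D B : ℕ} {h : Store} {Q : Store → Prop} {T : ℕ}

theorem run_pair (hB : 16 * D ≤ B) {e e' : Expr} {s : State} (hs : Rep D s h)
    (h1 : e.ok D B h) (h2 : e'.ok D B h) :
    ∃ s', Run B (.seq (e.code 56) (e'.code 57)) s (e.cost + e'.cost) s' ∧ Rep D s' h ∧
      s'.reg 56 = e.val h ∧ s'.reg 57 = e'.val h := by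
  obtain ⟨s₁, r₁, v₁, f₁, m₁⟩ := e.run_code hB 56 s le_rfl hs h1
  have hs₁ : Rep D s₁ h := hs.congr f₁ m₁
  obtain ⟨s₂, r₂, v₂, f₂, m₂⟩ := e'.run_code hB 57 s₁ (by omega) hs₁ h2
  have hs₂ : Rep D s₂ h := hs₁.congr (fun r hr => f₂ r (by omega)) m₂
  exact ⟨s₂, Run.seq r₁ r₂, hs₂, by rw [f₂ 56 (by omega), v₁], v₂⟩

theorem ifLt (hB : 16 * D ≤ B) {e e' : Expr} {p p' : Prog} (h1 : e.ok D B h) (h2 : e'.ok D B h)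
    (h3 : e.val h < e'.val h → Tri D B p T h Q) (h4 : ¬ e.val h < e'.val h → Tri D B p' T h Q) :
    Tri D B (ifLt e e' p p') (e.cost + e'.cost + T + 1) h Q := by
  intro s hs
  obtain ⟨s₁, r₁, v₁, f₁, m₁⟩ := e.run_code hB 56 s le_rfl hs h1
  have hs₁ : Rep D s₁ h := hs.congr f₁ m₁
  obtain ⟨s₂, r₂, v₂, f₂, m₂⟩ := e'.run_code hB 57 s₁ (by omega) hs₁ h2
  have hs₂ : Rep D s₂ h := hs₁.congr (fun r hr => f₂ r (by omega)) m₂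
  have e1 : s₂.reg 56 = e.val h := by rw [f₂ 56 (by omega), v₁]
  by_cases hc : e.val h < e'.val h
  · obtain ⟨t, s', h', hr, ht, hs', hq⟩ := h3 hc s₂ hs₂
    exact ⟨_, _, h', Run.seq r₁ (Run.seq r₂ (Run.ite_true _ (by rwa [e1, v₂]) hr)), by omega, hs',
      hq⟩
  · obtain ⟨t, s', h', hr, ht, hs', hq⟩ := h4 hc s₂ hs₂
    exact ⟨_, _, h', Run.seq r₁ (Run.seq r₂ (Run.ite_false _ (by rwa [e1, v₂]) hr)), by omega, hs',
      hq⟩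

/-- The rule for loops: `I` is an invariant indexed by a bound on the number of iterations. -/
theorem whileLt (hB : 16 * D ≤ B) {e e' : Expr} {p : Prog} (I : ℕ → Store → Prop)
    (hok : ∀ n h, I n h → e.ok D B h ∧ e'.ok D B h)
    (hbody : ∀ n h, I n h → e.val h < e'.val h → Tri D B p T h fun h' => ∃ n' < n, I n' h')
    (hQ : ∀ n h, I n h → ¬ e.val h < e'.val h → Q h) {n : ℕ} (hI : I n h) :
    Tri D B (whileLt e e' p) ((T + (e.cost + e'.cost) + 1) * n + (e.cost + e'.cost + 1)) h Q := by
  -- The induction is on the machine loop, with both sides of the test already in registers 56 and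
  -- 57; they are evaluated afresh at the end of each pass.
  have key : ∀ n h s, I n h → Rep D s h → s.reg 56 = e.val h → s.reg 57 = e'.val h →
      ∃ t s' h', Run B (.loop 56 57 (.seq p (.seq (e.code 56) (e'.code 57)))) s t s' ∧
        t ≤ (T + (e.cost + e'.cost) + 1) * n + 1 ∧ Rep D s' h' ∧ Q h' := by
    intro n
    induction n using Nat.strong_induction_on with
    | _ n ih =>
      intro h s hI hs e1 e2
      by_cases hc : e.val h < e'.val h
      · obtain ⟨t, s₁, h₁, r₁, ht, hs₁, n', hn', hI'⟩ := hbody n h hI hc s hs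
        obtain ⟨s₂, r₂, hs₂, e1', e2'⟩ := run_pair hB hs₁ (hok _ _ hI').1 (hok _ _ hI').2
        obtain ⟨t', s₃, h₃, r₃, ht', hs₃, hq⟩ := ih n' hn' h₁ s₂ hI' hs₂ e1' e2'
        refine ⟨_, s₃, h₃, Run.loop_true (by rwa [e1, e2]) (Run.seq r₁ r₂) r₃, ?_, hs₃, hq⟩
        have : (T + (e.cost + e'.cost) + 1) * (n' + 1) ≤ (T + (e.cost + e'.cost) + 1) * n :=
          Nat.mul_le_mul_left _ hn'
        rw [Nat.mul_add, mul_one] at this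
        omega
      · exact ⟨1, s, h, Run.loop_false _ (by rwa [e1, e2]), by omega, hs, hQ n h hI hc⟩
  intro s hs
  obtain ⟨s₂, r₂, hs₂, e1', e2'⟩ := run_pair hB hs (hok _ _ hI).1 (hok _ _ hI).2
  obtain ⟨t', s₃, h₃, r₃, ht', hs₃, hq⟩ := key n h s₂ hI hs₂ e1' e2'
  exact ⟨_, s₃, h₃, Run.seq r₂ r₃, by omega, hs₃, hq⟩

end Tri

end RAM

/-! ### Cuts and residual capacities -/

open Classical in
/-- The total capacity of the arcs `a < A` that leave the vertex set `Z`. -/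
noncomputable def outCap (A : ℕ) (src tgt c : ℕ → ℕ) (Z : Set ℕ) : ℕ :=
  ∑ a ∈ Finset.range A, if src a ∈ Z ∧ tgt a ∉ Z then c a else 0

open Classical in
-- Only the summand of `x` changes. The old contribution is added on the left, which avoids
-- subtraction in `ℕ`.
theorem outCap_update {A : ℕ} {src tgt c : ℕ → ℕ} (Z : Set ℕ) {x : ℕ} (hx : x < A) (y : ℕ) :
    outCap A src tgt (Function.update c x y) Z + (if src x ∈ Z ∧ tgt x ∉ Z then c x else 0) =
      outCap A src tgt c Z + (if src x ∈ Z ∧ tgt x ∉ Z then y else 0) := by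
  have hx' : x ∈ Finset.range A := Finset.mem_range.2 hx
  unfold outCap
  rw [← Finset.add_sum_erase _ _ hx', ← Finset.add_sum_erase _ _ hx']
  have : ∑ a ∈ (Finset.range A).erase x,
        (if src a ∈ Z ∧ tgt a ∉ Z then Function.update c x y a else 0) =
      ∑ a ∈ (Finset.range A).erase x, if src a ∈ Z ∧ tgt a ∉ Z then c a else 0 := by
    refine Finset.sum_congr rfl fun a ha => ?_
    rw [Function.update_of_ne (Finset.ne_of_mem_erase ha)]
  rw [this, Function.update_self]
  omega

open Classical in
/-- Pushing one unit of flow along the arc `x` with reverse arc `x'`. -/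
theorem outCap_push {A : ℕ} {src tgt c : ℕ → ℕ} (Z : Set ℕ) {x x' : ℕ} (hx : x < A) (hx' : x' < A)
    (hne : x' ≠ x) (hs : src x' = tgt x) (ht : tgt x' = src x) (hc : 0 < c x) :
    outCap A src tgt (Function.update (Function.update c x (c x - 1)) x' (c x' + 1)) Z +
        (if src x ∈ Z then 1 else 0) =
      outCap A src tgt c Z + (if tgt x ∈ Z then 1 else 0) := by
  have h1 := outCap_update (src := src) (tgt := tgt) (c := c) Z hx (c x - 1)
  have h2 := outCap_update (src := src) (tgt := tgt) (c := Function.update c x (c x - 1)) Z hx'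
    (c x' + 1)
  rw [Function.update_of_ne hne, hs, ht] at h2
  by_cases p : src x ∈ Z <;> by_cases q : tgt x ∈ Z <;> simp [p, q] at h1 h2 ⊢ <;> omega

/-- The successor of the last arc `a < p` with source `v`, or `0` if there is none. -/
def lastArc (src : ℕ → ℕ) (v : ℕ) : ℕ → ℕ
  | 0 => 0
  | a + 1 => if src a = v then a + 1 else lastArc src v a

theorem lastArc_le (src : ℕ → ℕ) (v p : ℕ) : lastArc src v p ≤ p := by
  induction p with
  | zero => simp [lastArc]
  | succ a ih => rw [lastArc]; split_ifs <;> omega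

theorem src_lastArc {src : ℕ → ℕ} {v p : ℕ} (h : 0 < lastArc src v p) :
    src (lastArc src v p - 1) = v := by
  induction p with
  | zero => simp [lastArc] at h
  | succ a ih =>
    rw [lastArc] at h ⊢
    split_ifs with e
    · simpa using e
    · rw [if_neg e] at h; exact ih h

/-- With `src_lastArc` this says that iterating `lastArc` from `A` downwards lists all arcs out of
`v`. Storing successors of arc numbers frees 0 as the end-of-list mark. -/
theorem lt_lastArc {src : ℕ → ℕ} {v p a : ℕ} (ha : a < p) (hv : src a = v) :
    a < lastArc src v p := by
  induction p with
  | zero => omega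
  | succ b ih =>
    rw [lastArc]
    split_ifs with e
    · exact ha
    · exact ih (lt_of_le_of_ne (by omega) (by rintro rfl; exact e hv))

/-! ### Binary counters -/

/-- The number whose binary digits are `o 0, …, o (L - 1)`. -/
def binVal (L : ℕ) (o : ℕ → ℕ) : ℕ := ∑ i ∈ Finset.range L, o i * 2 ^ i

theorem binVal_lt {L : ℕ} {o : ℕ → ℕ} (h : ∀ i < L, o i ≤ 1) : binVal L o < 2 ^ L := by
  induction L with
  | zero => simp [binVal]
  | succ L ih =>
    have h1 := ih fun i hi => h i (by omega)
    have h2 : o L * 2 ^ L ≤ 1 * 2 ^ L := Nat.mul_le_mul_right _ (h L (by omega))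
    rw [binVal, Finset.sum_range_succ, pow_succ]
    rw [binVal] at h1
    omega

/-- Uniqueness of binary digits: a counter that has run through all values has run through all
choices of orientations. -/
theorem binVal_inj {L : ℕ} {o o' : ℕ → ℕ} (h : ∀ i < L, o i ≤ 1) (h' : ∀ i < L, o' i ≤ 1)
    (e : binVal L o = binVal L o') : ∀ i < L, o i = o' i := by
  induction L with
  | zero => intro i hi; omega
  | succ L ih =>
    have l1 := binVal_lt fun i hi => h i (Nat.lt_succ_of_lt hi)
    have l2 := binVal_lt fun i hi => h' i (Nat.lt_succ_of_lt hi)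
    have e1 : binVal (L + 1) o = binVal L o + o L * 2 ^ L := Finset.sum_range_succ _ _
    have e2 : binVal (L + 1) o' = binVal L o' + o' L * 2 ^ L := Finset.sum_range_succ _ _
    have b1 := h L (by omega)
    have b2 := h' L (by omega)
    have eL : o L = o' L := by
      interval_cases h1 : o L <;> interval_cases h2 : o' L <;> omega
    rw [e1, e2, eL] at e
    have := ih (fun i hi => h i (by omega)) (fun i hi => h' i (by omega)) (by omega)
    intro i hi
    rcases Nat.lt_succ_iff_lt_or_eq.1 hi with hi | rfl
    · exact this i hi
    · exact eL

theorem binVal_update {L : ℕ} {o : ℕ → ℕ} {i : ℕ} (hi : i < L) (y : ℕ) :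
    binVal L (Function.update o i y) + o i * 2 ^ i = binVal L o + y * 2 ^ i := by
  have hi' : i ∈ Finset.range L := Finset.mem_range.2 hi
  unfold binVal
  rw [← Finset.add_sum_erase _ _ hi', ← Finset.add_sum_erase _ (fun i => o i * 2 ^ i) hi']
  have : ∑ a ∈ (Finset.range L).erase i, Function.update o i y a * 2 ^ a =
      ∑ a ∈ (Finset.range L).erase i, o a * 2 ^ a := by
    refine Finset.sum_congr rfl fun a ha => ?_
    rw [Function.update_of_ne (Finset.ne_of_mem_erase ha)]
  rw [this, Function.update_self]
  omega

/-! ### Systems of equations in two variables -/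

/-- A sequence of equations `x (U j) + x (V j) = R j` over `𝔽₂` with weights `W j`. -/
structure EdgeSystem where
  U : ℕ → ℕ
  V : ℕ → ℕ
  R : ℕ → ℕ
  W : ℕ → ℕ

namespace EdgeSystem

variable (E : EdgeSystem)

/-- The `j`-th equation is violated. -/
def Viol (lab : ℕ → ℕ) (j : ℕ) : Prop := (lab (E.U j) + lab (E.V j) + E.R j) % 2 = 1

instance (lab : ℕ → ℕ) : DecidablePred (E.Viol lab) := fun _ => inferInstanceAs (Decidable (_ = _))

/-- The total weight of the violated equations among the first `J`. -/
def cost (J : ℕ) (lab : ℕ → ℕ) : ℕ := ∑ j ∈ Finset.range J, if E.Viol lab j then E.W j else 0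

/-- The number of violated equations before the `j`-th one. -/
def rank (lab : ℕ → ℕ) (j : ℕ) : ℕ := Nat.count (E.Viol lab) j

theorem rank_succ (lab : ℕ → ℕ) (j : ℕ) :
    E.rank lab (j + 1) = E.rank lab j + if E.Viol lab j then 1 else 0 := Nat.count_succ _ _

/-- Positive integral weights bound the number of violated equations by their weight; this limits
the number of bits to be guessed. -/
theorem rank_le_cost (hW : ∀ j, 0 < E.W j) (lab : ℕ → ℕ) (J : ℕ) : E.rank lab J ≤ E.cost J lab := by
  induction J with
  | zero => simp [rank]
  | succ J ih =>
    rw [rank, Nat.count_succ, cost, Finset.sum_range_succ]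
    have := hW J
    rw [rank, cost] at ih
    split_ifs <;> omega

section Network

variable (s t : ℕ) (lab o : ℕ → ℕ)

/-- Tail of the first edge that the network has for the `j`-th equation. -/
def p₀ (j : ℕ) : ℕ := if E.Viol lab j then s else E.U j

/-- Head of the first edge that the network has for the `j`-th equation. -/
def q₀ (j : ℕ) : ℕ :=
  if E.Viol lab j then (if 0 < o (E.rank lab j) then E.U j else E.V j) else E.V j

/-- Tail of the second edge that the network has for the `j`-th equation. -/
def p₁ (j : ℕ) : ℕ :=
  if E.Viol lab j then (if 0 < o (E.rank lab j) then E.V j else E.U j) else s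

/-- Head of the second edge that the network has for the `j`-th equation. -/
def q₁ (j : ℕ) : ℕ := if E.Viol lab j then t else s

/-- Sources of the arcs of the network. -/
def src (a : ℕ) : ℕ :=
  if a % 4 = 0 then E.p₀ s lab (a / 4) else if a % 4 = 1 then E.q₀ lab o (a / 4)
  else if a % 4 = 2 then E.p₁ s lab o (a / 4) else E.q₁ s t lab (a / 4)

/-- Targets of the arcs of the network. -/
def tgt (a : ℕ) : ℕ :=
  if a % 4 = 0 then E.q₀ lab o (a / 4) else if a % 4 = 1 then E.p₀ s lab (a / 4)
  else if a % 4 = 2 then E.q₁ s t lab (a / 4) else E.p₁ s lab o (a / 4)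

/-- Capacities of the arcs of the network. -/
def cap (a : ℕ) : ℕ := E.W (a / 4)

end Network

/-- The reverse of an arc. -/
def rev (a : ℕ) : ℕ := if a % 2 = 0 then a + 1 else a - 1

theorem rev_ne (a : ℕ) : rev a ≠ a := by unfold rev; split_ifs <;> omega

theorem rev_rev (a : ℕ) : rev (rev a) = a := by unfold rev; split_ifs <;> omega

theorem rev_lt {a J : ℕ} (h : a < 4 * J) : rev a < 4 * J := by unfold rev; split_ifs <;> omega

theorem rev_div (a : ℕ) : rev a / 4 = a / 4 := by unfold rev; split_ifs <;> omega

theorem src_rev (s t : ℕ) (lab o : ℕ → ℕ) (a : ℕ) :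
    E.src s t lab o (rev a) = E.tgt s t lab o a := by
  have h : a % 4 = 0 ∨ a % 4 = 1 ∨ a % 4 = 2 ∨ a % 4 = 3 := by omega
  unfold src tgt
  rw [rev_div]
  rcases h with h | h | h | h
  · have : rev a % 4 = 1 := by unfold rev; split_ifs <;> omega
    simp [h, this]
  · have : rev a % 4 = 0 := by unfold rev; split_ifs <;> omega
    simp [h, this]
  · have : rev a % 4 = 3 := by unfold rev; split_ifs <;> omega
    simp [h, this]
  · have : rev a % 4 = 2 := by unfold rev; split_ifs <;> omega
    simp [h, this]

theorem tgt_rev (s t : ℕ) (lab o : ℕ → ℕ) (a : ℕ) :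
    E.tgt s t lab o (rev a) = E.src s t lab o a := by
  rw [← src_rev, rev_rev]

open Classical in
-- Both directions of an edge carry the capacity `E.W j`, so an edge is counted once exactly if its
-- ends are separated. For a satisfied equation the second edge is a loop at `s`, which is never
-- cut; it is there so that each equation owns exactly four arcs.
theorem outCap_eq (s t : ℕ) (lab o : ℕ → ℕ) (J : ℕ) (Z : Set ℕ) :
    outCap (4 * J) (E.src s t lab o) (E.tgt s t lab o) E.cap Z =
      ∑ j ∈ Finset.range J,
        ((if E.p₀ s lab j ∈ Z ↔ E.q₀ lab o j ∈ Z then 0 else E.W j) +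
          (if E.p₁ s lab o j ∈ Z ↔ E.q₁ s t lab j ∈ Z then 0 else E.W j)) := by
  induction J with
  | zero => simp [outCap]
  | succ J ih =>
    rw [Finset.sum_range_succ, ← ih, outCap, outCap, show 4 * (J + 1) = 4 * J + 1 + 1 + 1 + 1 by ring,
      Finset.sum_range_succ, Finset.sum_range_succ, Finset.sum_range_succ, Finset.sum_range_succ]
    have m1 : (4 * J + 1) % 4 = 1 := by omega
    have m2 : (4 * J + 1 + 1) % 4 = 2 := by omega
    have m3 : (4 * J + 1 + 1 + 1) % 4 = 3 := by omega
    have d1 : (4 * J + 1) / 4 = J := by omega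
    have d2 : (4 * J + 1 + 1) / 4 = J := by omega
    have d3 : (4 * J + 1 + 1 + 1) / 4 = J := by omega
    have d0 : (4 * J) / 4 = J := by omega
    have m0 : (4 * J) % 4 = 0 := by omega
    simp only [src, tgt, cap, m0, m1, m2, m3, d0, d1, d2, d3, if_true]
    norm_num
    by_cases h0 : E.p₀ s lab J ∈ Z <;> by_cases h1 : E.q₀ lab o J ∈ Z <;>
      by_cases h2 : E.p₁ s lab o J ∈ Z <;> by_cases h3 : E.q₁ s t lab J ∈ Z <;>
      simp [h0, h1, h2, h3] <;> ring

open Classical in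
/-- The labelling that differs from `lab` on `Z`. -/
noncomputable def flip (lab : ℕ → ℕ) (Z : Set ℕ) (v : ℕ) : ℕ := if v ∈ Z then 1 - lab v else lab v

/-- Flipping the labels on the source side of a cut violates equations of at most the weight of
the cut. -/
theorem cost_flip_le {s t : ℕ} {lab : ℕ → ℕ} (hlab : ∀ v, lab v ≤ 1) (o : ℕ → ℕ) (J : ℕ)
    {Z : Set ℕ} (hs : s ∈ Z) (ht : t ∉ Z) :
    E.cost J (flip lab Z) ≤ outCap (4 * J) (E.src s t lab o) (E.tgt s t lab o) E.cap Z := by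
  classical
  rw [outCap_eq, cost]
  -- Compare equation by equation. A satisfied equation becomes violated only if its own edge is
  -- cut. A violated one stays violated only if both ends are in `Z` or neither is, and then one of
  -- the edges to `s` and `t` is cut.
  refine Finset.sum_le_sum fun j _ => ?_
  have h1 := hlab (E.U j)
  have h2 := hlab (E.V j)
  by_cases hv : E.Viol lab j <;> by_cases ho : 0 < o (E.rank lab j) <;>
    simp only [p₀, q₀, p₁, q₁, hv, ho, if_true, if_false, hs, ht, true_iff, iff_false] <;>
    unfold Viol flip at * <;>
    by_cases hu : E.U j ∈ Z <;> by_cases hw : E.V j ∈ Z <;>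
    simp only [hu, hw, if_true, if_false, not_true, not_false_iff, iff_true, true_iff] <;>
    split_ifs <;> omega

/-- If at most `L` equations are violated, then every labelling comes from a cut for some choice
of orientations, given by `L` bits. -/
theorem exists_cut {s t n : ℕ} (hU : ∀ j, E.U j ≤ n) (hV : ∀ j, E.V j ≤ n) (hnt : n < t)
    (hts : t < s) (lab lab' : ℕ → ℕ) {J L : ℕ} (hL : E.rank lab J ≤ L) :
    ∃ f : ℕ → ℕ, (∀ i, f i ≤ 1) ∧ ∀ o : ℕ → ℕ, (∀ i < L, o i = f i) →
      ∃ Z : Set ℕ, s ∈ Z ∧ t ∉ Z ∧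
        outCap (4 * J) (E.src s t lab o) (E.tgt s t lab o) E.cap Z = E.cost J lab' := by
  classical
  -- The set where the labellings differ, corrected at `s` and `t`. Both exceed `n`, so no end of an
  -- equation is affected.
  set Z : Set ℕ := {v | v = s ∨ (v ≠ t ∧ (lab' v + lab v) % 2 = 1)} with hZ
  -- The bit of a violated equation, addressed by its rank, records whether its first end lies in
  -- `Z`.
  set f : ℕ → ℕ := fun i => if ∃ j < J, E.Viol lab j ∧ E.rank lab j = i ∧ E.U j ∈ Z then 1 else 0
    with hf
  refine ⟨f, fun i => by simp only [hf]; split_ifs <;> omega, fun o ho => ⟨Z, ?_, ?_, ?_⟩⟩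
  · simp [hZ]
  · simp [hZ, hts.ne]
  have hsZ : s ∈ Z := by simp [hZ]
  have htZ : t ∉ Z := by simp [hZ, hts.ne]
  rw [outCap_eq, cost]
  refine Finset.sum_congr rfl fun j hj => ?_
  rw [Finset.mem_range] at hj
  have zu : E.U j ∈ Z ↔ (lab' (E.U j) + lab (E.U j)) % 2 = 1 := by
    have := hU j
    simp only [hZ, Set.mem_ofPred_eq]
    constructor
    · rintro (h | h)
      · omega
      · exact h.2
    · exact fun h => Or.inr ⟨by omega, h⟩
  have zv : E.V j ∈ Z ↔ (lab' (E.V j) + lab (E.V j)) % 2 = 1 := by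
    have := hV j
    simp only [hZ, Set.mem_ofPred_eq]
    constructor
    · rintro (h | h)
      · omega
      · exact h.2
    · exact fun h => Or.inr ⟨by omega, h⟩
  have e' : E.Viol lab' j ↔ (lab' (E.U j) + lab' (E.V j) + E.R j) % 2 = 1 := Iff.rfl
  have e : E.Viol lab j ↔ (lab (E.U j) + lab (E.V j) + E.R j) % 2 = 1 := Iff.rfl
  by_cases hv : E.Viol lab j
  · have hr : E.rank lab j < L := lt_of_lt_of_le (Nat.count_strict_mono hv hj) hL
    have hor : 0 < o (E.rank lab j) ↔ E.U j ∈ Z := by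
      rw [ho _ hr]
      simp only [hf]
      split_ifs with h
      · obtain ⟨j', _, hv', e, hu⟩ := h
        -- Violated equations have different ranks, so each of them has a bit of its own.
        rw [Nat.count_injective hv' hv e] at hu
        simp [hu]
      · simp only [lt_irrefl, false_iff]
        exact fun hu => h ⟨j, hj, hv, rfl, hu⟩
    simp only [p₀, q₀, p₁, q₁, hv, if_true, hsZ, htZ, true_iff, iff_false]
    by_cases hu : E.U j ∈ Z
    · rw [if_pos (hor.2 hu), if_pos (hor.2 hu), if_pos hu]
      rw [zu] at hu
      rw [e] at hv
      simp only [zv, e']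
      split_ifs <;> omega
    · rw [if_neg (mt hor.1 hu), if_neg (mt hor.1 hu), if_pos hu]
      rw [zu] at hu
      rw [e] at hv
      simp only [zv, e']
      split_ifs <;> omega
  · simp only [p₀, q₀, p₁, q₁, hv, if_false, iff_self, if_true, add_zero, zu, zv, e']
    rw [e] at hv
    split_ifs <;> omega

end EdgeSystem

/-! ### Graph search -/

/-- The invariant of the search of the residual graph with arcs `a < A` and residual capacities `r`
from the vertex `S`.  The discovered vertices are `q 0, …, q (qt - 1)`, the marked ones; the arcs
out of `q i` have been scanned for `i < qh`, and those out of `q qh` down to `cur`.  The scanned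
arcs form the set `P`. -/
structure SearchInv (A S : ℕ) (src tgt r : ℕ → ℕ) (P : Finset ℕ) (vis pa q : ℕ → ℕ)
    (qh qt cur : ℕ) : Prop where
  qt_pos : 1 ≤ qt
  qh_le : qh ≤ qt
  q_zero : q 0 = S
  inj : ∀ i < qt, ∀ i' < qt, q i = q i' → i = i'
  q_le : ∀ i < qt, q i ≤ S
  exists_of_vis : ∀ v, vis v = 1 → ∃ i < qt, q i = v
  vis_q : ∀ i < qt, vis (q i) = 1
  vis_le : ∀ v, vis v ≤ 1
  parent : ∀ i < qt, 0 < i → pa (q i) < A ∧ tgt (pa (q i)) = q i ∧ 0 < r (pa (q i)) ∧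
    ∃ i' < i, src (pa (q i)) = q i'
  lt : ∀ a ∈ P, a < A
  closed : ∀ a ∈ P, 0 < r a → vis (tgt a) = 1
  scanned : ∀ a ∈ P, (∃ i < qh, src a = q i) ∨ (qh < qt ∧ src a = q qh ∧ cur ≤ a)
  mem_of_lt : ∀ a < A, (∃ i < qh, src a = q i) → a ∈ P
  mem_of_cur : qh < qt → ∀ a < A, src a = q qh → cur ≤ a → a ∈ P
  cur_le : qh < qt → cur ≤ A ∧ (0 < cur → src (cur - 1) = q qh)

namespace SearchInv

variable {A S : ℕ} {src tgt r : ℕ → ℕ} {P : Finset ℕ} {vis pa q : ℕ → ℕ} {qh qt cur : ℕ}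

theorem init (vis pa q : ℕ → ℕ) (hvis : ∀ v, vis v = 0) :
    SearchInv A S src tgt r ∅ (Function.update vis S 1) pa (Function.update q 0 S) 0 1
      (lastArc src S A) where
  qt_pos := le_rfl
  qh_le := by omega
  q_zero := by simp
  inj i hi i' hi' _ := by omega
  q_le i hi := by simp [show i = 0 by omega]
  exists_of_vis v hv := by
    refine ⟨0, by omega, ?_⟩
    by_contra h
    rw [Function.update_self] at h
    rw [Function.update_of_ne (Ne.symm h), hvis] at hv
    omega
  vis_q i hi := by simp [show i = 0 by omega]
  vis_le v := by
    by_cases h : v = S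
    · subst h; simp
    · simp [h, hvis]
  parent i hi h := by omega
  lt a ha := by simp at ha
  closed a ha := by simp at ha
  scanned a ha := by simp at ha
  mem_of_lt a _ := by simp
  mem_of_cur _ a ha hs hc := by
    rw [Function.update_self] at hs
    have := lt_lastArc ha hs
    omega
  cur_le _ := by
    rw [Function.update_self]
    exact ⟨lastArc_le _ _ _, src_lastArc⟩

/-- Scanned arcs leave an earlier vertex, excluded since listed vertices are distinct, or are at
least `cur`. Hence each scan enlarges `P`, which makes the search terminate. -/
theorem notMem (H : SearchInv A S src tgt r P vis pa q qh qt cur) (h : qh < qt) (hc : 0 < cur) :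
    cur - 1 ∉ P := by
  intro hP
  rcases H.scanned _ hP with ⟨i, hi, e⟩ | ⟨_, _, hle⟩
  · rw [(H.cur_le h).2 hc] at e
    have := H.inj _ h _ (by omega) e
    omega
  · omega

theorem card_le (H : SearchInv A S src tgt r P vis pa q qh qt cur) : P.card ≤ A := by
  have : P ⊆ Finset.range A := fun a ha => Finset.mem_range.2 (H.lt a ha)
  simpa using Finset.card_le_card this

/-- Scanning an arc that leads to no new vertex. -/
theorem scan (H : SearchInv A S src tgt r P vis pa q qh qt cur) (h : qh < qt) (hc : 0 < cur)
    (hv : 0 < r (cur - 1) → vis (tgt (cur - 1)) = 1) :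
    SearchInv A S src tgt r (insert (cur - 1) P) vis pa q qh qt
      (lastArc src (src (cur - 1)) (cur - 1)) :=
  have hs := (H.cur_le h).2 hc
  { H with
    lt := by
      intro a ha
      rcases Finset.mem_insert.1 ha with rfl | ha
      · have := (H.cur_le h).1; omega
      · exact H.lt a ha
    closed := by
      intro a ha
      rcases Finset.mem_insert.1 ha with rfl | ha
      · exact hv
      · exact H.closed a ha
    scanned := by
      have hle := lastArc_le src (src (cur - 1)) (cur - 1)
      intro a ha
      rcases Finset.mem_insert.1 ha with rfl | ha
      · exact Or.inr ⟨h, hs, hle⟩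
      · rcases H.scanned a ha with h' | ⟨h1, h2, h3⟩
        · exact Or.inl h'
        · exact Or.inr ⟨h1, h2, by omega⟩
    mem_of_lt := fun a ha h' => Finset.mem_insert_of_mem (H.mem_of_lt a ha h')
    mem_of_cur := by
      intro _ a ha e hle
      by_cases h1 : a = cur - 1
      · subst h1; exact Finset.mem_insert_self _ _
      · by_cases h2 : cur ≤ a
        · exact Finset.mem_insert_of_mem (H.mem_of_cur h a ha e h2)
        · have := lt_lastArc (src := src) (show a < cur - 1 by omega) (e.trans hs.symm)
          omega
    cur_le := by
      intro _
      have hle := lastArc_le src (src (cur - 1)) (cur - 1)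
      have := (H.cur_le h).1
      refine ⟨by omega, fun h0 => ?_⟩
      rw [src_lastArc h0, hs] }

/-- Discovering a new vertex. -/
theorem push (H : SearchInv A S src tgt r P vis pa q qh qt cur) (h : qh < qt) (hc : 0 < cur)
    (hr : 0 < r (cur - 1)) (hv : vis (tgt (cur - 1)) = 0) (hS : tgt (cur - 1) ≤ S) :
    SearchInv A S src tgt r P (Function.update vis (tgt (cur - 1)) 1)
      (Function.update pa (tgt (cur - 1)) (cur - 1)) (Function.update q qt (tgt (cur - 1)))
      qh (qt + 1) cur := by
  set y := tgt (cur - 1) with hy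
  have hq : ∀ i < qt, Function.update q qt y i = q i := fun i hi =>
    Function.update_of_ne hi.ne _ _
  have hne : ∀ i < qt, q i ≠ y := by
    intro i hi e
    have := H.vis_q i hi
    rw [e, hv] at this
    omega
  have hvis : ∀ v, vis v = 1 → Function.update vis y 1 v = 1 := by
    intro v h1
    by_cases e : v = y
    · subst e; simp
    · rw [Function.update_of_ne e, h1]
  refine
  { qt_pos := by omega
    qh_le := by omega
    q_zero := by rw [hq 0 (by omega), H.q_zero]
    inj := ?_
    q_le := ?_
    exists_of_vis := ?_
    vis_q := ?_
    vis_le := ?_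
    parent := ?_
    lt := H.lt
    closed := fun a ha h0 => hvis _ (H.closed a ha h0)
    scanned := ?_
    mem_of_lt := ?_
    mem_of_cur := ?_
    cur_le := ?_ }
  · intro i hi i' hi' e
    by_cases h1 : i = qt <;> by_cases h2 : i' = qt
    · omega
    · rw [h1, Function.update_self, hq i' (by omega)] at e
      exact absurd e.symm (hne i' (by omega))
    · rw [h2, Function.update_self, hq i (by omega)] at e
      exact absurd e (hne i (by omega))
    · rw [hq i (by omega), hq i' (by omega)] at e
      exact H.inj i (by omega) i' (by omega) e
  · intro i hi
    by_cases h1 : i = qt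
    · subst h1; simpa using hS
    · rw [hq i (by omega)]; exact H.q_le i (by omega)
  · intro v h1
    by_cases e : v = y
    · exact ⟨qt, by omega, by rw [Function.update_self, e]⟩
    · rw [Function.update_of_ne e] at h1
      obtain ⟨i, hi, e'⟩ := H.exists_of_vis v h1
      exact ⟨i, by omega, by rw [hq i hi, e']⟩
  · intro i hi
    by_cases h1 : i = qt
    · subst h1; simp
    · rw [hq i (by omega)]; exact hvis _ (H.vis_q i (by omega))
  · intro v
    by_cases e : v = y
    · subst e; simp
    · rw [Function.update_of_ne e]; exact H.vis_le v
  · intro i hi h0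
    by_cases h1 : i = qt
    · subst h1
      simp only [Function.update_self]
      -- The parent arc of the new vertex leaves `q qh`, which stands earlier in the queue; so
      -- following parents strictly lowers the position.
      refine ⟨by have := (H.cur_le h).1; omega, rfl, hr, qh, h, ?_⟩
      rw [hq _ h]
      exact (H.cur_le h).2 hc
    · have hi' : i < qt := by omega
      rw [hq i hi', Function.update_of_ne (hne i hi')]
      obtain ⟨h1, h2, h3, i', h4, h5⟩ := H.parent i hi' h0
      exact ⟨h1, h2, h3, i', h4, by rw [hq i' (by omega), h5]⟩
  · intro a ha
    rcases H.scanned a ha with ⟨i, hi, e⟩ | ⟨h1, h2, h3⟩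
    · exact Or.inl ⟨i, hi, by rw [hq i (by omega), e]⟩
    · exact Or.inr ⟨by omega, by rw [hq _ h, h2], h3⟩
  · rintro a ha ⟨i, hi, e⟩
    exact H.mem_of_lt a ha ⟨i, hi, by rw [e, hq i (by omega)]⟩
  · intro _ a ha e hle
    rw [hq _ h] at e
    exact H.mem_of_cur h a ha e hle
  · intro _
    rw [hq _ h]
    exact H.cur_le h

/-- Going on to the next discovered vertex. -/
theorem pop (H : SearchInv A S src tgt r P vis pa q qh qt 0) (h : qh < qt) {cur' : ℕ}
    (hc : qh + 1 < qt → cur' = lastArc src (q (qh + 1)) A) :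
    SearchInv A S src tgt r P vis pa q (qh + 1) qt cur' :=
  { H with
    qh_le := h
    scanned := by
      intro a ha
      rcases H.scanned a ha with ⟨i, hi, e⟩ | ⟨_, h2, _⟩
      · exact Or.inl ⟨i, by omega, e⟩
      · exact Or.inl ⟨qh, by omega, h2⟩
    mem_of_lt := by
      rintro a ha ⟨i, hi, e⟩
      rcases Nat.lt_succ_iff_lt_or_eq.1 hi with hi | rfl
      · exact H.mem_of_lt a ha ⟨i, hi, e⟩
      · exact H.mem_of_cur h a ha e (Nat.zero_le _)
    mem_of_cur := by
      intro h' a ha e hle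
      -- The list of the next vertex starts at its largest arc, so nothing at or above the starting
      -- point needs to have been scanned.
      have := lt_lastArc ha e
      rw [← hc h'] at this
      omega
    cur_le := by
      intro h'
      rw [hc h']
      exact ⟨lastArc_le _ _ _, src_lastArc⟩ }

end SearchInv

/-! ### The search program -/

namespace RAM

/-- The stores `h` and `h'` differ at most in the variables `vs` and the arrays `as`. -/
def Frame (vs : List Var) (as : List Arr) (h h' : Store) : Prop :=
  (∀ r, r ∉ vs → h'.v r = h.v r) ∧ ∀ f, f ∉ as → h'.a f = h.a f

namespace Frame

variable {vs : List Var} {as : List Arr} {h h' h'' : Store}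

theorem refl : Frame vs as h h := ⟨fun _ _ => rfl, fun _ _ => rfl⟩

theorem trans (H : Frame vs as h h') (H' : Frame vs as h' h'') : Frame vs as h h'' :=
  ⟨fun r hr => (H'.1 r hr).trans (H.1 r hr), fun f hf => (H'.2 f hf).trans (H.2 f hf)⟩

theorem mono {vs' : List Var} {as' : List Arr} (H : Frame vs as h h') (hv : vs ⊆ vs')
    (ha : as ⊆ as') : Frame vs' as' h h' :=
  ⟨fun r hr => H.1 r fun h => hr (hv h), fun f hf => H.2 f fun h => hf (ha h)⟩

theorem set (H : Frame vs as h h') {r : Var} (hr : r ∈ vs) (x : ℕ) : Frame vs as h (h'.set r x) :=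
  ⟨fun r' hr' => by
    rw [Store.set_v, if_neg (by rintro rfl; exact hr' hr), H.1 r' hr'], H.2⟩

theorem put (H : Frame vs as h h') {f : Arr} (hf : f ∈ as) (i x : ℕ) :
    Frame vs as h (h'.put f i x) :=
  ⟨H.1, fun f' hf' => by
    rw [Store.put_a, if_neg (by rintro rfl; exact hf' hf), H.2 f' hf']⟩

end Frame

/-- The arrays hold adjacency lists of the graph with arcs `a < A` between vertices `≤ S`. -/
structure IsNet (A S : ℕ) (src tgt : ℕ → ℕ) (h : Store) : Prop where
  var_A : h.v .A = A
  var_s : h.v .s = S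
  src_eq : ∀ a < A, h.a .src a = src a
  tgt_eq : ∀ a < A, h.a .tgt a = tgt a
  rv_eq : ∀ a < A, h.a .rv a = EdgeSystem.rev a
  nx_eq : ∀ a < A, h.a .nx a = lastArc src (src a) a
  hd_eq : ∀ v, h.a .hd v = lastArc src v A

/-- The residual capacities `rs` are not part of `IsNet`, so the network survives augmentations.
That the changed variables and arrays are harmless is decided automatically. -/
theorem IsNet.frame {A S : ℕ} {src tgt : ℕ → ℕ} {h h' : Store} {vs : List Var} {as : List Arr}
    (H : IsNet A S src tgt h) (F : Frame vs as h h')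
    (hvs : .A ∉ vs ∧ .s ∉ vs := by decide)
    (has : .src ∉ as ∧ .tgt ∉ as ∧ .rv ∉ as ∧ .nx ∉ as ∧ .hd ∉ as := by decide) :
    IsNet A S src tgt h' := by
  obtain ⟨h1, h2, h3, h4, h5⟩ := has
  exact ⟨by rw [F.1 _ hvs.1, H.var_A], by rw [F.1 _ hvs.2, H.var_s], by rw [F.2 _ h1]; exact H.src_eq,
    by rw [F.2 _ h2]; exact H.tgt_eq, by rw [F.2 _ h3]; exact H.rv_eq,
    by rw [F.2 _ h4]; exact H.nx_eq, by rw [F.2 _ h5]; exact H.hd_eq⟩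

/-- Start of the search. -/
def searchInit : Cmd :=
  .set .qh (.c 0) ;; .set .qt (.c 1) ;; .put .q (.c 0) (.v .s) ;; .put .vis (.v .s) (.c 1) ;;
  .set .cur (.a .hd (.v .s))

/-- One step of the search. -/
def searchStep : Cmd :=
  .ite (.c 0) (.v .cur)
    (.set .x (.sub (.v .cur) (.c 1)) ;; .set .y (.a .tgt (.v .x)) ;;
      .ite (.a .vis (.v .y)) (.c 1)
        (.ite (.c 0) (.a .rs (.v .x))
          (.put .vis (.v .y) (.c 1) ;; .put .pa (.v .y) (.v .x) ;; .put .q (.v .qt) (.v .y) ;;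
            .set .qt (.add (.v .qt) (.c 1)))
          .skip)
        .skip ;;
      .set .cur (.a .nx (.v .x)))
    (.set .qh (.add (.v .qh) (.c 1)) ;;
      .ite (.v .qh) (.v .qt) (.set .cur (.a .hd (.a .q (.v .qh)))) .skip)

/-- Search of the residual graph from the vertex `s`. -/
def search : Prog := .seq searchInit.code (whileLt (.v .qh) (.v .qt) searchStep.code)

/-- The state after a search: the vertices that can be reached are marked and listed in `q`. -/
structure Searched (A S : ℕ) (src tgt : ℕ → ℕ) (h : Store) : Prop where
  inv : ∃ P, SearchInv A S src tgt (h.a .rs) P (h.a .vis) (h.a .pa) (h.a .q) (h.v .qh) (h.v .qt)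
    (h.v .cur)
  eq : h.v .qh = h.v .qt
  qt_le : h.v .qt ≤ A + 1

theorem tri_search {D B A S : ℕ} {src tgt : ℕ → ℕ} {h : Store} (hB : 16 * D ≤ B)
    (hA : A + 1 < D) (hS : S < D) (htgt : ∀ a < A, tgt a ≤ S) (hnet : IsNet A S src tgt h)
    (hvis : ∀ v, h.a .vis v = 0) :
    Tri D B search (200 * (A + 1)) h fun h' =>
      Frame [.qh, .qt, .cur, .x, .y] [.vis, .pa, .q] h h' ∧ Searched A S src tgt h' := by
  -- The potential counts each unscanned arc twice and each waiting vertex once: a scan loses two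
  -- and gains at most one, going on to the next vertex loses one. The bound on `qt` charges every
  -- vertex but the root to a scanned arc, so the search costs `O(A)`.
  set I : ℕ → Store → Prop := fun n h' =>
    Frame [.qh, .qt, .cur, .x, .y] [.vis, .pa, .q] h h' ∧ ∃ P,
      SearchInv A S src tgt (h.a .rs) P (h'.a .vis) (h'.a .pa) (h'.a .q) (h'.v .qh) (h'.v .qt)
        (h'.v .cur) ∧ h'.v .qt ≤ P.card + 1 ∧
      n = 2 * (A - P.card) + (h'.v .qt - h'.v .qh) with hI
  have hloop : ∀ h', I (2 * A + 1) h' → Tri D B (whileLt (.v .qh) (.v .qt) searchStep.code)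
      ((searchStep.cost + 2 + 1) * (2 * A + 1) + 3) h' fun h' =>
      Frame [.qh, .qt, .cur, .x, .y] [.vis, .pa, .q] h h' ∧ Searched A S src tgt h' := by
    intro h' hI'
    refine Tri.whileLt hB I (fun _ _ _ => by simp only [Expr.ok, and_self]) ?_ ?_ hI'
    · rintro n h' ⟨F, P, H, hqt, hn⟩ hlt
      simp only [Expr.val] at hlt
      have hP := H.card_le
      have hN := hnet.frame F
      have hrs : h'.a .rs = h.a .rs := F.2 _ (by decide)
      refine Tri.of_wp hB _ ?_
      by_cases hc : 0 < h'.v .cur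
      · have hcA := (H.cur_le hlt).1
        have hx : h'.v .cur - 1 < A := by omega
        have hnm := H.notMem hlt hc
        have hcard := Finset.card_insert_of_notMem hnm
        have hy := htgt _ hx
        have hPA : (insert (h'.v .cur - 1) P).card ≤ A := by
          refine (Finset.card_le_card (t := Finset.range A) fun a ha => ?_).trans (by simp)
          rcases Finset.mem_insert.1 ha with rfl | ha
          · simpa using hx
          · simpa using H.lt a ha
        simp only [searchStep, Cmd.wp, Expr.val, Expr.ok, Store.set_v, Store.set_a, Store.put_v,
          Store.put_a, hc, reduceCtorEq, if_true, if_false, not_true, true_implies, false_implies,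
          true_and, and_true, hN.tgt_eq _ hx, hN.nx_eq _ hx, hrs, hI]
        refine ⟨by omega, by omega, by omega, by omega, by omega, ?_, ?_⟩
        · intro hv
          refine ⟨by omega, by omega, ?_, ?_⟩
          · intro hr
            refine ⟨by omega, by omega, by omega, by omega, ⟨by omega, by omega⟩, by omega, ?_⟩
            -- The head is marked first; then the arc counts as scanned, since it now leads to a
            -- marked vertex.
            refine ⟨_, ?_, ?_, _, (H.push hlt hc hr (by omega) hy).scan (by omega) hc
              (fun _ => by simp), ?_, rfl⟩
            · omega
            · refine Frame.set (Frame.set (Frame.put (Frame.put (Frame.put (Frame.set (Frame.set F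
                ?_ _) ?_ _) ?_ _ _) ?_ _ _) ?_ _ _) ?_ _) ?_ _ <;> decide
            · omega
          · intro hr
            refine ⟨by omega, _, ?_, ?_, _, H.scan hlt hc (fun h0 => absurd h0 hr), ?_, rfl⟩
            · omega
            · refine Frame.set (Frame.set (Frame.set F ?_ _) ?_ _) ?_ _ <;> decide
            · omega
        · intro hv
          have := H.vis_le (tgt (h'.v .cur - 1))
          refine ⟨by omega, _, ?_, ?_, _, H.scan hlt hc (fun _ => by omega), ?_, rfl⟩
          · omega
          · refine Frame.set (Frame.set (Frame.set F ?_ _) ?_ _) ?_ _ <;> decide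
          · omega
      · have hc0 : h'.v .cur = 0 := by omega
        rw [hc0] at H
        simp only [searchStep, Cmd.wp, Expr.val, Expr.ok, Store.set_v, Store.set_a, Store.put_v,
          Store.put_a, hc, reduceCtorEq, if_true, if_false, not_false_iff, true_implies,
          false_implies, true_and, hI]
        refine ⟨by omega, ⟨by omega, by omega⟩, ?_, ?_⟩
        · intro hlt'
          have := H.q_le _ hlt'
          refine ⟨⟨by omega, by omega⟩, _, ?_, ?_, P, H.pop hlt (fun _ => hN.hd_eq _), hqt, rfl⟩
          · omega
          · refine Frame.set (Frame.set F ?_ _) ?_ _ <;> decide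
        · intro hlt'
          refine ⟨_, ?_, ?_, P, H.pop hlt (fun h0 => absurd h0 hlt'), hqt, rfl⟩
          · omega
          · exact Frame.set F (by decide) _
    · rintro n h' ⟨F, P, H, hqt, hn⟩ hlt
      simp only [Expr.val] at hlt
      have hrs : h'.a .rs = h.a .rs := F.2 _ (by decide)
      have := H.card_le
      have := H.qh_le
      exact ⟨F, ⟨P, by rw [hrs]; exact H⟩, by omega, by omega⟩
  refine Tri.mono (Tri.seq' (Tri.of_wp hB searchInit (Q := I (2 * A + 1)) ?_) hloop) ?_
    (fun _ h => h)
  · simp only [searchInit, Cmd.wp, Expr.val, Expr.ok, Store.set_v, Store.set_a, Store.put_v,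
      Store.put_a, reduceCtorEq, if_true, if_false, true_and, hnet.var_s, hnet.hd_eq, hI]
    refine ⟨by omega, by omega, by omega, by omega, by omega, by omega, by omega, ?_, ∅,
      SearchInv.init _ _ _ hvis, ?_, ?_⟩
    · refine Frame.set (Frame.put (Frame.put (Frame.set (Frame.set Frame.refl
        ?_ _) ?_ _) ?_ _ _) ?_ _ _) ?_ _ <;> decide
    · simp
    · simp [mul_comm]
  · have h1 : searchInit.cost ≤ 40 := by decide
    have h2 : searchStep.cost ≤ 60 := by decide
    have := Nat.mul_le_mul_right (2 * A + 1) (show searchStep.cost + 2 + 1 ≤ 63 by omega)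
    omega

end RAM

/-! ### Augmentation along the search tree -/

open Classical in
/-- The invariant of the augmentation along the search tree towards the vertex `T`: one unit of flow
has been pushed from `q i` to `T`, changing the residual capacities from `r` to `r'`. -/
structure AugmentInv (A S T : ℕ) (src tgt r : ℕ → ℕ) (pa q : ℕ → ℕ) (i : ℕ) (r' : ℕ → ℕ) :
    Prop where
  pos : ∀ i' ≤ i, 0 < i' → 0 < r' (pa (q i'))
  sum : ∀ a < A, r' a + r' (EdgeSystem.rev a) = r a + r (EdgeSystem.rev a)
  out : ∀ Z : Set ℕ, S ∈ Z → T ∉ Z →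
    outCap A src tgt r' Z + (if q i ∈ Z then 1 else 0) = outCap A src tgt r Z

open Classical in
-- One more tree arc towards the root is used. Its capacity drops, but the tree arcs of other
-- vertices have other targets and hence differ from it; if the reverse arc is among them, it only
-- gains. By `outCap_push` the unit of excess at `q i` moves to `q i'`.
theorem AugmentInv.step {A S T : ℕ} {src tgt r : ℕ → ℕ} {P : Finset ℕ} {vis pa q : ℕ → ℕ}
    {qh qt cur i : ℕ} {r' : ℕ → ℕ} (H : SearchInv A S src tgt r P vis pa q qh qt cur)
    (hrev : ∀ a < A, EdgeSystem.rev a < A ∧ src (EdgeSystem.rev a) = tgt a ∧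
      tgt (EdgeSystem.rev a) = src a)
    (K : AugmentInv A S T src tgt r pa q i r') (hi : i < qt) (h0 : 0 < i) {i' : ℕ} (hi' : i' < i)
    (e : src (pa (q i)) = q i') :
    AugmentInv A S T src tgt r pa q i'
      (Function.update (Function.update r' (pa (q i)) (r' (pa (q i)) - 1))
        (EdgeSystem.rev (pa (q i))) (r' (EdgeSystem.rev (pa (q i))) + 1)) := by
  obtain ⟨hA, ht, -, -⟩ := H.parent i hi h0
  set x := pa (q i) with hx
  have hr := K.pos i le_rfl h0
  rw [← hx] at hr
  have hne := EdgeSystem.rev_ne x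
  obtain ⟨hxA, hsx, htx⟩ := hrev x hA
  constructor
  · intro j hj h1
    have hjx : pa (q j) ≠ x := by
      intro e'
      have := (H.parent j (by omega) h1).2.1
      rw [e', ht] at this
      have := H.inj _ hi _ (by omega) this
      omega
    have := K.pos j (by omega) h1
    by_cases e' : pa (q j) = EdgeSystem.rev x
    · rw [e', Function.update_self]; omega
    · rwa [Function.update_of_ne e', Function.update_of_ne hjx]
  · intro a ha
    rw [← K.sum a ha]
    by_cases e1 : a = x
    · subst e1
      rw [Function.update_of_ne hne.symm, Function.update_self, Function.update_self]
      omega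
    · by_cases e2 : a = EdgeSystem.rev x
      · rw [e2, EdgeSystem.rev_rev, Function.update_self, Function.update_of_ne hne.symm,
          Function.update_self]
        omega
      · have e3 : EdgeSystem.rev a ≠ x := fun e3 => e2 (by rw [← e3, EdgeSystem.rev_rev])
        have e4 : EdgeSystem.rev a ≠ EdgeSystem.rev x := fun e4 => e1 (by
          rw [← EdgeSystem.rev_rev a, e4, EdgeSystem.rev_rev])
        rw [Function.update_of_ne e2, Function.update_of_ne e1, Function.update_of_ne e4,
          Function.update_of_ne e3]
  · intro Z hS hT
    have h1 := outCap_push (src := src) (tgt := tgt) (c := r') Z hA hxA hne hsx htx hr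
    have h2 := K.out Z hS hT
    rw [ht, e] at h1
    omega

theorem outCap_congr {A : ℕ} {src tgt c c' : ℕ → ℕ} (h : ∀ a < A, c a = c' a) (Z : Set ℕ) :
    outCap A src tgt c Z = outCap A src tgt c' Z := by
  classical
  refine Finset.sum_congr rfl fun a ha => ?_
  rw [h a (Finset.mem_range.1 ha)]

/-- Applied to the set of vertices reached by a failed search, which no residual arc leaves. -/
theorem outCap_eq_zero {A : ℕ} {src tgt c : ℕ → ℕ} {Z : Set ℕ}
    (h : ∀ a < A, src a ∈ Z → 0 < c a → tgt a ∈ Z) : outCap A src tgt c Z = 0 := by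
  classical
  refine Finset.sum_eq_zero fun a ha => ?_
  split_ifs with hz
  · by_contra h0
    exact hz.2 (h a (Finset.mem_range.1 ha) hz.1 (by omega))
  · rfl

namespace RAM

/-- One step of the augmentation. -/
def augmentStep : Cmd :=
  .set .x (.a .pa (.v .y)) ;; .put .rs (.v .x) (.sub (.a .rs (.v .x)) (.c 1)) ;;
  .put .rs (.a .rv (.v .x)) (.add (.a .rs (.a .rv (.v .x))) (.c 1)) ;;
  .set .y (.a .src (.v .x))

/-- Augmentation of the flow along the path to `t` that has been found. -/
def augment : Prog :=
  .seq (Cmd.set .y (.v .t)).code (whileLt (.v .y) (.v .s) augmentStep.code)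

/-- The path is walked from `T` back to `S` along parent arcs. As `S` is the largest vertex number,
the test `y < s` detects its end. Since the sum of the residual capacities of an arc and its reverse
is preserved, the bound `hr` excludes overflow. -/
theorem tri_augment {D B A S T : ℕ} {src tgt : ℕ → ℕ} {h : Store} (hB : 16 * D ≤ B)
    (hA : A < D) (hS : S < D)
    (hrev : ∀ a < A, EdgeSystem.rev a < A ∧ src (EdgeSystem.rev a) = tgt a ∧
      tgt (EdgeSystem.rev a) = src a)
    (hr : ∀ a < A, h.a .rs a + h.a .rs (EdgeSystem.rev a) ≤ B)
    (hnet : IsNet A S src tgt h) (hs : Searched A S src tgt h) (hT : h.v .t = T)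
    (hvis : 0 < h.a .vis T) :
    Tri D B augment (200 * (A + 1)) h fun h' => Frame [.x, .y] [.rs] h h' ∧
      (∀ a < A, h'.a .rs a + h'.a .rs (EdgeSystem.rev a) =
        h.a .rs a + h.a .rs (EdgeSystem.rev a)) ∧
      ∀ Z : Set ℕ, S ∈ Z → T ∉ Z →
        outCap A src tgt (h'.a .rs) Z + 1 = outCap A src tgt (h.a .rs) Z := by
  obtain ⟨⟨P, H⟩, -, hqt⟩ := hs
  obtain ⟨i₀, hi₀, e₀⟩ := H.exists_of_vis T (by have := H.vis_le T; omega)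
  set I : ℕ → Store → Prop := fun n h' => Frame [.x, .y] [.rs] h h' ∧ n < h.v .qt ∧
    h'.v .y = h.a .q n ∧
    AugmentInv A S T src tgt (h.a .rs) (h.a .pa) (h.a .q) n (h'.a .rs) with hI
  have hloop : ∀ h', I i₀ h' → Tri D B (whileLt (.v .y) (.v .s) augmentStep.code)
      ((augmentStep.cost + 2 + 1) * i₀ + 3) h' fun h' => Frame [.x, .y] [.rs] h h' ∧
      (∀ a < A, h'.a .rs a + h'.a .rs (EdgeSystem.rev a) =
        h.a .rs a + h.a .rs (EdgeSystem.rev a)) ∧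
      ∀ Z : Set ℕ, S ∈ Z → T ∉ Z →
        outCap A src tgt (h'.a .rs) Z + 1 = outCap A src tgt (h.a .rs) Z := by
    intro h' hI'
    refine Tri.whileLt hB I (fun _ _ _ => by simp only [Expr.ok, and_self]) ?_ ?_ hI'
    · rintro n h' ⟨F, hn, hy, K⟩ hlt
      have hN := hnet.frame F
      simp only [Expr.val, hN.var_s] at hlt
      have h0 : 0 < n := by
        rcases Nat.eq_zero_or_pos n with rfl | h0
        · rw [hy, H.q_zero] at hlt; omega
        · exact h0
      obtain ⟨hx, ht, -, i', hi', e⟩ := H.parent n hn h0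
      have hpa : h'.a .pa = h.a .pa := F.2 _ (by decide)
      obtain ⟨hx', -, -⟩ := hrev _ hx
      have hsum := K.sum _ hx
      have hle := hr _ hx
      have hpos := K.pos n le_rfl h0
      have hne := EdgeSystem.rev_ne (h.a .pa (h.a .q n))
      refine Tri.of_wp hB _ ?_
      simp only [augmentStep, Cmd.wp, Expr.val, Expr.ok, Store.set_v, Store.set_a, Store.put_v,
        Store.put_a, reduceCtorEq, if_true, if_false, true_and, hI, hpa, hy, hN.rv_eq _ hx,
        hN.src_eq _ hx, Function.update_of_ne hne]
      refine ⟨by rw [← hy]; omega, ⟨by omega, by omega⟩, by omega, by omega,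
        ⟨⟨by omega, by omega⟩, by omega, by omega⟩, by omega, by omega, i', hi', ?_, by omega, e,
        K.step H hrev hn h0 hi' e⟩
      refine Frame.set (Frame.put (Frame.put (Frame.set F ?_ _) ?_ _ _) ?_ _ _) ?_ _ <;> decide
    · rintro n h' ⟨F, hn, hy, K⟩ hlt
      have hN := hnet.frame F
      simp only [Expr.val, hN.var_s] at hlt
      have h1 := H.q_le n hn
      -- On exit `q n = S = q 0`, so distinctness of the queue gives `n = 0`: the unit has been
      -- pushed all the way from `S`.
      have h2 := H.inj n hn 0 (by omega) (by rw [H.q_zero]; omega)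
      subst h2
      refine ⟨F, K.sum, fun Z hZ hZ' => ?_⟩
      have := K.out Z hZ hZ'
      rwa [H.q_zero, if_pos hZ] at this
  refine Tri.mono (Tri.seq' (Tri.of_wp hB (.set .y (.v .t)) (Q := I i₀) ?_) hloop) ?_
    (fun _ h => h)
  · simp only [Cmd.wp, Expr.val, Expr.ok, Store.set_v, Store.set_a, true_and, hI, hT, if_true]
    refine ⟨Frame.set Frame.refl (by decide) _, hi₀, e₀.symm, ?_, fun _ _ => rfl, ?_⟩
    · intro i' hi' h0
      exact (H.parent i' (by omega) h0).2.2.1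
    · intro Z _ hT'
      rw [e₀, if_neg hT', add_zero]
  · have h1 : (Cmd.set .y (.v .t)).cost ≤ 40 := by decide
    have h2 : augmentStep.cost ≤ 60 := by decide
    have := Nat.mul_le_mul (show augmentStep.cost + 2 + 1 ≤ 63 by omega)
      (show i₀ ≤ A + 1 by omega)
    omega

/-- `for i < n do c; i := i + 1`. -/
def forLt (e : Expr) (c : Cmd) : Prog :=
  .seq (Cmd.set .i (.c 0)).code (whileLt (.v .i) e (c ;; .set .i (.add (.v .i) (.c 1))).code)

/-- The rule for counting loops. -/
theorem Tri.forLt {D B N : ℕ} {h : Store} {e : Expr} {c : Cmd} (hB : 16 * D ≤ B) (hN : N < B)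
    (I : ℕ → Store → Prop) (h0 : I 0 (h.set .i 0))
    (hok : ∀ n h, I n h → e.ok D B h ∧ e.val h = N)
    (hbody : ∀ n h, I n h → h.v .i = n → n < N →
      c.wp D B (fun h' => h'.v .i = n ∧ I (n + 1) (h'.set .i (n + 1))) h) :
    Tri D B (forLt e c) ((c.cost + 2 * e.cost + 10) * (N + 1)) h (I N) := by
  -- The rule for `whileLt` counts down, so its index is the number of passes left.
  set I' : ℕ → Store → Prop := fun n h' => h'.v .i = N - n ∧ n ≤ N ∧ I (N - n) h' with hI'
  have hloop : ∀ h', I' N h' → Tri D B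
      (RAM.whileLt (.v .i) e (c ;; .set .i (.add (.v .i) (.c 1))).code)
      (((c ;; .set .i (.add (.v .i) (.c 1))).cost + (1 + e.cost) + 1) * N + (1 + e.cost + 1)) h'
      (I N) := by
    intro h' hI
    refine Tri.whileLt hB I' (fun n h'' H => ?_) ?_ ?_ hI
    · exact ⟨trivial, (hok _ _ H.2.2).1⟩
    · rintro n h' ⟨h1, h2, h3⟩ hlt
      rw [(hok _ _ h3).2] at hlt
      simp only [Expr.val] at hlt
      refine Tri.of_wp hB _ ?_
      have := hbody _ _ h3 h1 (by omega)
      rw [Cmd.wp]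
      refine Cmd.wp_mono _ (fun h'' H => ?_) this
      simp only [Cmd.wp, Expr.val, Expr.ok, H.1, true_and, hI', Store.set_v, if_true]
      refine ⟨⟨by omega, by omega⟩, n - 1, by omega, by omega, by omega, ?_⟩
      have e1 : N - (n - 1) = N - n + 1 := by omega
      rw [e1]
      exact H.2
    · rintro n h' ⟨h1, h2, h3⟩ hlt
      rw [(hok _ _ h3).2] at hlt
      simp only [Expr.val] at hlt
      have : N - n = N := by omega
      rwa [this] at h3
  refine Tri.mono (Tri.seq' (Tri.of_wp hB (.set .i (.c 0)) (Q := I' N) ?_) hloop) ?_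
    (fun _ h => h)
  · simp only [Cmd.wp, Expr.val, Expr.ok, hI', Store.set_v, if_true, Nat.sub_self]
    exact ⟨by omega, trivial, le_rfl, h0⟩
  · simp only [Cmd.cost, Expr.cost]
    ring_nf
    omega

end RAM

/-! ### Flow of value `k + 1` or cut of capacity at most `k` -/

namespace RAM

/-- Removal of the marks of the discovered vertices. -/
def unmark : Prog := forLt (.v .qt) (.put .vis (.a .q (.v .i)) (.c 0))

/-- Only vertices in the queue are marked, and there are at most `A + 1` of them. Clearing through
the queue instead of the whole array keeps the number of variables out of the running time. -/
theorem tri_unmark {D B A S : ℕ} {h : Store} (hB : 16 * D ≤ B) (hA : A + 1 < D) (hS : S < D)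
    (hqt : h.v .qt ≤ A + 1) (hq : ∀ i < h.v .qt, h.a .q i ≤ S)
    (hvis : ∀ v, h.a .vis v ≠ 0 → ∃ i < h.v .qt, h.a .q i = v) :
    Tri D B unmark (200 * (A + 1)) h fun h' =>
      Frame [.i] [.vis] h h' ∧ ∀ v, h'.a .vis v = 0 := by
  refine Tri.mono (Tri.forLt hB (N := h.v .qt) (by omega) (fun n h' => Frame [.i] [.vis] h h' ∧
    ∀ v, h'.a .vis v ≠ 0 → ∃ i < h.v .qt, n ≤ i ∧ h.a .q i = v) ?_ ?_ ?_) ?_ ?_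
  · exact ⟨Frame.set Frame.refl (by decide) _, fun v hv => by
      obtain ⟨i, hi, e⟩ := hvis v hv
      exact ⟨i, hi, Nat.zero_le _, e⟩⟩
  · rintro n h' ⟨F, -⟩
    exact ⟨trivial, F.1 _ (by decide)⟩
  · rintro n h' ⟨F, H⟩ hi hn
    have hqe : h'.a .q = h.a .q := F.2 _ (by decide)
    have := hq n hn
    simp only [Cmd.wp, Expr.val, Expr.ok, hi, true_and, hqe, Store.put_v, Store.set_a, Store.put_a,
      if_true]
    refine ⟨by omega, by omega, by omega, Frame.set (Frame.put F (by decide) _ _) (by decide) _,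
      fun v hv => ?_⟩
    by_cases e : v = h.a .q n
    · subst e; simp at hv
    · rw [Function.update_of_ne e] at hv
      obtain ⟨i, h1, h2, h3⟩ := H v hv
      refine ⟨i, h1, lt_of_le_of_ne h2 ?_, h3⟩
      rintro rfl
      exact e h3.symm
  · have h1 : (Cmd.put .vis (.a .q (.v .i)) (.c 0)).cost + 2 * (Expr.v .qt).cost + 10 ≤ 40 := by
      decide
    have := Nat.mul_le_mul h1 (show h.v .qt + 1 ≤ A + 2 by omega)
    omega
  · rintro h' ⟨F, H⟩
    refine ⟨F, fun v => ?_⟩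
    by_contra hv
    obtain ⟨i, h1, h2, -⟩ := H v hv
    omega

/-- Flipping of the labels of the discovered vertices. -/
def flipLabels : Prog :=
  forLt (.v .qt) (.put .X (.a .q (.v .i)) (.sub (.c 1) (.a .X (.a .q (.v .i)))))

theorem tri_flipLabels {D B A S : ℕ} {h : Store} (hB : 16 * D ≤ B) (hA : A + 1 < D) (hS : S < D)
    (hqt : h.v .qt ≤ A + 1) (hq : ∀ i < h.v .qt, h.a .q i ≤ S)
    (hinj : ∀ i < h.v .qt, ∀ i' < h.v .qt, h.a .q i = h.a .q i' → i = i') :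
    Tri D B flipLabels (200 * (A + 1)) h fun h' => Frame [.i] [.X] h h' ∧
      h'.a .X = EdgeSystem.flip (h.a .X) {v | ∃ i < h.v .qt, h.a .q i = v} := by
  refine Tri.mono (Tri.forLt hB (N := h.v .qt) (by omega) (fun n h' => n ≤ h.v .qt ∧
    Frame [.i] [.X] h h' ∧
    h'.a .X = EdgeSystem.flip (h.a .X) {v | ∃ i < n, h.a .q i = v}) ?_ ?_ ?_) ?_ ?_
  · refine ⟨Nat.zero_le _, Frame.set Frame.refl (by decide) _, ?_⟩
    funext v
    simp [EdgeSystem.flip]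
  · rintro n h' ⟨-, F, -⟩
    exact ⟨trivial, F.1 _ (by decide)⟩
  · rintro n h' ⟨hnle, F, H⟩ hi hn
    have hqe : h'.a .q = h.a .q := F.2 _ (by decide)
    have := hq n hn
    simp only [Cmd.wp, Expr.val, Expr.ok, hi, true_and, hqe, Store.put_v, Store.set_a, Store.put_a,
      if_true]
    refine ⟨by omega, ⟨by omega, by omega, by omega⟩, by omega, hn,
      Frame.set (Frame.put F (by decide) _ _) (by decide) _, ?_⟩
    funext v
    rw [H]
    by_cases e : v = h.a .q n
    · subst e
      -- Without repetitions in the queue no label is flipped twice.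
      have hnot : h.a .q n ∉ {v | ∃ i < n, h.a .q i = v} := by
        rintro ⟨i, h1, h2⟩
        have := hinj _ (by omega) _ hn h2
        omega
      have hmem : h.a .q n ∈ {v | ∃ i < n + 1, h.a .q i = v} := ⟨n, by omega, rfl⟩
      rw [Function.update_self, EdgeSystem.flip, if_neg hnot, EdgeSystem.flip, if_pos hmem]
    · rw [Function.update_of_ne e, EdgeSystem.flip, EdgeSystem.flip]
      have : v ∈ {v | ∃ i < n + 1, h.a .q i = v} ↔ v ∈ {v | ∃ i < n, h.a .q i = v} := by
        constructor
        · rintro ⟨i, h1, h2⟩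
          refine ⟨i, lt_of_le_of_ne (by omega) ?_, h2⟩
          rintro rfl
          exact e h2.symm
        · rintro ⟨i, h1, h2⟩
          exact ⟨i, by omega, h2⟩
      by_cases hm : v ∈ {v | ∃ i < n, h.a .q i = v}
      · rw [if_pos hm, if_pos (this.2 hm)]
      · rw [if_neg hm, if_neg (mt this.1 hm)]
  · have h1 : (Cmd.put .X (.a .q (.v .i)) (.sub (.c 1) (.a .X (.a .q (.v .i))))).cost +
        2 * (Expr.v .qt).cost + 10 ≤ 60 := by
      decide
    have := Nat.mul_le_mul h1 (show h.v .qt + 1 ≤ A + 2 by omega)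
    omega
  · rintro h' ⟨-, F, H⟩
    exact ⟨F, H⟩

/-- Emptying of the adjacency lists. -/
def clearLists : Prog := forLt (.v .A) (.put .hd (.a .src (.v .i)) (.c 0))

/-- A nonempty list belongs to the source of some arc, so it suffices to run over the arcs. -/
theorem tri_clearLists {D B A S : ℕ} {src tgt : ℕ → ℕ} {h : Store} (hB : 16 * D ≤ B) (hA : A < D)
    (hS : S < D) (hsrc : ∀ a < A, src a ≤ S) (hnet : IsNet A S src tgt h) :
    Tri D B clearLists (100 * (A + 1)) h fun h' =>
      Frame [.i] [.hd] h h' ∧ ∀ v, h'.a .hd v = 0 := by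
  refine Tri.mono (Tri.forLt hB (N := A) (by omega) (fun n h' => Frame [.i] [.hd] h h' ∧
    ∀ v, h'.a .hd v ≠ 0 → ∃ a < A, n ≤ a ∧ src a = v) ?_ ?_ ?_) ?_ ?_
  · refine ⟨Frame.set Frame.refl (by decide) _, fun v hv => ?_⟩
    simp only [Store.set_a, hnet.hd_eq] at hv
    have := lastArc_le src v A
    exact ⟨_, by omega, Nat.zero_le _, src_lastArc (Nat.pos_of_ne_zero hv)⟩
  · rintro n h' ⟨F, -⟩
    exact ⟨trivial, (F.1 _ (by decide)).trans hnet.var_A⟩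
  · rintro n h' ⟨F, H⟩ hi hn
    have hse : h'.a .src = h.a .src := F.2 _ (by decide)
    have := hsrc n hn
    simp only [Cmd.wp, Expr.val, Expr.ok, hi, true_and, hse, Store.put_v, Store.set_a, Store.put_a,
      if_true, hnet.src_eq n hn]
    refine ⟨by omega, by omega, by omega, Frame.set (Frame.put F (by decide) _ _) (by decide) _,
      fun v hv => ?_⟩
    by_cases e : v = src n
    · subst e; simp at hv
    · rw [Function.update_of_ne e] at hv
      obtain ⟨i, h1, h2, h3⟩ := H v hv
      refine ⟨i, h1, lt_of_le_of_ne h2 ?_, h3⟩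
      rintro rfl
      exact e h3.symm
  · have h1 : (Cmd.put .hd (.a .src (.v .i)) (.c 0)).cost + 2 * (Expr.v .A).cost + 10 ≤ 40 := by
      decide
    have := Nat.mul_le_mul_right (A + 1) h1
    omega
  · rintro h' ⟨F, H⟩
    refine ⟨F, fun v => ?_⟩
    by_contra hv
    obtain ⟨i, h1, h2, -⟩ := H v hv
    omega

/-- One round of the computation of a flow. -/
def flowStep : Prog :=
  .seq search (.seq
    (ifLt (.c 0) (.a .vis (.v .t))
      (.seq augment (Cmd.set .fl (.add (.v .fl) (.c 1))).code)
      (.seq flipLabels (Cmd.set .found (.c 1) ;; .set .fl (.add (.v .k) (.c 1))).code))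
    unmark)

/-- Computation of a flow of value `k + 1`, or of a cut of smaller capacity, in which case the labels
of the vertices on the side of `s` are flipped. -/
def flow : Prog :=
  .seq (Cmd.set .fl (.c 0)).code (whileLt (.v .fl) (.add (.v .k) (.c 1)) flowStep)

/-- The variables changed by `flow`. -/
abbrev flowVars : List Var := [.qh, .qt, .cur, .x, .y, .i, .fl, .found]

/-- The arrays changed by `flow`. -/
abbrev flowArrs : List Arr := [.vis, .pa, .q, .rs, .X]

/-- The invariant of the computation of a flow. -/
structure FlowInv (k A S T : ℕ) (src tgt c : ℕ → ℕ) (h h' : Store) : Prop where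
  frame : Frame flowVars flowArrs h h'
  unmarked : ∀ v, h'.a .vis v = 0
  fl_le : h'.v .fl ≤ k + 1
  cases :
    (h'.v .found = 0 ∧ h'.a .X = h.a .X ∧
      (∀ a < A, h'.a .rs a + h'.a .rs (EdgeSystem.rev a) = c a + c (EdgeSystem.rev a)) ∧
      ∀ Z : Set ℕ, S ∈ Z → T ∉ Z →
        outCap A src tgt (h'.a .rs) Z + h'.v .fl = outCap A src tgt c Z) ∨
    (h'.v .found = 1 ∧ h'.v .fl = k + 1 ∧ ∃ Z : Set ℕ, S ∈ Z ∧ T ∉ Z ∧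
      outCap A src tgt c Z ≤ k ∧ h'.a .X = EdgeSystem.flip (h.a .X) Z)

/-- The step of Ford and Fulkerson. If `T` is reached, one unit is pushed. Otherwise the reached set
is a cut without residual capacity, so its capacity is the current `fl ≤ k`; setting `fl` to `k + 1`
then merely ends the loop. -/
theorem tri_flowStep {D B k A S T : ℕ} {src tgt c : ℕ → ℕ} {h h' : Store} (hB : 16 * D ≤ B)
    (hA : A + 1 < D) (hS : S < D) (hT : T < D) (hk : k + 1 < D)
    (htgt : ∀ a < A, tgt a ≤ S)
    (hrev : ∀ a < A, EdgeSystem.rev a < A ∧ src (EdgeSystem.rev a) = tgt a ∧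
      tgt (EdgeSystem.rev a) = src a)
    (hc : ∀ a < A, c a + c (EdgeSystem.rev a) ≤ B)
    (hnet : IsNet A S src tgt h) (ht : h.v .t = T) (hvk : h.v .k = k)
    (H : FlowInv k A S T src tgt c h h') (hlt : h'.v .fl < k + 1) :
    Tri D B flowStep (1000 * (A + 1)) h' fun h'' =>
      FlowInv k A S T src tgt c h h'' ∧ h'.v .fl < h''.v .fl := by
  obtain ⟨F, hvis, hfl, ⟨hf, hX, hsum, hout⟩ | ⟨hf, hfl', _⟩⟩ := H
  swap
  · omega
  have hN := hnet.frame F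
  have ht' : h'.v .t = T := (F.1 _ (by decide)).trans ht
  have hk' : h'.v .k = k := (F.1 _ (by decide)).trans hvk
  refine Tri.mono (Tri.seq' (tri_search hB hA hS htgt hN hvis) (T' := 800 * (A + 1)) ?_) (by omega)
    (fun _ h => h)
  rintro h₁ ⟨F₁, hS₁⟩
  have hN₁ := hN.frame F₁
  have ht₁ : h₁.v .t = T := (F₁.1 _ (by decide)).trans ht'
  have hk₁ : h₁.v .k = k := (F₁.1 _ (by decide)).trans hk'
  have hrs₁ : h₁.a .rs = h'.a .rs := F₁.2 _ (by decide)
  have hX₁ : h₁.a .X = h.a .X := (F₁.2 _ (by decide)).trans hX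
  have hf₁ : h₁.v .found = 0 := (F₁.1 _ (by decide)).trans hf
  have hfl₁ : h₁.v .fl = h'.v .fl := F₁.1 _ (by decide)
  obtain ⟨P, hI⟩ := hS₁.inv
  have hmark : ∀ v, h₁.a .vis v ≠ 0 → ∃ i < h₁.v .qt, h₁.a .q i = v := fun v hv =>
    hI.exists_of_vis v (by have := hI.vis_le v; omega)
  have F' : Frame flowVars flowArrs h h₁ := F.trans (F₁.mono (by decide) (by decide))
  have key : Tri D B (ifLt (.c 0) (.a .vis (.v .t))
      (.seq augment (Cmd.set .fl (.add (.v .fl) (.c 1))).code)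
      (.seq flipLabels (Cmd.set .found (.c 1) ;; .set .fl (.add (.v .k) (.c 1))).code))
      (300 * (A + 1)) h₁ fun h₂ => Frame [.x, .y, .i, .fl, .found] [.rs, .X] h₁ h₂ ∧
        ((h₂.v .found = 0 ∧ h₂.v .fl = h'.v .fl + 1 ∧ h₂.a .X = h.a .X ∧
          (∀ a < A, h₂.a .rs a + h₂.a .rs (EdgeSystem.rev a) = c a + c (EdgeSystem.rev a)) ∧
          ∀ Z : Set ℕ, S ∈ Z → T ∉ Z →
            outCap A src tgt (h₂.a .rs) Z + h₂.v .fl = outCap A src tgt c Z) ∨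
        (h₂.v .found = 1 ∧ h₂.v .fl = k + 1 ∧ ∃ Z : Set ℕ, S ∈ Z ∧ T ∉ Z ∧
          outCap A src tgt c Z ≤ k ∧ h₂.a .X = EdgeSystem.flip (h.a .X) Z)) := by
    refine Tri.mono (Tri.ifLt hB (T := 250 * (A + 1)) ?_ ?_ ?_ ?_) ?_ (fun _ h => h)
    · simp [Expr.ok]
    · simp only [Expr.ok, Expr.val, true_and, ht₁]; exact hT
    · intro hv
      simp only [Expr.val, ht₁] at hv
      refine Tri.mono (Tri.seq' (tri_augment hB (by omega) hS hrev ?_ hN₁ hS₁ ht₁ hv)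
        fun h₂ H₂ => Tri.of_wp hB _ ?_) ?_ (fun _ h => h)
      · intro a ha
        rw [hrs₁, hsum a ha]
        exact hc a ha
      · obtain ⟨F₂, hsum₂, hout₂⟩ := H₂
        have hfl₂ : h₂.v .fl = h'.v .fl := (F₂.1 _ (by decide)).trans hfl₁
        simp only [Cmd.wp, Expr.ok, Expr.val, true_and, Store.set_v, Store.set_a, reduceCtorEq,
          if_true, if_false, hfl₂]
        refine ⟨⟨by omega, by omega⟩, Frame.set (F₂.mono (by decide) (by decide)) (by decide) _,
          Or.inl ⟨(F₂.1 _ (by decide)).trans hf₁, (F₂.2 _ (by decide)).trans hX₁, ?_, ?_⟩⟩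
        · intro a ha
          rw [hsum₂ a ha, hrs₁, hsum a ha]
        · intro Z hZ hZ'
          have h1 := hout₂ Z hZ hZ'
          have h2 := hout Z hZ hZ'
          rw [hrs₁] at h1
          omega
      · have : (Cmd.set .fl (.add (.v .fl) (.c 1))).cost ≤ 10 := by decide
        omega
    · intro hv
      simp only [Expr.val, ht₁, not_lt, Nat.le_zero] at hv
      refine Tri.mono (Tri.seq' (tri_flipLabels hB hA hS hS₁.qt_le hI.q_le hI.inj)
        fun h₂ H₂ => Tri.of_wp hB _ ?_) ?_ (fun _ h => h)
      · obtain ⟨F₂, hX₂⟩ := H₂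
        have hk₂ : h₂.v .k = k := (F₂.1 _ (by decide)).trans hk₁
        simp only [Cmd.wp, Expr.ok, Expr.val, true_and, Store.set_v, Store.set_a, reduceCtorEq,
          if_true, if_false, hk₂]
        refine ⟨by omega, ⟨by omega, by omega⟩, Frame.set (Frame.set
          (F₂.mono (by decide) (by decide)) (by decide) _) (by decide) _, Or.inr
          ⟨{v | ∃ i < h₁.v .qt, h₁.a .q i = v}, ⟨0, hI.qt_pos, hI.q_zero⟩, ?_, ?_, ?_⟩⟩
        · rintro ⟨i, hi, e⟩
          have := hI.vis_q i hi
          rw [e, hv] at this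
          omega
        · have hZ : S ∈ {v | ∃ i < h₁.v .qt, h₁.a .q i = v} := ⟨0, hI.qt_pos, hI.q_zero⟩
          have hZ' : T ∉ {v | ∃ i < h₁.v .qt, h₁.a .q i = v} := by
            rintro ⟨i, hi, e⟩
            have := hI.vis_q i hi
            rw [e, hv] at this
            omega
          rw [← hout _ hZ hZ', outCap_eq_zero]
          · omega
          · rintro a ha ⟨i, hi, e⟩ h0
            rw [← hrs₁] at h0
            -- The search is over, so all arcs out of reached vertices have been scanned, and those
            -- with residual capacity lead to reached vertices.
            refine hI.exists_of_vis _ (hI.closed a (hI.mem_of_lt a ha ⟨i, ?_, e.symm⟩) h0)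
            rw [hS₁.eq]; exact hi
        · rw [hX₂, hX₁]
      · have : (Cmd.set .found (.c 1) ;; .set .fl (.add (.v .k) (.c 1))).cost ≤ 10 := by decide
        omega
    · simp only [Expr.cost]
      omega
  refine Tri.mono (Tri.seq' key fun h₂ H₂ => Tri.mono (tri_unmark hB hA hS (A := A) (S := S)
    ?_ ?_ ?_) le_rfl fun h₃ H₃ => ?_) (by omega) (fun _ h => h)
  · rw [H₂.1.1 _ (by decide)]; exact hS₁.qt_le
  · rw [H₂.1.1 _ (by decide), H₂.1.2 _ (by decide)]; exact hI.q_le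
  · rw [H₂.1.1 _ (by decide), H₂.1.2 _ (by decide), H₂.1.2 _ (by decide)]; exact hmark
  · obtain ⟨F₂, H₂⟩ := H₂
    obtain ⟨F₃, hv₃⟩ := H₃
    have e1 : h₃.v .found = h₂.v .found := F₃.1 _ (by decide)
    have e2 : h₃.v .fl = h₂.v .fl := F₃.1 _ (by decide)
    have e3 : h₃.a .X = h₂.a .X := F₃.2 _ (by decide)
    have e4 : h₃.a .rs = h₂.a .rs := F₃.2 _ (by decide)
    have F₃' : Frame flowVars flowArrs h h₃ := (F'.trans (F₂.mono (by decide) (by decide))).trans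
      (F₃.mono (by decide) (by decide))
    rcases H₂ with ⟨g1, g2, g3, g4, g5⟩ | ⟨g1, g2, g3⟩
    · exact ⟨⟨F₃', hv₃, by omega, Or.inl ⟨by omega, by rw [e3, g3], by rw [e4]; exact g4,
        by rw [e4, e2]; exact g5⟩⟩, by omega⟩
    · exact ⟨⟨F₃', hv₃, by omega, Or.inr ⟨by omega, by omega, by rw [e3]; exact g3⟩⟩, by omega⟩

theorem tri_flow {D B k A S T : ℕ} {src tgt c : ℕ → ℕ} {h : Store} (hB : 16 * D ≤ B)
    (hA : A + 1 < D) (hS : S < D) (hT : T < D) (hk : k + 1 < D)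
    (htgt : ∀ a < A, tgt a ≤ S)
    (hrev : ∀ a < A, EdgeSystem.rev a < A ∧ src (EdgeSystem.rev a) = tgt a ∧
      tgt (EdgeSystem.rev a) = src a)
    (hc : ∀ a < A, c a + c (EdgeSystem.rev a) ≤ B)
    (hnet : IsNet A S src tgt h) (ht : h.v .t = T) (hvk : h.v .k = k) (hf : h.v .found = 0)
    (hvis : ∀ v, h.a .vis v = 0) (hrs : ∀ a < A, h.a .rs a = c a) :
    Tri D B flow (2000 * (A + 1) * (k + 1)) h fun h' => Frame flowVars flowArrs h h' ∧
      (∀ v, h'.a .vis v = 0) ∧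
      ((h'.v .found = 0 ∧ h'.a .X = h.a .X ∧
        ∀ Z : Set ℕ, S ∈ Z → T ∉ Z → k < outCap A src tgt c Z) ∨
      (h'.v .found = 1 ∧ ∃ Z : Set ℕ, S ∈ Z ∧ T ∉ Z ∧ outCap A src tgt c Z ≤ k ∧
        h'.a .X = EdgeSystem.flip (h.a .X) Z)) := by
  set I : ℕ → Store → Prop := fun n h' => FlowInv k A S T src tgt c h h' ∧ n = k + 1 - h'.v .fl
    with hI
  refine Tri.mono (Tri.seq' (Tri.of_wp hB (.set .fl (.c 0)) (Q := I (k + 1)) ?_) fun h' H =>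
    Tri.whileLt hB (T := 1000 * (A + 1)) I ?_ ?_ ?_ H) ?_ (fun _ h => h)
  · simp only [Cmd.wp, Expr.ok, Expr.val, hI]
    refine ⟨by omega, ⟨Frame.set Frame.refl (by decide) _, hvis, by simp, Or.inl ⟨by simpa using hf,
      rfl, ?_, ?_⟩⟩, by simp⟩
    · intro a ha
      rw [Store.set_a, hrs a ha, hrs _ (hrev a ha).1]
    · intro Z _ _
      rw [Store.set_a, outCap_congr hrs]
      simp
  · rintro n h' ⟨H, -⟩
    have : h'.v .k = k := (H.frame.1 _ (by decide)).trans hvk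
    simp only [Expr.ok, Expr.val, this, true_and]
    omega
  · rintro n h' ⟨H, hn⟩ hlt
    have : h'.v .k = k := (H.frame.1 _ (by decide)).trans hvk
    simp only [Expr.val, this] at hlt
    refine Tri.mono (tri_flowStep hB hA hS hT hk htgt hrev hc hnet ht hvk H hlt) le_rfl ?_
    rintro h'' ⟨H', hlt'⟩
    exact ⟨_, by omega, H', rfl⟩
  · rintro n h' ⟨H, hn⟩ hlt
    have : h'.v .k = k := (H.frame.1 _ (by decide)).trans hvk
    simp only [Expr.val, this] at hlt
    refine ⟨H.frame, H.unmarked, ?_⟩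
    rcases H.cases with ⟨g1, g2, g3, g4⟩ | ⟨g1, g2, g3⟩
    · refine Or.inl ⟨g1, g2, fun Z hZ hZ' => ?_⟩
      have := g4 Z hZ hZ'
      -- `k + 1` units have been pushed, so every cut had capacity at least `k + 1`.
      omega
    · exact Or.inr ⟨g1, g3⟩
  · simp only [Cmd.cost, Expr.cost]
    nlinarith

end RAM

/-! ### Construction of the network -/

namespace RAM

theorem Cmd.wp_seq {D B : ℕ} {c c' : Cmd} {P Q : Store → Prop} {h : Store} (H : c.wp D B P h)
    (H' : ∀ h', P h' → c'.wp D B Q h') : (c ;; c').wp D B Q h :=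
  Cmd.wp_mono c H' H

/-- Appending an arc to the network. -/
def mkArc (P Q : Var) (e : Expr) : Cmd :=
  .put .src (.v .A) (.v P) ;; .put .tgt (.v .A) (.v Q) ;; .put .rv (.v .A) e ;;
  .put .rs (.v .A) (.v .w) ;; .put .nx (.v .A) (.a .hd (.v P)) ;;
  .put .hd (.v P) (.add (.v .A) (.c 1)) ;; .set .A (.add (.v .A) (.c 1))

/-- The arrays in which the network is stored. -/
abbrev netArrs : List Arr := [.src, .tgt, .rv, .rs, .nx, .hd]

theorem wp_mkArc {D B a S : ℕ} {src tgt c : ℕ → ℕ} {h : Store} {P Q : Var} {e : Expr}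
    (hB : 16 * D ≤ B) (ha : a < D) (hS : S < D) (hnet : IsNet a S src tgt h)
    (hrs : ∀ a' < a, h.a .rs a' = c a') (hP : h.v P = src a) (hQ : h.v Q = tgt a)
    (hle : src a ≤ S) (hw : h.v .w = c a)
    (he : ∀ h' : Store, h'.v .A = a → e.ok D B h' ∧ e.val h' = EdgeSystem.rev a) :
    (mkArc P Q e).wp D B (fun h' => Frame [.A] netArrs h h' ∧ IsNet (a + 1) S src tgt h' ∧
      ∀ a' < a + 1, h'.a .rs a' = c a') h := by
  have hA := hnet.var_A
  have he' : ∀ h' : Store, h'.v = h.v → e.ok D B h' ∧ e.val h' = EdgeSystem.rev a :=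
    fun h' e' => he h' (by rw [e', hA])
  have upd : ∀ {f g : ℕ → ℕ} {y : ℕ}, (∀ a' < a, f a' = g a') → y = g a →
      ∀ a' < a + 1, Function.update f a y a' = g a' := by
    intro f g y hfg hy a' ha'
    by_cases e' : a' = a
    · subst e'; rw [Function.update_self, hy]
    · rw [Function.update_of_ne e']; exact hfg a' (by omega)
  simp only [mkArc, Cmd.wp, Expr.val, Expr.ok, Store.put_v, Store.put_a, reduceCtorEq,
    if_false, true_and, hA, hP, hQ, hw, hnet.hd_eq]
  rw [(he' _ (by rfl)).2]
  refine ⟨ha, ha, (he' _ (by rfl)).1, ha, ha, by omega, ha, ⟨by omega, by omega⟩, by omega,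
    ⟨by omega, by omega⟩, ?_, ⟨?_, ?_, ?_, ?_, ?_, ?_, ?_⟩, ?_⟩
  · refine Frame.set (Frame.put (Frame.put (Frame.put (Frame.put (Frame.put (Frame.put Frame.refl
      ?_ _ _) ?_ _ _) ?_ _ _) ?_ _ _) ?_ _ _) ?_ _ _) ?_ _ <;> decide
  · simp
  · simpa using hnet.var_s
  · simpa using upd hnet.src_eq rfl
  · simpa using upd hnet.tgt_eq rfl
  · simpa using upd hnet.rv_eq rfl
  · simpa using upd hnet.nx_eq rfl
  -- The new arc becomes the head of the list of its source and the old head its successor: this is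
  -- the recursion of `lastArc`.
  · intro v
    simp only [Store.set_a, Store.put_a, if_true, reduceCtorEq, if_false, lastArc]
    by_cases e' : v = src a
    · subst e'; simp
    · rw [Function.update_of_ne e', if_neg (Ne.symm e'), hnet.hd_eq]
  · simpa using upd hrs rfl

/-- The store holds the first `m` equations of the system `E`. -/
structure HasSys (E : EdgeSystem) (n m : ℕ) (h : Store) : Prop where
  var_n : h.v .n = n
  var_t : h.v .t = n + 1
  var_s : h.v .s = n + 2
  U_eq : ∀ j < m, h.a .U j = E.U j
  V_eq : ∀ j < m, h.a .V j = E.V j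
  R_eq : ∀ j < m, h.a .R j = E.R j
  W_eq : ∀ j < m, h.a .W j = E.W j

theorem HasSys.frame {E : EdgeSystem} {n m : ℕ} {h h' : Store} {vs : List Var} {as : List Arr}
    (H : HasSys E n m h) (F : Frame vs as h h')
    (hvs : .n ∉ vs ∧ .t ∉ vs ∧ .s ∉ vs := by decide)
    (has : .U ∉ as ∧ .V ∉ as ∧ .R ∉ as ∧ .W ∉ as := by decide) :
    HasSys E n m h' := by
  obtain ⟨h1, h2, h3, h4⟩ := has
  exact ⟨by rw [F.1 _ hvs.1, H.var_n], by rw [F.1 _ hvs.2.1, H.var_t],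
    by rw [F.1 _ hvs.2.2, H.var_s], by rw [F.2 _ h1]; exact H.U_eq,
    by rw [F.2 _ h2]; exact H.V_eq, by rw [F.2 _ h3]; exact H.R_eq, by rw [F.2 _ h4]; exact H.W_eq⟩

/-- The ends of the edges of the network for the `i`-th equation. -/
def buildEnds : Cmd :=
  .set .x (.a .U (.v .i)) ;; .set .y (.a .V (.v .i)) ;; .set .w (.a .W (.v .i)) ;;
  .set .d (.add (.sub (.a .X (.v .x)) (.a .X (.v .y))) (.sub (.a .X (.v .y)) (.a .X (.v .x)))) ;;
  .set .b (.a .R (.v .i)) ;;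
  .set .d (.add (.sub (.v .d) (.v .b)) (.sub (.v .b) (.v .d))) ;;
  .ite (.c 0) (.v .d)
    (.set .p₀ (.v .s) ;; .set .q₁ (.v .t) ;;
      .ite (.c 0) (.a .O (.v .rk))
        (.set .q₀ (.v .x) ;; .set .p₁ (.v .y))
        (.set .q₀ (.v .y) ;; .set .p₁ (.v .x)) ;;
      .set .rk (.add (.v .rk) (.c 1)))
    (.set .p₀ (.v .x) ;; .set .q₀ (.v .y) ;; .set .p₁ (.v .s) ;; .set .q₁ (.v .s))

theorem wp_buildEnds {D B : ℕ} {E : EdgeSystem} {n m i : ℕ} {h : Store} (hB : 16 * D ≤ B)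
    (hm : m < D) (hn : n + 2 < D) (hE : HasSys E n m h) (hU : E.U i ≤ n) (hV : E.V i ≤ n)
    (hR : E.R i ≤ 1) (hlab : ∀ v, h.a .X v ≤ 1) (hi : i < m) (hvi : h.v .i = i)
    (hrk : h.v .rk = E.rank (h.a .X) i) :
    buildEnds.wp D B (fun h' => Frame [.x, .y, .w, .b, .d, .p₀, .q₀, .p₁, .q₁, .rk] [] h h' ∧
      h'.v .w = E.W i ∧ h'.v .p₀ = E.p₀ (n + 2) (h.a .X) i ∧
      h'.v .q₀ = E.q₀ (h.a .X) (h.a .O) i ∧ h'.v .p₁ = E.p₁ (n + 2) (h.a .X) (h.a .O) i ∧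
      h'.v .q₁ = E.q₁ (n + 2) (n + 1) (h.a .X) i ∧ h'.v .rk = E.rank (h.a .X) (i + 1)) h := by
  have lu := hlab (E.U i)
  have lv := hlab (E.V i)
  have hrle : E.rank (h.a .X) i ≤ i := Nat.count_le _
  -- The sum of two truncated differences is the absolute difference, which for bits is addition
  -- modulo 2.
  set d := (h.a .X (E.U i) - h.a .X (E.V i)) + (h.a .X (E.V i) - h.a .X (E.U i)) with hd
  have hdle : d ≤ 1 := by omega
  have hviol : 0 < (d - E.R i) + (E.R i - d) ↔ E.Viol (h.a .X) i := by
    unfold EdgeSystem.Viol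
    omega
  simp only [buildEnds, Cmd.wp, Expr.val, Expr.ok, Store.set_v, Store.set_a, reduceCtorEq, if_true,
    if_false, true_and, hE.var_t, hE.var_s, hvi, hE.U_eq i hi, hE.V_eq i hi,
    hE.R_eq i hi, hE.W_eq i hi, hrk, ← hd]
  refine ⟨by omega, by omega, by omega, ⟨⟨by omega, by omega⟩, ⟨by omega, by omega⟩, by omega⟩,
    by omega, by omega, by omega, ?_, ?_⟩
  · intro h1
    have hv := hviol.1 h1
    refine ⟨by omega, by omega, ?_, ?_⟩
    · intro ho
      refine ⟨⟨by omega, by omega⟩, ?_, ?_⟩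
      · refine Frame.set (Frame.set (Frame.set (Frame.set (Frame.set (Frame.set (Frame.set
          (Frame.set (Frame.set (Frame.set (Frame.set Frame.refl ?_ _) ?_ _) ?_ _) ?_ _) ?_ _) ?_ _)
          ?_ _) ?_ _) ?_ _) ?_ _) ?_ _ <;> decide
      · simp [EdgeSystem.p₀, EdgeSystem.q₀, EdgeSystem.p₁, EdgeSystem.q₁, hv, ho,
          EdgeSystem.rank_succ]
    · intro ho
      refine ⟨⟨by omega, by omega⟩, ?_, ?_⟩
      · refine Frame.set (Frame.set (Frame.set (Frame.set (Frame.set (Frame.set (Frame.set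
          (Frame.set (Frame.set (Frame.set (Frame.set Frame.refl ?_ _) ?_ _) ?_ _) ?_ _) ?_ _) ?_ _)
          ?_ _) ?_ _) ?_ _) ?_ _) ?_ _ <;> decide
      · simp [EdgeSystem.p₀, EdgeSystem.q₀, EdgeSystem.p₁, EdgeSystem.q₁, hv, ho,
          EdgeSystem.rank_succ]
  · intro h1
    have hv : ¬ E.Viol (h.a .X) i := fun H => h1 (hviol.2 H)
    refine ⟨?_, ?_⟩
    · refine Frame.set (Frame.set (Frame.set (Frame.set (Frame.set (Frame.set (Frame.set
          (Frame.set (Frame.set (Frame.set Frame.refl ?_ _) ?_ _) ?_ _) ?_ _) ?_ _) ?_ _)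
          ?_ _) ?_ _) ?_ _) ?_ _ <;> decide
    · simp [EdgeSystem.p₀, EdgeSystem.q₀, EdgeSystem.p₁, EdgeSystem.q₁, hv,
          EdgeSystem.rank_succ]

/-- Appending the arcs for the `i`-th equation. -/
def buildStep : Cmd :=
  buildEnds ;; mkArc .p₀ .q₀ (.add (.v .A) (.c 1)) ;; mkArc .q₀ .p₀ (.sub (.v .A) (.c 1)) ;;
  mkArc .p₁ .q₁ (.add (.v .A) (.c 1)) ;; mkArc .q₁ .p₁ (.sub (.v .A) (.c 1))

/-- Construction of the network for the first `j + 1` equations. -/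
def build : Prog :=
  .seq (Cmd.set .A (.c 0) ;; .set .rk (.c 0)).code (forLt (.add (.v .j) (.c 1)) buildStep)

/-- The variables changed by `build`. -/
abbrev buildVars : List Var := [.x, .y, .w, .b, .d, .p₀, .q₀, .p₁, .q₁, .rk, .A, .i]

end RAM

namespace EdgeSystem

variable (E : EdgeSystem)

theorem src_le {n : ℕ} (hU : ∀ j, E.U j ≤ n) (hV : ∀ j, E.V j ≤ n) (lab o : ℕ → ℕ) (a : ℕ) :
    E.src (n + 2) (n + 1) lab o a ≤ n + 2 := by
  have h1 := hU (a / 4)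
  have h2 := hV (a / 4)
  unfold src p₀ q₀ p₁ q₁
  split_ifs <;> omega

theorem tgt_le {n : ℕ} (hU : ∀ j, E.U j ≤ n) (hV : ∀ j, E.V j ≤ n) (lab o : ℕ → ℕ) (a : ℕ) :
    E.tgt (n + 2) (n + 1) lab o a ≤ n + 2 := by
  rw [← src_rev]
  exact E.src_le hU hV lab o _

end EdgeSystem

namespace RAM

theorem tri_build {D B : ℕ} {E : EdgeSystem} {n m j : ℕ} {h : Store} (hB : 16 * D ≤ B)
    (hm : 4 * m + 1 < D) (hn : n + 2 < D) (hE : HasSys E n m h) (hU : ∀ j, E.U j ≤ n)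
    (hV : ∀ j, E.V j ≤ n) (hR : ∀ j, E.R j ≤ 1) (hlab : ∀ v, h.a .X v ≤ 1) (hj : j < m)
    (hvj : h.v .j = j) (hhd : ∀ v, h.a .hd v = 0) :
    Tri D B build (1000 * (j + 2)) h fun h' => Frame buildVars netArrs h h' ∧
      IsNet (4 * (j + 1)) (n + 2) (E.src (n + 2) (n + 1) (h.a .X) (h.a .O))
        (E.tgt (n + 2) (n + 1) (h.a .X) (h.a .O)) h' ∧
      ∀ a < 4 * (j + 1), h'.a .rs a = E.cap a := by
  set src := E.src (n + 2) (n + 1) (h.a .X) (h.a .O) with hsrc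
  set tgt := E.tgt (n + 2) (n + 1) (h.a .X) (h.a .O) with htgt
  set I : ℕ → Store → Prop := fun i h' => i ≤ j + 1 ∧ Frame buildVars netArrs h h' ∧
    IsNet (4 * i) (n + 2) src tgt h' ∧ (∀ a < 4 * i, h'.a .rs a = E.cap a) ∧
    h'.v .rk = E.rank (h.a .X) i with hI
  refine Tri.mono (Tri.seq' (P := fun h' => I 0 (h'.set .i 0))
    (Tri.of_wp hB (.set .A (.c 0) ;; .set .rk (.c 0)) ?_) fun h' H =>
    Tri.forLt hB (N := j + 1) (by omega) I H ?_ ?_) ?_ ?_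
  · simp only [Cmd.wp, Expr.ok, Expr.val, hI]
    refine ⟨by omega, by omega, by omega, ?_, ⟨?_, ?_, ?_, ?_, ?_, ?_, ?_⟩, ?_, ?_⟩
    · refine Frame.set (Frame.set (Frame.set Frame.refl ?_ _) ?_ _) ?_ _ <;> decide
    · simp
    · simpa using hE.var_s
    · intro a ha; omega
    · intro a ha; omega
    · intro a ha; omega
    · intro a ha; omega
    · intro v
      simpa [lastArc] using hhd v
    · intro a ha; omega
    · simp [EdgeSystem.rank]
  · rintro i h' ⟨-, F, -⟩
    have : h'.v .j = j := (F.1 _ (by decide)).trans hvj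
    simp only [Expr.ok, Expr.val, this, true_and, and_true]
    omega
  · rintro i h' ⟨-, F, hN, hrs, hrk⟩ hvi hi
    have hX : h'.a .X = h.a .X := F.2 _ (by decide)
    have hO : h'.a .O = h.a .O := F.2 _ (by decide)
    refine Cmd.wp_seq (wp_buildEnds hB (by omega) hn (hE.frame F) (hU i) (hV i) (hR i)
      (by rw [hX]; exact hlab) (by omega) hvi (by rw [hX, hrk])) ?_
    rintro h₁ ⟨F₁, w₁, a₁, b₁, c₁, d₁, r₁⟩
    rw [hX] at a₁ b₁ c₁ d₁ r₁
    rw [hO] at b₁ c₁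
    have m0 : (4 * i) % 4 = 0 := by omega
    have m1 : (4 * i + 1) % 4 = 1 := by omega
    have m2 : (4 * i + 1 + 1) % 4 = 2 := by omega
    have m3 : (4 * i + 1 + 1 + 1) % 4 = 3 := by omega
    have e0 : (4 * i) / 4 = i := by omega
    have e1 : (4 * i + 1) / 4 = i := by omega
    have e2 : (4 * i + 1 + 1) / 4 = i := by omega
    have e3 : (4 * i + 1 + 1 + 1) / 4 = i := by omega
    have hsle : ∀ a, src a ≤ n + 2 := E.src_le hU hV _ _
    have hN₁ := hN.frame F₁
    refine Cmd.wp_seq (wp_mkArc (c := E.cap) hB (by omega) hn hN₁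
      (by rw [F₁.2 _ (by decide)]; exact hrs) ?_ ?_ (hsle _) ?_ ?_) ?_
    · rw [a₁, hsrc]; simp [EdgeSystem.src, m0, e0]
    · rw [b₁, htgt]; simp [EdgeSystem.tgt, m0, e0]
    · rw [w₁, EdgeSystem.cap, e0]
    · intro h' hA
      simp only [Expr.ok, Expr.val, hA, EdgeSystem.rev]
      -- The four arcs start at the even number `4 * i`, so the reverse is the next arc for the
      -- first and third, the previous one for the others.
      refine ⟨⟨trivial, by omega, by omega⟩, by split_ifs <;> omega⟩
    rintro h₂ ⟨F₂, hN₂, hrs₂⟩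
    refine Cmd.wp_seq (wp_mkArc (c := E.cap) hB (by omega) hn hN₂ hrs₂ ?_ ?_ (hsle _) ?_ ?_) ?_
    · rw [F₂.1 _ (by decide), b₁, hsrc]; simp [EdgeSystem.src, m1, e1]
    · rw [F₂.1 _ (by decide), a₁, htgt]; simp [EdgeSystem.tgt, m1, e1]
    · rw [F₂.1 _ (by decide), w₁, EdgeSystem.cap, e1]
    · intro h' hA
      simp only [Expr.ok, Expr.val, hA, EdgeSystem.rev]
      refine ⟨⟨trivial, by omega⟩, by split_ifs <;> omega⟩
    rintro h₃ ⟨F₃, hN₃, hrs₃⟩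
    have F₃' := F₂.trans F₃
    refine Cmd.wp_seq (wp_mkArc (c := E.cap) hB (by omega) hn hN₃ hrs₃ ?_ ?_ (hsle _) ?_ ?_) ?_
    · rw [F₃'.1 _ (by decide), c₁, hsrc]; simp [EdgeSystem.src, m2, e2]
    · rw [F₃'.1 _ (by decide), d₁, htgt]; simp [EdgeSystem.tgt, m2, e2]
    · rw [F₃'.1 _ (by decide), w₁, EdgeSystem.cap, e2]
    · intro h' hA
      simp only [Expr.ok, Expr.val, hA, EdgeSystem.rev]
      refine ⟨⟨trivial, by omega, by omega⟩, by split_ifs <;> omega⟩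
    rintro h₄ ⟨F₄, hN₄, hrs₄⟩
    have F₄' := F₃'.trans F₄
    refine Cmd.wp_mono _ ?_ (wp_mkArc (c := E.cap) hB (by omega) hn hN₄ hrs₄ ?_ ?_ (hsle _) ?_ ?_)
    · rintro h₅ ⟨F₅, hN₅, hrs₅⟩
      have F₅' := F₄'.trans F₅
      refine ⟨?_, by omega, Frame.set ((F.trans (F₁.mono (by decide) (by decide))).trans
        (F₅'.mono (by decide) (by decide))) (by decide) _, ?_, ?_, ?_⟩
      · rw [F₅'.1 _ (by decide), F₁.1 _ (by decide), hvi]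
      · exact hN₅.frame (Frame.set (vs := [.i]) (as := []) Frame.refl (by decide) _)
      · exact hrs₅
      · simp only [Store.set_v, reduceCtorEq, if_false]
        rw [F₅'.1 _ (by decide), r₁]
    · rw [F₄'.1 _ (by decide), d₁, hsrc]; simp [EdgeSystem.src, m3, e3]
    · rw [F₄'.1 _ (by decide), c₁, htgt]; simp [EdgeSystem.tgt, m3, e3]
    · rw [F₄'.1 _ (by decide), w₁, EdgeSystem.cap, e3]
    · intro h' hA
      simp only [Expr.ok, Expr.val, hA, EdgeSystem.rev]
      refine ⟨⟨trivial, by omega⟩, by split_ifs <;> omega⟩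
  · have h1 : buildStep.cost + 2 * (Expr.add (.v .j) (.c 1)).cost + 10 ≤ 500 := by decide
    have h2 : (Cmd.set .A (.c 0) ;; .set .rk (.c 0)).cost ≤ 10 := by decide
    have := Nat.mul_le_mul_right (j + 1 + 1) h1
    omega
  · rintro h' ⟨-, F, hN, hrs, -⟩
    exact ⟨F, hN, hrs⟩

end RAM

theorem EdgeSystem.cost_mono (E : EdgeSystem) (lab : ℕ → ℕ) {J J' : ℕ} (h : J ≤ J') :
    E.cost J lab ≤ E.cost J' lab :=
  Finset.sum_le_sum_of_subset (Finset.range_mono h)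

/-! ### Enumeration of orientations and iterative compression -/

namespace RAM

/-- One carry of the incrementation of the binary counter. -/
def carryStep : Cmd := .put .O (.v .i) (.c 0) ;; .set .i (.add (.v .i) (.c 1))

/-- The end of the incrementation of the binary counter, with a test for overflow. -/
def carryEnd : Cmd :=
  .put .O (.v .i) (.c 1) ;; .ite (.v .i) (.add (.v .k) (.c 1)) .skip (.set .go (.c 0))

/-- Incrementation of the binary counter with the digits `O 0, …, O k`. -/
def increment : Prog :=
  .seq (Cmd.set .i (.c 0)).code
    (.seq (whileLt (.c 0) (.a .O (.v .i)) carryStep.code) carryEnd.code)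

/-- The digit `O (k + 1) = 0` is a sentinel: carrying stops there at the latest, and stopping there
means overflow. While carrying, the value of the counter plus `2 ^ i` is constant. -/
theorem tri_increment {D B k : ℕ} {h : Store} (hB : 16 * D ≤ B) (hk : k + 2 < D) (hvk : h.v .k = k)
    (hO : ∀ i ≤ k + 1, h.a .O i ≤ 1) (hOk : h.a .O (k + 1) = 0) :
    Tri D B increment (100 * (k + 2)) h fun h' => Frame [.i, .go] [.O] h h' ∧
      ((h'.v .go = h.v .go ∧ binVal (k + 1) (h'.a .O) = binVal (k + 1) (h.a .O) + 1 ∧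
        (∀ i ≤ k + 1, h'.a .O i ≤ 1) ∧ h'.a .O (k + 1) = 0) ∨
      (h'.v .go = 0 ∧ binVal (k + 1) (h.a .O) + 1 = 2 ^ (k + 1))) := by
  set I : ℕ → Store → Prop := fun n h' => Frame [.i] [.O] h h' ∧ h'.v .i ≤ k + 1 ∧
    (∀ i ≤ k + 1, h'.a .O i ≤ 1) ∧ h'.a .O (k + 1) = 0 ∧ n = k + 1 - h'.v .i ∧
    binVal (k + 1) (h'.a .O) + 2 ^ h'.v .i = binVal (k + 1) (h.a .O) + 1 with hI
  have hloop : ∀ h', I (k + 1) h' → Tri D B (whileLt (.c 0) (.a .O (.v .i)) carryStep.code)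
      ((carryStep.cost + 4 + 1) * (k + 1) + 5) h' fun h' => ∃ n, I n h' ∧ h'.a .O (h'.v .i) = 0 := by
    intro h' hI'
    refine Tri.whileLt hB I ?_ ?_ ?_ hI'
    · rintro n h' ⟨-, hi, -⟩
      simp only [Expr.ok, Expr.val, true_and]
      omega
    · rintro n h' ⟨F, hi, hd, h0, hn, hv⟩ hlt
      simp only [Expr.val] at hlt
      have hi' : h'.v .i < k + 1 := by
        refine lt_of_le_of_ne hi fun e => ?_
        rw [e] at hlt
        omega
      have h1 : h'.a .O (h'.v .i) = 1 := by
        have := hd (h'.v .i) hi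
        omega
      refine Tri.of_wp hB _ ?_
      simp only [carryStep, Cmd.wp, Expr.ok, Expr.val, Store.put_v, Store.put_a, Store.set_v,
        Store.set_a, if_true, true_and, hI]
      refine ⟨by omega, by omega, ⟨by omega, by omega⟩, _, ?_, Frame.set (Frame.put F (by decide) _ _)
        (by decide) _, by omega, ?_, ?_, rfl, ?_⟩
      · omega
      · intro i hik
        by_cases e : i = h'.v .i
        · subst e; simp
        · rw [Function.update_of_ne e]; exact hd i hik
      · rw [Function.update_of_ne (by omega)]; exact h0
      · have := binVal_update (o := h'.a .O) hi' 0
        rw [h1] at this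
        rw [pow_succ]
        omega
    · rintro n h' H hlt
      simp only [Expr.val] at hlt
      exact ⟨n, H, by omega⟩
  refine Tri.mono (Tri.seq' (Tri.of_wp hB (.set .i (.c 0)) (Q := I (k + 1)) ?_) fun h' H =>
    Tri.seq' (hloop h' H) fun h' H' => Tri.of_wp hB _ ?_) ?_ (fun _ h => h)
  · simp only [Cmd.wp, Expr.ok, Expr.val, hI]
    refine ⟨by omega, Frame.set Frame.refl (by decide) _, by simp, hO, hOk, by simp, by simp⟩
  · obtain ⟨n, ⟨F, hi, hd, h0, -, hv⟩, hz⟩ := H'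
    have hk' : h'.v .k = k := (F.1 _ (by decide)).trans hvk
    have F' : Frame [.i, .go] [.O] h h' := F.mono (by decide) (by decide)
    simp only [carryEnd, Cmd.wp, Expr.ok, Expr.val, Store.put_v, Store.put_a, Store.set_v,
      Store.set_a, if_true, true_and, hk']
    refine ⟨by omega, by omega, ⟨by omega, by omega⟩, fun hlt => ⟨Frame.put F' (by decide) _ _,
      Or.inl ⟨F.1 _ (by decide), ?_, ?_, ?_⟩⟩, fun hlt => ⟨by omega,
      Frame.set (Frame.put F' (by decide) _ _) (by decide) _, Or.inr ?_⟩⟩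
    · have := binVal_update (o := h'.a .O) hlt 1
      rw [hz] at this
      omega
    · intro i hik
      by_cases e : i = h'.v .i
      · subst e; simp
      · rw [Function.update_of_ne e]; exact hd i hik
    · rw [Function.update_of_ne (by omega)]; exact h0
    · have e : h'.v .i = k + 1 := by omega
      rw [e] at hv
      have := binVal_lt (L := k + 1) fun i hi => hO i hi.le
      omega
  · have h1 : (Cmd.set .i (.c 0)).cost ≤ 10 := by decide
    have h2 : carryStep.cost ≤ 20 := by decide
    have h3 : carryEnd.cost ≤ 20 := by decide
    have := Nat.mul_le_mul_right (k + 1) (show carryStep.cost + 4 + 1 ≤ 25 by omega)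
    omega

/-- The attempt to find a better labelling with the current orientations. -/
def guessStep : Prog :=
  .seq build (.seq flow (.seq clearLists
    (ifLt (.c 0) (.v .found) (Cmd.set .go (.c 0)).code increment)))

/-- Start of the search for a better labelling. -/
def compressInit : Cmd := .set .go (.c 1) ;; .set .found (.c 0)

/-- Given a labelling that violates equations of weight at most `k` among the first `j`, search
for one that does so among the first `j + 1`. -/
def compress : Prog :=
  .seq (forLt (.add (.v .k) (.c 2)) (.put .O (.v .i) (.c 0)))
    (.seq compressInit.code (whileLt (.c 0) (.v .go) guessStep))

/-- The variables changed by `compress`. -/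
abbrev compressVars : List Var :=
  [.x, .y, .w, .b, .d, .p₀, .q₀, .p₁, .q₁, .rk, .A, .i, .qh, .qt, .cur, .fl, .found, .go]

/-- The arrays changed by `compress`. -/
abbrev compressArrs : List Arr :=
  [.src, .tgt, .rv, .rs, .nx, .hd, .vis, .pa, .q, .X, .O]

/-- With the orientations `o` the network has no cut of capacity at most `k`. -/
def NoCut (E : EdgeSystem) (n k J : ℕ) (lab o : ℕ → ℕ) : Prop :=
  ∀ Z : Set ℕ, n + 2 ∈ Z → n + 1 ∉ Z →
    k < outCap (4 * J) (E.src (n + 2) (n + 1) lab o) (E.tgt (n + 2) (n + 1) lab o) E.cap Z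

/-- The invariant of `compress`, where `c` choices of orientations remain to be tried. -/
structure GuessInv (E : EdgeSystem) (n k J : ℕ) (h : Store) (c : ℕ) (h' : Store) : Prop where
  frame : Frame compressVars compressArrs h h'
  unlisted : ∀ v, h'.a .hd v = 0
  unmarked : ∀ v, h'.a .vis v = 0
  cases :
    (h'.v .go = 1 ∧ h'.v .found = 0 ∧ h'.a .X = h.a .X ∧ (∀ i ≤ k + 1, h'.a .O i ≤ 1) ∧
      h'.a .O (k + 1) = 0 ∧ binVal (k + 1) (h'.a .O) + c = 2 ^ (k + 1) ∧
      ∀ f : ℕ → ℕ, (∀ i, f i ≤ 1) → binVal (k + 1) f < binVal (k + 1) (h'.a .O) →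
        ∃ o, (∀ i < k + 1, o i = f i) ∧ NoCut E n k J (h.a .X) o) ∨
    (h'.v .go = 0 ∧ h'.v .found = 0 ∧
      ∀ f : ℕ → ℕ, (∀ i, f i ≤ 1) →
        ∃ o, (∀ i < k + 1, o i = f i) ∧ NoCut E n k J (h.a .X) o) ∨
    (h'.v .go = 0 ∧ h'.v .found = 1 ∧ ∃ o, ∃ Z : Set ℕ, n + 2 ∈ Z ∧ n + 1 ∉ Z ∧
      outCap (4 * J) (E.src (n + 2) (n + 1) (h.a .X) o) (E.tgt (n + 2) (n + 1) (h.a .X) o) E.cap Z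
        ≤ k ∧ h'.a .X = EdgeSystem.flip (h.a .X) Z)

/-- Either the current network has a small cut, which is kept, or its orientations join those known
to fail. Counter value plus `c` is `2 ^ (k + 1)` while guesses remain. -/
theorem tri_guessStep {D B : ℕ} {E : EdgeSystem} {n m k j c : ℕ} {h h' : Store} (hB : 16 * D ≤ B)
    (hm : 4 * m + 1 < D) (hn : n + 2 < D) (hk : k + 2 < D) (hE : HasSys E n m h)
    (hU : ∀ j, E.U j ≤ n) (hV : ∀ j, E.V j ≤ n) (hR : ∀ j, E.R j ≤ 1) (hW : ∀ j, 2 * E.W j ≤ B)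
    (hlab : ∀ v, h.a .X v ≤ 1) (hj : j < m) (hvj : h.v .j = j) (hvk : h.v .k = k)
    (H : GuessInv E n k (j + 1) h c h') (hgo : 0 < h'.v .go) :
    Tri D B guessStep (20000 * (j + 1) * (k + 1)) h' fun h'' =>
      ∃ c' < c, GuessInv E n k (j + 1) h c' h'' := by
  obtain ⟨F, hhd, hvis, ⟨hgo1, hf, hX, hO, hOk, hc, hno⟩ | ⟨hgo0, _⟩ | ⟨hgo0, _⟩⟩ := H
  rotate_left
  · omega
  · omega
  have hcpos : 0 < c := by
    have := binVal_lt (L := k + 1) fun i hi => hO i hi.le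
    omega
  have hj' : h'.v .j = j := (F.1 _ (by decide)).trans hvj
  have hk' : h'.v .k = k := (F.1 _ (by decide)).trans hvk
  have hE' := hE.frame F
  refine Tri.mono (Tri.seq' (tri_build hB hm hn hE' hU hV hR (by rw [hX]; exact hlab) hj hj' hhd)
    (T' := 18000 * (j + 1) * (k + 1)) ?_) ?_ (fun _ h => h)
  swap
  · nlinarith
  rintro h₁ ⟨F₁, hN₁, hrs₁⟩
  have hE₁ := hE'.frame F₁
  have hvis₁ : h₁.a .vis = h'.a .vis := F₁.2 _ (by decide)
  have hX₁ : h₁.a .X = h'.a .X := F₁.2 _ (by decide)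
  have hO₁ : h₁.a .O = h'.a .O := F₁.2 _ (by decide)
  have hgo₁ : h₁.v .go = 1 := (F₁.1 _ (by decide)).trans hgo1
  have hA : 4 * (j + 1) + 1 < D := by omega
  refine Tri.mono (Tri.seq' (tri_flow hB hA hn (T := n + 1) (by omega) (by omega)
    (c := E.cap) (k := k) (fun a _ => E.tgt_le hU hV _ _ a) (fun a ha => ⟨EdgeSystem.rev_lt ha,
      E.src_rev _ _ _ _ a, E.tgt_rev _ _ _ _ a⟩) (fun a _ => ?_) hN₁ hE₁.var_t
      ((F₁.1 _ (by decide)).trans hk') ((F₁.1 _ (by decide)).trans hf) (by rw [hvis₁]; exact hvis)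
      hrs₁) (T' := 8000 * (j + 1) * (k + 1)) ?_) ?_ (fun _ h => h)
  · rw [EdgeSystem.cap, EdgeSystem.cap, EdgeSystem.rev_div]
    have := hW (a / 4)
    omega
  swap
  · nlinarith
  rintro h₂ ⟨F₂, hvis₂, hres⟩
  have hN₂ := hN₁.frame F₂
  refine Tri.mono (Tri.seq' (tri_clearLists hB (by omega) hn (fun a _ => E.src_le hU hV _ _ a) hN₂)
    (T' := 4000 * (j + 1) * (k + 1)) ?_) ?_ (fun _ h => h)
  swap
  · nlinarith
  rintro h₃ ⟨F₃, hhd₃⟩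
  have hvis₃ : h₃.a .vis = h₂.a .vis := F₃.2 _ (by decide)
  have hX₃ : h₃.a .X = h₂.a .X := F₃.2 _ (by decide)
  have hO₃ : h₃.a .O = h'.a .O :=
    ((F₃.2 _ (by decide)).trans (F₂.2 _ (by decide))).trans hO₁
  have hgo₃ : h₃.v .go = 1 := ((F₃.1 _ (by decide)).trans (F₂.1 _ (by decide))).trans hgo₁
  have hf₃ : h₃.v .found = h₂.v .found := F₃.1 _ (by decide)
  have F' : Frame compressVars compressArrs h h₃ :=
    ((F.trans (F₁.mono (by decide) (by decide))).trans (F₂.mono (by decide) (by decide))).trans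
      (F₃.mono (by decide) (by decide))
  have hk₃ : h₃.v .k = k := (F'.1 _ (by decide)).trans hvk
  rw [hX₁, hX] at hres
  refine Tri.mono (Tri.ifLt hB (T := 100 * (k + 2)) (by simp [Expr.ok]) (by simp [Expr.ok]) ?_ ?_)
    ?_ (fun _ h => h)
  · intro hlt
    simp only [Expr.val, hf₃] at hlt
    refine Tri.mono (Tri.of_wp hB (.set .go (.c 0))
      (Q := fun h'' => ∃ c' < c, GuessInv E n k (j + 1) h c' h'') ?_)
      ((show (Cmd.set .go (.c 0)).cost ≤ 100 by decide).trans (by omega)) (fun _ h => h)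
    simp only [Cmd.wp, Expr.ok, Expr.val]
    refine ⟨by omega, 0, hcpos, Frame.set F' (by decide) _, hhd₃, by
      rw [Store.set_a, hvis₃]; exact hvis₂, Or.inr (Or.inr ?_)⟩
    rcases hres with ⟨h0, _⟩ | ⟨h1, Z, hZ, hZ', hle, hfl⟩
    · omega
    · exact ⟨by simp, by simp [hf₃, h1], _, Z, hZ, hZ', hle, by rw [Store.set_a, hX₃, hfl]⟩
  · intro hlt
    simp only [Expr.val, hf₃] at hlt
    rcases hres with ⟨h0, hX₂, hcut⟩ | ⟨h1, _⟩
    swap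
    · omega
    refine Tri.mono (tri_increment hB hk hk₃ (by rw [hO₃]; exact hO) (by rw [hO₃]; exact hOk))
      le_rfl ?_
    rintro h₄ ⟨F₄, H₄⟩
    have hf₄ : h₄.v .found = 0 := ((F₄.1 _ (by decide)).trans hf₃).trans h0
    have hhd₄ : h₄.a .hd = h₃.a .hd := F₄.2 _ (by decide)
    have hvis₄ : h₄.a .vis = h₃.a .vis := F₄.2 _ (by decide)
    have hX₄ : h₄.a .X = h.a .X := ((F₄.2 _ (by decide)).trans hX₃).trans hX₂
    have hno' : ∀ f : ℕ → ℕ, (∀ i, f i ≤ 1) →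
        binVal (k + 1) f < binVal (k + 1) (h'.a .O) + 1 →
        ∃ o, (∀ i < k + 1, o i = f i) ∧ NoCut E n k (j + 1) (h.a .X) o := by
      intro f hf hlt
      rcases Nat.lt_succ_iff_lt_or_eq.1 hlt with hlt | he
      · exact hno f hf hlt
      -- A choice `f` with the value of the counter agrees with the orientations just refuted on the
      -- first `k + 1` bits; other bits are immaterial.
      · exact ⟨h'.a .O, binVal_inj (fun i hi => hO i hi.le) (fun i _ => hf i) he.symm, hcut⟩
    have base : ∀ c' < c, _ → ∃ c' < c, GuessInv E n k (j + 1) h c' h₄ := fun c' hc' hcs =>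
      ⟨c', hc', F'.trans (F₄.mono (by decide) (by decide)), by rw [hhd₄]; exact hhd₃,
        by rw [hvis₄, hvis₃]; exact hvis₂, hcs⟩
    rw [hO₃] at H₄
    rcases H₄ with ⟨g1, g2, g3, g4⟩ | ⟨g1, g2⟩
    · refine base (c - 1) (by omega) (Or.inl ⟨by omega, hf₄, hX₄, g3, g4, by omega, ?_⟩)
      rw [g2]
      exact hno'
    · refine base 0 hcpos (Or.inr (Or.inl ⟨g1, hf₄, fun f hf => hno' f hf ?_⟩))
      rw [g2]
      exact binVal_lt fun i _ => hf i
  · simp only [Expr.cost]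
    nlinarith

theorem tri_compress {D B : ℕ} {E : EdgeSystem} {n m k j : ℕ} {h : Store} (hB : 16 * D ≤ B)
    (hm : 4 * m + 1 < D) (hn : n + 2 < D) (hk : k + 2 < D) (hE : HasSys E n m h)
    (hU : ∀ j, E.U j ≤ n) (hV : ∀ j, E.V j ≤ n) (hR : ∀ j, E.R j ≤ 1) (hW : ∀ j, 2 * E.W j ≤ B)
    (hW' : ∀ j, 0 < E.W j) (hlab : ∀ v, h.a .X v ≤ 1) (hj : j < m) (hvj : h.v .j = j)
    (hvk : h.v .k = k) (hhd : ∀ v, h.a .hd v = 0) (hvis : ∀ v, h.a .vis v = 0)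
    (hcost : E.cost j (h.a .X) ≤ k) :
    Tri D B compress (21000 * (j + 1) * (k + 1) * 2 ^ (k + 1)) h fun h' =>
      Frame compressVars compressArrs h h' ∧ (∀ v, h'.a .hd v = 0) ∧ (∀ v, h'.a .vis v = 0) ∧
      ((h'.v .found = 1 ∧ (∀ v, h'.a .X v ≤ 1) ∧ E.cost (j + 1) (h'.a .X) ≤ k) ∨
      (h'.v .found = 0 ∧ ∀ lab, k < E.cost (j + 1) lab)) := by
  -- At most `k` violations among the first `j` equations and one from the new equation: hence `k +
  -- 1` bits.
  have hrank : E.rank (h.a .X) (j + 1) ≤ k + 1 := by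
    have := E.rank_le_cost hW' (h.a .X) j
    rw [E.rank_succ]
    split_ifs <;> omega
  refine Tri.mono (Tri.seq' (Tri.forLt hB (N := k + 2) (by omega) (fun i h' =>
    Frame [.i] [.O] h h' ∧ ∀ i' < i, h'.a .O i' = 0) ?_ ?_ ?_) fun h₁ H₁ => Tri.seq'
      (Tri.of_wp hB compressInit (Q := fun h' => GuessInv E n k (j + 1) h (2 ^ (k + 1)) h') ?_)
      fun h₂ H₂ => Tri.whileLt hB (GuessInv E n k (j + 1) h) ?_
      (fun c h' H hlt => tri_guessStep hB hm hn hk hE hU hV hR hW hlab hj hvj hvk H (by simpa [Expr.val] using hlt)) ?_ H₂)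
    ?_ (fun _ h => h)
  · exact ⟨Frame.set Frame.refl (by decide) _, fun i' hi' => by omega⟩
  · rintro i h' ⟨F, -⟩
    have : h'.v .k = k := (F.1 _ (by decide)).trans hvk
    simp only [Expr.ok, Expr.val, this, true_and, and_true]
    omega
  · rintro i h' ⟨F, H⟩ hvi hi
    simp only [Cmd.wp, Expr.ok, Expr.val, hvi, true_and, Store.put_v, Store.set_a, Store.put_a,
      if_true]
    refine ⟨by omega, by omega, Frame.set (Frame.put F (by decide) _ _) (by decide) _, ?_⟩
    intro i' hi'
    by_cases e : i' = i
    · subst e; simp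
    · rw [Function.update_of_ne e]; exact H i' (by omega)
  · obtain ⟨F, H⟩ := H₁
    have hX₁ : h₁.a .X = h.a .X := F.2 _ (by decide)
    have hhd₁ : h₁.a .hd = h.a .hd := F.2 _ (by decide)
    have hvis₁ : h₁.a .vis = h.a .vis := F.2 _ (by decide)
    have h0 : binVal (k + 1) (h₁.a .O) = 0 :=
      Finset.sum_eq_zero fun i hi => by
        rw [H i (by have := Finset.mem_range.1 hi; omega), zero_mul]
    simp only [compressInit, Cmd.wp, Expr.ok, Expr.val]
    refine ⟨by omega, by omega, ?_, by simpa [hhd₁] using hhd, by simpa [hvis₁] using hvis, Or.inl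
      ⟨by simp, by simp, by simpa using hX₁, ?_, ?_, ?_, ?_⟩⟩
    · exact Frame.set (Frame.set (F.mono (by decide) (by decide)) (by decide) _) (by decide) _
    · intro i hi
      rw [Store.set_a, Store.set_a, H i (by omega)]
      omega
    · exact H _ (by omega)
    · rw [Store.set_a, Store.set_a, h0, zero_add]
    · intro f _ hlt
      rw [Store.set_a, Store.set_a, h0] at hlt
      omega
  · rintro c h' H
    simp [Expr.ok]
  · rintro c h' H hlt
    simp only [Expr.val] at hlt
    refine ⟨H.frame, H.unlisted, H.unmarked, ?_⟩
    rcases H.cases with ⟨g, _⟩ | ⟨-, g1, g2⟩ | ⟨-, g1, o, Z, hZ, hZ', hle, hfl⟩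
    · omega
    · refine Or.inr ⟨g1, fun lab => ?_⟩
      -- All orientations failed. A labelling `lab` has a matching choice `f`, for which its cost is
      -- the capacity of a cut, hence exceeds `k`.
      obtain ⟨f, hf, hcut⟩ := E.exists_cut hU hV (Nat.lt_succ_self n) (Nat.lt_succ_self (n + 1))
        (h.a .X) lab hrank
      obtain ⟨o, ho, hno⟩ := g2 f hf
      obtain ⟨Z, hZ, hZ', e⟩ := hcut o ho
      rw [← e]
      exact hno Z hZ hZ'
    · refine Or.inl ⟨g1, fun v => ?_, ?_⟩
      · rw [hfl]
        have := hlab v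
        unfold EdgeSystem.flip
        split_ifs <;> omega
      · rw [hfl]
        exact (E.cost_flip_le hlab o (j + 1) hZ hZ').trans hle
  · have h1 : (Cmd.put .O (.v .i) (.c 0)).cost + 2 * (Expr.add (.v .k) (.c 2)).cost + 10 ≤ 30 := by
      decide
    have h2 : compressInit.cost ≤ 10 := by decide
    have h3 := Nat.mul_le_mul_right (k + 2 + 1) h1
    have h4 : 1 ≤ 2 ^ (k + 1) := Nat.one_le_two_pow
    simp only [Expr.cost]
    generalize 2 ^ (k + 1) = p at *
    have h5 : 30 * (k + 2 + 1) + 13 ≤ 900 * (j + 1) * (k + 1) := by nlinarith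
    have h6 : 900 * (j + 1) * (k + 1) * 1 ≤ 900 * (j + 1) * (k + 1) * p := Nat.mul_le_mul_left _ h4
    have h7 : 3 * p ≤ 3 * (j + 1) * (k + 1) * p := Nat.mul_le_mul_right _ (by nlinarith)
    nlinarith

/-- The treatment of one more equation. -/
def mainStep : Prog :=
  .seq compress (Cmd.ite (.c 0) (.v .found) (.set .j (.add (.v .j) (.c 1)))
    (.set .ans (.c 0) ;; .set .j (.v .m))).code

/-- Solution of the stored system. -/
def solve : Prog :=
  .seq (Cmd.set .ans (.c 1) ;; .set .j (.c 0)).code (whileLt (.v .j) (.v .m) mainStep)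

/-- The invariant of `solve`. -/
structure SolveInv (E : EdgeSystem) (k m : ℕ) (h h' : Store) : Prop where
  frame : Frame (.ans :: .j :: compressVars) compressArrs h h'
  unlisted : ∀ v, h'.a .hd v = 0
  unmarked : ∀ v, h'.a .vis v = 0
  cases :
    (h'.v .ans = 1 ∧ h'.v .j ≤ m ∧ (∀ v, h'.a .X v ≤ 1) ∧ E.cost (h'.v .j) (h'.a .X) ≤ k) ∨
    (h'.v .ans = 0 ∧ h'.v .j = m ∧ ∀ lab, k < E.cost m lab)

/-- Initially all labels are 0 and the empty prefix costs nothing. On failure `j` jumps to `m` to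
leave the loop; this is sound since `cost` grows with the prefix. -/
theorem tri_solve {D B : ℕ} {E : EdgeSystem} {n m k : ℕ} {h : Store} (hB : 16 * D ≤ B)
    (hm : 4 * m + 1 < D) (hn : n + 2 < D) (hk : k + 2 < D) (hE : HasSys E n m h)
    (hU : ∀ j, E.U j ≤ n) (hV : ∀ j, E.V j ≤ n) (hR : ∀ j, E.R j ≤ 1) (hW : ∀ j, 2 * E.W j ≤ B)
    (hW' : ∀ j, 0 < E.W j) (hvm : h.v .m = m) (hvk : h.v .k = k) (hX : ∀ v, h.a .X v = 0)
    (hhd : ∀ v, h.a .hd v = 0) (hvis : ∀ v, h.a .vis v = 0) :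
    Tri D B solve (22000 * (m + 1) * (k + 1) * 2 ^ (k + 1) * (m + 1)) h fun h' =>
      (h'.v .ans = 1 ∧ ∃ lab, E.cost m lab ≤ k) ∨ (h'.v .ans = 0 ∧ ∀ lab, k < E.cost m lab) := by
  set I : ℕ → Store → Prop := fun c h' => SolveInv E k m h h' ∧ c = m - h'.v .j with hI
  refine Tri.mono (Tri.seq' (Tri.of_wp hB (.set .ans (.c 1) ;; .set .j (.c 0)) (Q := I m) ?_)
    fun h₁ H₁ => Tri.whileLt hB (T := 21000 * (m + 1) * (k + 1) * 2 ^ (k + 1) + 20) I ?_ ?_ ?_ H₁)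
    ?_ (fun _ h => h)
  · simp only [Cmd.wp, Expr.ok, Expr.val, hI]
    refine ⟨by omega, by omega, ⟨Frame.set (Frame.set Frame.refl (by decide) _) (by decide) _, hhd,
      hvis, Or.inl ⟨by simp, by simp, fun v => ?_, ?_⟩⟩, by simp⟩
    · rw [Store.set_a, Store.set_a, hX]
      omega
    · simp [EdgeSystem.cost]
  · rintro c h' -
    simp only [Expr.ok, and_self]
  · rintro c h' ⟨⟨F, hhd', hvis', hcs⟩, hc⟩ hlt
    have hm' : h'.v .m = m := (F.1 _ (by decide)).trans hvm
    simp only [Expr.val, hm'] at hlt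
    rcases hcs with ⟨hans, hj, hX', hcost⟩ | ⟨-, hj, -⟩
    swap
    · omega
    refine Tri.mono (Tri.seq' (tri_compress hB hm hn hk (hE.frame F) hU hV hR hW hW' hX' hlt rfl
      ((F.1 _ (by decide)).trans hvk) hhd' hvis' hcost) fun h₁ H₁ => Tri.of_wp hB _ ?_) ?_
      (fun _ h => h)
    · obtain ⟨F₁, hhd₁, hvis₁, H₁⟩ := H₁
      have hj₁ : h₁.v .j = h'.v .j := F₁.1 _ (by decide)
      have hm₁ : h₁.v .m = m := (F₁.1 _ (by decide)).trans hm'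
      have ha₁ : h₁.v .ans = 1 := (F₁.1 _ (by decide)).trans hans
      have F' : Frame (.ans :: .j :: compressVars) compressArrs h h₁ :=
        F.trans (F₁.mono (by decide) (by decide))
      simp only [Cmd.wp, Expr.ok, Expr.val, true_and, hj₁, Store.set_v, reduceCtorEq,
        if_false, hm₁, hI]
      refine ⟨by omega, fun hf => ⟨⟨by omega, by omega⟩, m - (h'.v .j + 1), by omega,
        ⟨F'.set (by decide) _, hhd₁, hvis₁, Or.inl ?_⟩, by simp⟩, fun hf => ⟨by omega, 0, by omega,
        ⟨(F'.set (by decide) _).set (by decide) _, hhd₁, hvis₁, Or.inr ?_⟩, by simp⟩⟩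
      · rcases H₁ with ⟨-, g2, g3⟩ | ⟨g1, -⟩
        · exact ⟨by simpa using ha₁, by simpa using hlt, g2, by simpa using g3⟩
        · omega
      · rcases H₁ with ⟨g1, -⟩ | ⟨-, g2⟩
        · omega
        · exact ⟨by simp, by simp, fun lab => (g2 lab).trans_le (E.cost_mono lab hlt)⟩
    · refine Nat.add_le_add ?_ (by decide)
      gcongr
  · rintro c h' ⟨⟨F, -, -, hcs⟩, hc⟩ hlt
    have hm' : h'.v .m = m := (F.1 _ (by decide)).trans hvm
    simp only [Expr.val, hm'] at hlt
    rcases hcs with ⟨g1, g2, g3, g4⟩ | ⟨g1, g2, g3⟩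
    · have : h'.v .j = m := by omega
      exact Or.inl ⟨g1, _, this ▸ g4⟩
    · exact Or.inr ⟨g1, g3⟩
  · have h1 : (Cmd.set .ans (.c 1) ;; .set .j (.c 0)).cost ≤ 10 := by decide
    simp only [Expr.cost]
    have h2 : 1 ≤ (m + 1) * (k + 1) * 2 ^ (k + 1) :=
      Nat.mul_pos (Nat.mul_pos (by omega) (by omega)) (by positivity)
    have e1 : 21000 * (m + 1) * (k + 1) * 2 ^ (k + 1) =
      21000 * ((m + 1) * (k + 1) * 2 ^ (k + 1)) := by ring
    have e2 : 22000 * (m + 1) * (k + 1) * 2 ^ (k + 1) =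
      22000 * ((m + 1) * (k + 1) * 2 ^ (k + 1)) := by ring
    rw [e1, e2]
    generalize (m + 1) * (k + 1) * 2 ^ (k + 1) = p at *
    nlinarith

end RAM

/-! ### From instances to systems of edges -/

namespace LinEq2

variable {n : ℕ} (e : LinEq2 n)

/-- The sorted list of the indices of the variables of an equation. -/
def indices : List ℕ := (e.vars.sort (· ≤ ·)).map Fin.val

theorem encode_eq : e.encode = e.indices.length :: (e.indices ++ [e.rhs.val, e.weight]) := by
  simp [encode, indices]

theorem indices_cases (h : e.vars.card ≤ 2) :
    (e.indices = [] ∧ e.vars = ∅) ∨ (∃ a : Fin n, e.indices = [a.val] ∧ e.vars = {a}) ∨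
      ∃ a b : Fin n, a ≠ b ∧ e.indices = [a.val, b.val] ∧ e.vars = {a, b} := by
  have h1 : (e.vars.sort (· ≤ ·)).toFinset = e.vars := Finset.sort_toFinset _ _
  have h2 : (e.vars.sort (· ≤ ·)).Nodup := Finset.sort_nodup _ _
  have h3 : (e.vars.sort (· ≤ ·)).length = e.vars.card := Finset.length_sort _
  unfold indices
  rcases hl : e.vars.sort (· ≤ ·) with _ | ⟨a, _ | ⟨b, _ | ⟨c, l⟩⟩⟩
  · rw [hl] at h1
    exact Or.inl ⟨rfl, by rw [← h1]; rfl⟩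
  · rw [hl] at h1
    exact Or.inr (Or.inl ⟨a, rfl, by rw [← h1]; rfl⟩)
  · rw [hl] at h1 h2
    refine Or.inr (Or.inr ⟨a, b, ?_, rfl, by rw [← h1]; simp⟩)
    rintro rfl
    simp at h2
  · rw [hl] at h3
    simp at h3
    omega

end LinEq2

namespace LinSystem2

variable (S : LinSystem2)

/-- The system of edges for a system of equations.  The vertex `n` serves as second end of the edges
for equations with less than two variables. -/
def edges : EdgeSystem where
  U j := (S.eqs[j]?).elim S.n fun e => e.indices.getD 0 S.n
  V j := (S.eqs[j]?).elim S.n fun e => e.indices.getD 1 S.n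
  R j := (S.eqs[j]?).elim 0 fun e => e.rhs.val
  W j := (S.eqs[j]?).elim 1 LinEq2.weight

theorem indices_getD_le {n : ℕ} (e : LinEq2 n) (i : ℕ) : e.indices.getD i n ≤ n := by
  by_cases h : i < e.indices.length
  · rw [List.getD_eq_getElem _ _ h]
    simp [LinEq2.indices]
  · rw [List.getD_eq_default _ _ (by omega)]

theorem edges_U_le (j : ℕ) : S.edges.U j ≤ S.n := by
  simp only [edges]
  rcases S.eqs[j]? with _ | e
  · exact le_rfl
  · exact indices_getD_le e 0

theorem edges_V_le (j : ℕ) : S.edges.V j ≤ S.n := by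
  simp only [edges]
  rcases S.eqs[j]? with _ | e
  · exact le_rfl
  · exact indices_getD_le e 1

theorem edges_R_le (j : ℕ) : S.edges.R j ≤ 1 := by
  simp only [edges]
  rcases S.eqs[j]? with _ | e
  · exact Nat.zero_le _
  · exact Nat.lt_succ_iff.1 (ZMod.val_lt e.rhs)

theorem edges_W_pos (j : ℕ) : 0 < S.edges.W j := by
  simp only [edges]
  rcases S.eqs[j]? with _ | e
  · exact Nat.one_pos
  · exact e.weight_pos

/-- A labelling of the vertices that corresponds to an assignment violates the same equations. -/
theorem edges_viol_iff (hS : ∀ e ∈ S.eqs, e.vars.card ≤ 2) {x : Fin S.n → ZMod 2} {lab : ℕ → ℕ}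
    (hx : ∀ i : Fin S.n, x i = lab i + lab S.n) {j : ℕ} (hj : j < S.eqs.length) :
    S.edges.Viol lab j ↔ ¬ S.eqs[j].Holds x := by
  set e := S.eqs[j] with he
  have two : (2 : ZMod 2) = 0 := rfl
  have key : ((lab (S.edges.U j) + lab (S.edges.V j) + S.edges.R j : ℕ) : ZMod 2) =
      ∑ i ∈ e.vars, x i + e.rhs := by
    have hR : S.edges.R j = e.rhs.val := by simp [edges, hj, he]
    have hU : S.edges.U j = e.indices.getD 0 S.n := by simp [edges, hj, he]
    have hV : S.edges.V j = e.indices.getD 1 S.n := by simp [edges, hj, he]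
    push_cast
    rw [hR, hU, hV, ZMod.natCast_zmod_val]
    congr 1
    -- Modulo 2 the label of the vertex `n` cancels if it occurs twice, as for zero or two
    -- variables; for one variable it occurs once on both sides.
    rcases e.indices_cases (hS e (List.getElem_mem hj)) with ⟨h1, h2⟩ | ⟨a, h1, h2⟩ |
      ⟨a, b, hab, h1, h2⟩
    · rw [h1, h2]
      simp only [List.getD_nil, Finset.sum_empty]
      linear_combination (lab S.n : ZMod 2) * two
    · rw [h1, h2]
      simp [hx]
    · rw [h1, h2, Finset.sum_pair hab]
      simp only [List.getD_cons_zero, List.getD_cons_succ, hx]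
      linear_combination (-lab S.n : ZMod 2) * two
  have h1 : S.edges.Viol lab j ↔
      ((lab (S.edges.U j) + lab (S.edges.V j) + S.edges.R j : ℕ) : ZMod 2) ≠ 0 := by
    rw [Ne, ZMod.natCast_eq_zero_iff, EdgeSystem.Viol]
    omega
  rw [h1, key, LinEq2.Holds, ← sub_eq_zero (a := ∑ i ∈ e.vars, x i)]
  have : ∑ i ∈ e.vars, x i + e.rhs = ∑ i ∈ e.vars, x i - e.rhs := by
    linear_combination e.rhs * two
  rw [this]

theorem sum_range_length {α : Type*} (f : α → ℕ) :
    ∀ (l : List α) (g : ℕ → ℕ), (∀ (j : ℕ) (h : j < l.length), g j = f l[j]) →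
      ∑ j ∈ Finset.range l.length, g j = (l.map f).sum
  | [], _, _ => by simp
  | a :: l, g, h => by
    rw [List.length_cons, Finset.sum_range_succ', List.map_cons, List.sum_cons,
      sum_range_length f l (fun j => g (j + 1)) fun j hj => h (j + 1) (by simpa using hj),
      h 0 (by simp), add_comm]
    rfl

theorem satWeight_add_cost (hS : ∀ e ∈ S.eqs, e.vars.card ≤ 2) {x : Fin S.n → ZMod 2} {lab : ℕ → ℕ}
    (hx : ∀ i : Fin S.n, x i = lab i + lab S.n) :
    S.satWeight x + S.edges.cost S.m lab = S.totalWeight := by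
  have h1 : S.edges.cost S.m lab =
      (S.eqs.map fun e => if e.Holds x then 0 else e.weight).sum := by
    refine sum_range_length _ _ _ fun j hj => ?_
    rw [if_congr (S.edges_viol_iff hS hx hj) rfl rfl, ite_not]
    simp [edges, hj]
  rw [h1, satWeight, totalWeight]
  induction S.eqs with
  | nil => simp
  | cons e l ih =>
    by_cases he : e.Holds x
    · simp only [List.filter_cons, he, decide_true, if_true, List.map_cons, List.sum_cons]
      omega
    · simp only [List.filter_cons, he, decide_false, if_false, List.map_cons, List.sum_cons,
        Bool.false_eq_true]
      omega

theorem exists_satWeight_iff (hS : ∀ e ∈ S.eqs, e.vars.card ≤ 2) (k : ℕ) :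
    (∃ x : Fin S.n → ZMod 2, (S.totalWeight : ℤ) - k ≤ S.satWeight x) ↔
      ∃ lab, S.edges.cost S.m lab ≤ k := by
  constructor
  · rintro ⟨x, hx⟩
    -- The default value 0 applies at the vertex `n`, so adding its label changes nothing.
    refine ⟨fun v => if h : v < S.n then (x ⟨v, h⟩).val else 0, ?_⟩
    have := S.satWeight_add_cost hS (x := x)
      (lab := fun v => if h : v < S.n then (x ⟨v, h⟩).val else 0) (fun i => by simp)
    omega
  · rintro ⟨lab, hlab⟩
    refine ⟨fun i => lab i + lab S.n, ?_⟩
    have := S.satWeight_add_cost hS (x := fun i => lab i + lab S.n) (lab := lab) (fun i => rfl)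
    omega

end LinSystem2

namespace MaxLin2BInst

variable (I : MaxLin2BInst 2)

/-- The position in the input of the `i`-th equation. -/
def pos (i : ℕ) : ℕ := 3 + ((I.S.eqs.take i).flatMap LinEq2.encode).length

theorem pos_succ {i : ℕ} (hi : i < I.S.eqs.length) :
    I.pos (i + 1) = I.pos i + I.S.eqs[i].encode.length := by
  simp only [pos]
  rw [List.take_succ_eq_append_getElem hi, List.flatMap_append, List.length_append]
  simp [add_assoc]

theorem encode_length_le {i : ℕ} (hi : i < I.S.eqs.length) : I.S.eqs[i].encode.length ≤ 5 := by
  have := I.card_le _ (List.getElem_mem hi)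
  simp [LinEq2.encode]
  omega

theorem pos_le {i : ℕ} (hi : i ≤ I.S.eqs.length) : I.pos i ≤ 3 + 5 * i := by
  induction i with
  | zero => simp [pos]
  | succ i ih =>
    have h1 := I.pos_succ (i := i) (by omega)
    have h2 := I.encode_length_le (i := i) (by omega)
    have h3 := ih (by omega)
    omega

theorem length_encode : ((maxLin2B 2).encode I).length = I.pos I.S.eqs.length := by
  simp [maxLin2B, pos]
  omega

theorem encode_getD {i r : ℕ} (hi : i < I.S.eqs.length) (hr : r < I.S.eqs[i].encode.length) :
    ((maxLin2B 2).encode I).getD (I.pos i + r) 0 = I.S.eqs[i].encode.getD r 0 := by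
  have e : (maxLin2B 2).encode I = ([I.k, I.S.n, I.S.m] ++
      (I.S.eqs.take i).flatMap LinEq2.encode) ++
      (I.S.eqs[i].encode ++ (I.S.eqs.drop (i + 1)).flatMap LinEq2.encode) := by
    have : I.S.eqs = I.S.eqs.take i ++ I.S.eqs[i] :: I.S.eqs.drop (i + 1) := by
      simp
    change [I.k, I.S.n, I.S.m] ++ I.S.eqs.flatMap LinEq2.encode = _
    have := congrArg (List.flatMap LinEq2.encode) this
    rw [List.flatMap_append, List.flatMap_cons] at this
    rw [this, List.append_assoc]
  have hl : ([I.k, I.S.n, I.S.m] ++ (I.S.eqs.take i).flatMap LinEq2.encode).length = I.pos i := by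
    simp [pos]
    omega
  rw [e, List.getD_append_right _ _ _ _ (by omega), hl, Nat.add_sub_cancel_left,
    List.getD_append _ _ _ _ hr]

end MaxLin2BInst

/-! ### Reading the input -/

namespace RAM

/-- Reading of an equation. -/
def parseStep : Cmd :=
  .set .x (.a .inp (.v .p)) ;; .put .U (.v .i) (.v .n) ;; .put .V (.v .i) (.v .n) ;;
  .ite (.c 0) (.v .x) (.put .U (.v .i) (.a .inp (.add (.v .p) (.c 1)))) .skip ;;
  .ite (.c 1) (.v .x) (.put .V (.v .i) (.a .inp (.add (.v .p) (.c 2)))) .skip ;;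
  .set .p (.add (.v .p) (.add (.v .x) (.c 1))) ;;
  .put .R (.v .i) (.a .inp (.v .p)) ;;
  .put .W (.v .i) (.a .inp (.add (.v .p) (.c 1))) ;;
  .set .p (.add (.v .p) (.c 2))

/-- The numbers of the auxiliary vertices. -/
def parseInit : Cmd :=
  .set .t (.add (.v .n) (.c 1)) ;; .set .s (.add (.v .n) (.c 2)) ;; .set .p (.c 3)

/-- Reading of the input. -/
def parse : Prog := .seq parseInit.code (forLt (.v .m) parseStep)

theorem tri_parse {D B : ℕ} (I : MaxLin2BInst 2) {h : Store} (hB : 16 * D ≤ B)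
    (hm : 5 * I.S.m + 10 < D) (hn : I.S.n + 2 < D) (hvn : h.v .n = I.S.n) (hvm : h.v .m = I.S.m)
    (hinp : ∀ i < D, h.a .inp i = ((maxLin2B 2).encode I).getD i 0) :
    Tri D B parse (500 * (I.S.m + 1)) h fun h' =>
      Frame [.x, .p, .i, .t, .s] [.U, .V, .R, .W] h h' ∧ HasSys I.S.edges I.S.n I.S.m h' := by
  have hml : I.S.m = I.S.eqs.length := rfl
  set J : ℕ → Store → Prop := fun i h' => i ≤ I.S.m ∧
    Frame [.x, .p, .i, .t, .s] [.U, .V, .R, .W] h h' ∧ HasSys I.S.edges I.S.n i h' ∧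
    h'.v .p = I.pos i with hJ
  refine Tri.mono (Tri.seq' (P := fun h' => J 0 (h'.set .i 0)) (Tri.of_wp hB parseInit ?_)
    fun h' H => Tri.forLt hB (N := I.S.m) (by omega) J H ?_ ?_) ?_ ?_
  · simp only [parseInit, Cmd.wp, Expr.ok, Expr.val, Store.set_v, reduceCtorEq, if_false, hvn,
      true_and, hJ]
    refine ⟨by omega, by omega, by omega, by omega, ?_, ⟨?_, ?_, ?_, ?_, ?_, ?_, ?_⟩, ?_⟩
    · refine Frame.set (Frame.set (Frame.set (Frame.set Frame.refl ?_ _) ?_ _) ?_ _) ?_ _ <;> decide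
    · simpa using hvn
    · simp
    · simp
    · intro j hj; omega
    · intro j hj; omega
    · intro j hj; omega
    · intro j hj; omega
    · simp [MaxLin2BInst.pos]
  · rintro i h' ⟨-, F, -⟩
    exact ⟨trivial, (F.1 _ (by decide)).trans hvm⟩
  · rintro i h' ⟨-, F, hE, hp⟩ hvi hi
    rw [hml] at hi
    have hpos := I.pos_succ hi
    have hposle := I.pos_le (i := i + 1) hi
    have hlen := I.encode_length_le hi
    have henc : ∀ r < I.S.eqs[i].encode.length,
        h'.a .inp (I.pos i + r) = I.S.eqs[i].encode.getD r 0 := by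
      intro r hr
      rw [F.2 _ (by decide), hinp _ (by omega), I.encode_getD hi hr]
    have hn' : h'.v .n = I.S.n := hE.var_n
    have hU : I.S.edges.U i = I.S.eqs[i].indices.getD 0 I.S.n := by
      simp [LinSystem2.edges, hi]
    have hV : I.S.edges.V i = I.S.eqs[i].indices.getD 1 I.S.n := by
      simp [LinSystem2.edges, hi]
    have hR : I.S.edges.R i = I.S.eqs[i].rhs.val := by simp [LinSystem2.edges, hi]
    have hW : I.S.edges.W i = I.S.eqs[i].weight := by simp [LinSystem2.edges, hi]
    have upd : ∀ {f g : ℕ → ℕ} {y : ℕ}, (∀ a' < i, f a' = g a') → y = g i →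
        ∀ a' < i + 1, Function.update f i y a' = g a' := by
      intro f g y hfg hy a' ha'
      by_cases e' : a' = i
      · subst e'; rw [Function.update_self, hy]
      · rw [Function.update_of_ne e']; exact hfg a' (by omega)
    rw [LinEq2.encode_eq] at hlen henc hpos
    set L := I.S.eqs[i].indices with hL
    have hlenL : (L.length :: (L ++ [I.S.eqs[i].rhs.val, I.S.eqs[i].weight])).length =
        L.length + 3 := by simp
    rw [hlenL] at hlen henc hpos
    have g0 : h'.a .inp (I.pos i) = L.length := by simpa using henc 0 (by omega)
    have g1 : 0 < L.length → h'.a .inp (I.pos i + 1) = I.S.edges.U i := by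
      intro hl
      rw [henc 1 (by omega), hU, List.getD_cons_succ, List.getD_append _ _ _ _ hl,
        List.getD_eq_getElem _ _ hl, List.getD_eq_getElem _ _ hl]
    have g2 : 1 < L.length → h'.a .inp (I.pos i + 2) = I.S.edges.V i := by
      intro hl
      rw [henc 2 (by omega), hV, List.getD_cons_succ, List.getD_append _ _ _ _ hl,
        List.getD_eq_getElem _ _ hl, List.getD_eq_getElem _ _ hl]
    have g1' : ¬ 0 < L.length → I.S.n = I.S.edges.U i := by
      intro hl
      rw [hU, List.getD_eq_default _ _ (by omega)]
    have g2' : ¬ 1 < L.length → I.S.n = I.S.edges.V i := by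
      intro hl
      rw [hV, List.getD_eq_default _ _ (by omega)]
    have g3 : h'.a .inp (I.pos i + (L.length + 1)) = I.S.edges.R i := by
      rw [henc _ (by omega), hR, List.getD_cons_succ, List.getD_append_right _ _ _ _ le_rfl]
      simp
    have g4 : h'.a .inp (I.pos i + (L.length + 1) + 1) = I.S.edges.W i := by
      rw [add_assoc, henc _ (by omega), hW, List.getD_cons_succ,
        List.getD_append_right _ _ _ _ (by omega)]
      simp
    -- The common end of the three branches, for two, one and no variables. Cells not overwritten
    -- keep the default end `n`.
    have fin : ∀ h'' : Store, Frame [.x, .p, .i, .t, .s] [.U, .V, .R, .W] h h'' →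
        (∀ r, r ≠ .x → r ≠ .p → h''.v r = h'.v r) → h''.v .p = I.pos (i + 1) →
        (∀ a < i + 1, h''.a .U a = I.S.edges.U a) → (∀ a < i + 1, h''.a .V a = I.S.edges.V a) →
        (∀ a < i + 1, h''.a .R a = I.S.edges.R a) → (∀ a < i + 1, h''.a .W a = I.S.edges.W a) →
        J (i + 1) (h''.set .i (i + 1)) := by
      intro h'' F'' hv hp'' hU'' hV'' hR'' hW''
      refine ⟨by rw [hml]; exact hi,
        F''.set (by decide) _, ⟨?_, ?_, ?_, hU'', hV'', hR'', hW''⟩, by simpa using hp''⟩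
      · simpa [hv] using hE.var_n
      · simpa [hv] using hE.var_t
      · simpa [hv] using hE.var_s
    simp only [parseStep, Cmd.wp, Expr.ok, Expr.val, Store.put_v, Store.put_a, Store.set_v,
      Store.set_a, reduceCtorEq, if_true, if_false, true_and, hvi, hp, g0, hn', g3, g4]
    have b1 : i < D := by omega
    have b2 : 1 ≤ B := by omega
    have b3 : 2 ≤ B := by omega
    have b4 : I.pos i + L.length + 3 < D := by omega
    refine ⟨by omega, b1, b1, by omega, fun hl => ⟨⟨⟨b2, by omega⟩, by omega⟩, b1, b2, fun hl' =>
      ⟨⟨⟨b3, by omega⟩, by omega⟩, b1, ⟨⟨b2, by omega⟩, by omega⟩, by omega, b1,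
        ⟨⟨b2, by omega⟩, by omega⟩, b1, ⟨b3, by omega⟩, fin _ ?_ ?_ ?_ ?_ ?_ ?_ ?_⟩, fun hl' =>
      ⟨⟨⟨b2, by omega⟩, by omega⟩, by omega, b1,
        ⟨⟨b2, by omega⟩, by omega⟩, b1, ⟨b3, by omega⟩, fin _ ?_ ?_ ?_ ?_ ?_ ?_ ?_⟩⟩,
      fun hl => ⟨b2, fun hl' => absurd hl' (by omega), fun hl' =>
      ⟨⟨⟨b2, by omega⟩, by omega⟩, by omega, b1,
        ⟨⟨b2, by omega⟩, by omega⟩, b1, ⟨b3, by omega⟩, fin _ ?_ ?_ ?_ ?_ ?_ ?_ ?_⟩⟩⟩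
    · refine Frame.set (Frame.put (Frame.put (Frame.set (Frame.put (Frame.put (Frame.put (Frame.put
        (Frame.set F ?_ _) ?_ _ _) ?_ _ _) ?_ _ _) ?_ _ _) ?_ _) ?_ _ _) ?_ _ _) ?_ _ <;> decide
    · intro r h1 h2; simp [h1, h2]
    · simp; omega
    · simpa using upd hE.U_eq (g1 hl)
    · simpa using upd hE.V_eq (g2 hl')
    · simpa using upd hE.R_eq rfl
    · simpa using upd hE.W_eq rfl
    · refine Frame.set (Frame.put (Frame.put (Frame.set (Frame.put (Frame.put (Frame.put
        (Frame.set F ?_ _) ?_ _ _) ?_ _ _) ?_ _ _) ?_ _) ?_ _ _) ?_ _ _) ?_ _ <;> decide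
    · intro r h1 h2; simp [h1, h2]
    · simp; omega
    · simpa using upd hE.U_eq (g1 hl)
    · simpa using upd hE.V_eq (g2' hl')
    · simpa using upd hE.R_eq rfl
    · simpa using upd hE.W_eq rfl
    · refine Frame.set (Frame.put (Frame.put (Frame.set (Frame.put (Frame.put
        (Frame.set F ?_ _) ?_ _ _) ?_ _ _) ?_ _) ?_ _ _) ?_ _ _) ?_ _ <;> decide
    · intro r h1 h2; simp [h1, h2]
    · simp; omega
    · simpa using upd hE.U_eq (g1' hl)
    · simpa using upd hE.V_eq (g2' hl')
    · simpa using upd hE.R_eq rfl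
    · simpa using upd hE.W_eq rfl
  · have h1 : parseStep.cost + 2 * (Expr.v .m).cost + 10 ≤ 400 := by decide
    have h2 : parseInit.cost ≤ 50 := by decide
    have := Nat.mul_le_mul_right (I.S.m + 1) h1
    omega
  · rintro h' ⟨-, F, hE, -⟩
    exact ⟨F, hE⟩

end RAM

/-! ### Memory layout and the complete program -/

namespace RAM

/-- Computation of the base addresses of the arrays `1, …, f`, given their length in register `57`. -/
def bases : ℕ → Prog
  | 0 => .skip
  | f + 1 => .seq (bases f) (.add (41 + f) (40 + f) 57)

/-- The machine has no multiplication; each base address is the previous one plus `D`. -/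
theorem run_bases {D B : ℕ} (hB : 16 * D ≤ B) {s : State} (h57 : s.reg 57 = D)
    (h40 : s.reg 40 = 0) : ∀ F ≤ 15, ∃ s', Run B (bases F) s (F + 1) s' ∧ s'.mem = s.mem ∧
      (∀ r, r ≤ 40 → s'.reg r = s.reg r) ∧ s'.reg 57 = D ∧ ∀ f ≤ F, s'.reg (40 + f) = f * D := by
  intro F
  induction F with
  | zero =>
    intro _
    refine ⟨s, Run.skip s, rfl, fun _ _ => rfl, h57, fun f hf => ?_⟩
    have : f = 0 := by omega
    subst this
    simpa using h40
  | succ F ih =>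
    intro hF
    obtain ⟨s', hr, hm, hreg, h57', hb⟩ := ih (by omega)
    have hF' := hb F le_rfl
    have hle : (F + 1) * D ≤ 16 * D := Nat.mul_le_mul_right _ (by omega)
    have e : s'.reg (40 + F) + s'.reg 57 = (F + 1) * D := by rw [hF', h57']; ring
    refine ⟨_, Run.seq hr (Run.add s' (41 + F) (40 + F) 57 (by rw [e]; omega)), hm, ?_, ?_, ?_⟩
    · intro r hr'
      simp only [State.setReg]
      rw [Function.update_of_ne (by omega), hreg r hr']
    · simp only [State.setReg]
      rw [Function.update_of_ne (by omega), h57']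
    · intro f hf
      simp only [State.setReg]
      by_cases h1 : f = F + 1
      · subst h1
        rw [show 40 + (F + 1) = 41 + F by omega, Function.update_self, e]
      · rw [Function.update_of_ne (by omega), hb f (by omega)]

/-- The first steps: `k`, `n` and `m` are read and the length `8 * (k + n + m + 3)` of the arrays is
computed. -/
def prelude : Prog :=
  .seq (.load 1 56) <| .seq (.const 56 1) <| .seq (.load 2 56) <| .seq (.const 56 2) <|
  .seq (.load 3 56) <| .seq (.const 57 3) <| .seq (.add 57 57 1) <| .seq (.add 57 57 2) <|
  .seq (.add 57 57 3) <| .seq (.add 57 57 57) <| .seq (.add 57 57 57) (.add 57 57 57)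

theorem run_prelude {B k n m : ℕ} {s : State} (hB : 8 * (k + n + m + 3) ≤ B)
    (hreg : ∀ r, s.reg r = 0) (hk : s.mem 0 = k) (hn : s.mem 1 = n) (hm : s.mem 2 = m) :
    ∃ s', Run B prelude s 12 s' ∧ s'.mem = s.mem ∧ s'.reg 1 = k ∧ s'.reg 2 = n ∧ s'.reg 3 = m ∧
      s'.reg 57 = 8 * (k + n + m + 3) ∧
      ∀ r, r ≠ 1 → r ≠ 2 → r ≠ 3 → r < 56 → s'.reg r = 0 := by
  refine ⟨_, Run.seq (Run.load _ _ _) <| Run.seq (Run.const _ _ _ ?_) <| Run.seq (Run.load _ _ _) <|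
    Run.seq (Run.const _ _ _ ?_) <| Run.seq (Run.load _ _ _) <| Run.seq (Run.const _ _ _ ?_) <|
    Run.seq (Run.add _ _ _ _ ?_) <| Run.seq (Run.add _ _ _ _ ?_) <|
    Run.seq (Run.add _ _ _ _ ?_) <| Run.seq (Run.add _ _ _ _ ?_) <|
    Run.seq (Run.add _ _ _ _ ?_) (Run.add _ _ _ _ ?_), rfl, ?_, ?_, ?_, ?_, ?_⟩
  · omega
  · omega
  · omega
  · simp [State.setReg, hreg, hk]; omega
  · simp [State.setReg, hreg, hk, hn]; omega
  · simp [State.setReg, hreg, hk, hn, hm]; omega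
  · simp [State.setReg, hreg, hk, hn, hm]; omega
  · simp [State.setReg, hreg, hk, hn, hm]; omega
  · simp [State.setReg, hreg, hk, hn, hm]; omega
  · simp [State.setReg, hreg, hk]
  · simp [State.setReg, hreg, hn]
  · simp [State.setReg, hreg, hm]
  · simp [State.setReg, hreg, hk, hn, hm]; omega
  · intro r h1 h2 h3 h4
    have h5 : r ≠ 56 := by omega
    have h6 : r ≠ 57 := by omega
    simp [State.setReg, hreg, h1, h2, h3, h5, h6]

/-- The program that solves `Max-(≤ 2, *)-Lin2-B[W]`. -/
def maxLin2Prog : Prog := .seq prelude (.seq (bases 15) (.seq parse solve))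

end RAM

theorem MaxLin2BInst.three_le_length (I : MaxLin2BInst 2) :
    3 ≤ ((maxLin2B 2).encode I).length := by
  simp [maxLin2B]

theorem MaxLin2BInst.le_sum (I : MaxLin2BInst 2) :
    I.k + I.S.n + I.S.m ≤ ((maxLin2B 2).encode I).sum := by
  simp [maxLin2B]
  omega

theorem MaxLin2BInst.edges_W_le (I : MaxLin2BInst 2) (j : ℕ) :
    I.S.edges.W j ≤ ((maxLin2B 2).encode I).sum + 1 := by
  simp only [LinSystem2.edges]
  rcases hj : I.S.eqs[j]? with _ | e
  · simp
  · simp only [Option.elim_some]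
    have he : e ∈ I.S.eqs := List.mem_of_getElem? hj
    have : e.weight ∈ (maxLin2B 2).encode I := by
      refine List.mem_append_right _ (List.mem_flatMap.2 ⟨e, he, ?_⟩)
      simp [LinEq2.encode]
    exact (List.le_sum_of_mem this).trans (Nat.le_succ _)

theorem maxLin2B_run (I : MaxLin2BInst 2) :
    ∃ (t : ℕ) (s : RAM.State),
      RAM.Run (RAM.wordBound 4 ((maxLin2B 2).encode I)) RAM.maxLin2Prog
        (RAM.init ((maxLin2B 2).encode I)) t s ∧
      t ≤ 1000000 * (2 ^ I.k * (max I.k 1 * max I.S.m 1) ^ 2) ∧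
      ((maxLin2B 2).Yes I → s.reg 0 = 1) ∧ (¬ (maxLin2B 2).Yes I → s.reg 0 = 0) := by
  set l := (maxLin2B 2).encode I with hl
  set B := RAM.wordBound 4 l with hBdef
  set k := I.k with hk
  set n := I.S.n with hn
  set m := I.S.m with hm
  set D := 8 * (k + n + m + 3) with hD
  have h3 : 3 ≤ l.length := I.three_le_length
  have hsum : k + n + m ≤ l.sum := I.le_sum
  -- The header has three words, so the base `N` of the word bound is at least 5 and `N ^ 5 ≥ 5 ^ 4
  -- * N`. This leaves room for `16 * D = 128 * (k + n + m + 3)`.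
  have hN : 625 * (l.length + l.sum + 2) ≤ B := by
    have h5 : 5 ≤ l.length + l.sum + 2 := by omega
    have := Nat.mul_le_mul_right (l.length + l.sum + 2) (Nat.pow_le_pow_left h5 4)
    rw [hBdef, RAM.wordBound, pow_succ]
    exact this
  have hB : 16 * D ≤ B := by omega
  have hlen : l.length ≤ 3 + 5 * m := by
    rw [hl, I.length_encode]
    exact I.pos_le le_rfl
  have hencode : l = [k, n, m] ++ I.S.eqs.flatMap LinEq2.encode := rfl
  obtain ⟨s₁, r₁, m₁, a₁, b₁, c₁, d₁, z₁⟩ := RAM.run_prelude (B := B) (k := k) (n := n) (m := m)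
    (s := RAM.init l) (by omega) (fun _ => rfl) (by simp [RAM.init, hencode])
    (by simp [RAM.init, hencode]) (by simp [RAM.init, hencode])
  obtain ⟨s₂, r₂, m₂, f₂, -, b₂⟩ := RAM.run_bases hB d₁ (z₁ 40 (by omega) (by omega) (by omega)
    (by omega)) 15 le_rfl
  -- Arrays are total functions here, so they are set to 0 beyond their length; the invariants ask
  -- for zeros everywhere.
  set h : RAM.Store := ⟨fun r => s₂.reg r.idx,
    fun f i => if i < D then s₂.mem (f.idx * D + i) else 0⟩ with hh
  have hrep : RAM.Rep D s₂ h := by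
    refine ⟨fun r => rfl, ?_, fun f hf => b₂ f (by omega), fun f i hi => ?_⟩
    · rw [f₂ 39 (by omega), z₁ 39 (by omega) (by omega) (by omega) (by omega)]
    · simp [hh, hi]
  have hmem : s₂.mem = fun i => l.getD i 0 := m₂.trans m₁
  -- The input has at most `3 + 5 * m < D` words, so it lies within the block of `inp` and all other
  -- arrays start empty.
  have hzero : ∀ f : RAM.Arr, f ≠ .inp → ∀ i, h.a f i = 0 := by
    intro f hf i
    simp only [hh]
    split_ifs with hi
    · have h1 : 1 ≤ f.idx := by
        refine Nat.one_le_iff_ne_zero.2 fun h0 => hf (RAM.Arr.idx_injective h0)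
      have h2 : 1 * D ≤ f.idx * D := Nat.mul_le_mul_right _ h1
      rw [hmem]
      exact List.getD_eq_default _ _ (by omega)
    · rfl
  have hinp : ∀ i < D, h.a .inp i = l.getD i 0 := by
    intro i hi
    simp [hh, hi, hmem, RAM.Arr.idx]
  have hvk : h.v .k = k := (f₂ 1 (by omega)).trans a₁
  have hvn : h.v .n = n := (f₂ 2 (by omega)).trans b₁
  have hvm : h.v .m = m := (f₂ 3 (by omega)).trans c₁
  have htri := RAM.Tri.seq' (RAM.tri_parse I hB (by omega) (by omega) hvn hvm hinp)
    (Q := fun h' => (h'.v .ans = 1 ∧ ∃ lab, I.S.edges.cost m lab ≤ k) ∨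
      (h'.v .ans = 0 ∧ ∀ lab, k < I.S.edges.cost m lab)) (fun h' H => by
      obtain ⟨F, hE⟩ := H
      refine RAM.tri_solve hB (by omega) (by omega) (by omega) hE I.S.edges_U_le I.S.edges_V_le
        I.S.edges_R_le (fun j => ?_) I.S.edges_W_pos ((F.1 _ (by decide)).trans hvm)
        ((F.1 _ (by decide)).trans hvk) ?_ ?_ ?_
      · have := I.edges_W_le j
        rw [← hl] at this
        omega
      · rw [F.2 _ (by decide)]; exact hzero _ (by decide)
      · rw [F.2 _ (by decide)]; exact hzero _ (by decide)
      · rw [F.2 _ (by decide)]; exact hzero _ (by decide))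
  obtain ⟨t, s₃, h₃, r₃, ht, hrep₃, hres⟩ := htri s₂ hrep
  have hans : s₃.reg 0 = h₃.v .ans := hrep₃.var .ans
  have hiff : (maxLin2B 2).Yes I ↔ ∃ lab, I.S.edges.cost m lab ≤ k :=
    I.S.exists_satWeight_iff I.card_le k
  refine ⟨_, s₃, RAM.Run.seq r₁ (RAM.Run.seq r₂ r₃), ?_, fun hy => ?_, fun hy => ?_⟩
  · have e1 : m + 1 ≤ 2 * max m 1 := by omega
    have e2 : k + 1 ≤ 2 * max k 1 := by omega
    have e3 : 1 ≤ max k 1 := le_max_right _ _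
    have e4 : 1 ≤ max m 1 := le_max_right _ _
    have e5 : 1 ≤ 2 ^ k := Nat.one_le_two_pow
    generalize max m 1 = M at *
    generalize max k 1 = K at *
    rw [pow_succ] at ht
    generalize 2 ^ k = P at *
    -- Three factors, each at most doubled, give 8, and `2 ^ (k + 1)` gives another 2; the main term
    -- is `352000`, and the constant `1000000` absorbs the rest.
    have f1 : (m + 1) * (k + 1) * (m + 1) ≤ (2 * M) * (2 * K) * (2 * M) := by gcongr
    have f2 : (2 * M) * (2 * K) * (2 * M) ≤ 8 * (K * M) ^ 2 := by nlinarith [Nat.mul_le_mul_right (K * M * M) e3]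
    have f3 : (m + 1) * (k + 1) * (m + 1) * P ≤ 8 * (K * M) ^ 2 * P :=
      Nat.mul_le_mul_right _ (f1.trans f2)
    have f4 : m + 1 ≤ (m + 1) * (k + 1) * (m + 1) * P := by
      have : 1 ≤ (k + 1) * (m + 1) * P := Nat.mul_pos (Nat.mul_pos (by omega) (by omega)) e5
      calc m + 1 = (m + 1) * 1 := (mul_one _).symm
        _ ≤ (m + 1) * ((k + 1) * (m + 1) * P) := Nat.mul_le_mul_left _ this
        _ = _ := by ring
    have f5 : 22000 * (m + 1) * (k + 1) * (P * 2) * (m + 1) =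
        44000 * ((m + 1) * (k + 1) * (m + 1) * P) := by ring
    have f6 : P * (K * M) ^ 2 = (K * M) ^ 2 * P := mul_comm _ _
    rw [f5] at ht
    rw [f6]
    have f7 : 8 * (K * M) ^ 2 * P = 8 * ((K * M) ^ 2 * P) := mul_assoc _ _ _
    omega
  · rw [hiff] at hy
    obtain ⟨lab, hlab⟩ := hy
    rcases hres with ⟨g, -⟩ | ⟨-, g⟩
    · rw [hans, g]
    · have := g lab
      omega
  · rw [hiff] at hy
    rcases hres with ⟨-, g⟩ | ⟨g, -⟩
    · exact absurd g hy
    · rw [hans, g]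

/-- Each equation contributes at least one word, and each word counts at least 1 for its separator.
So `m` can be absorbed into the polynomial factor in the bit length. -/
theorem MaxLin2BInst.m_le_size (I : MaxLin2BInst 2) : max I.S.m 1 ≤ (maxLin2B 2).size I := by
  have h1 : ((maxLin2B 2).encode I).length ≤ (maxLin2B 2).size I := by
    unfold ParamProblem.size
    induction (maxLin2B 2).encode I with
    | nil => simp
    | cons a l ih => simp only [List.length_cons, List.map_cons, List.sum_cons]; omega
  have h2 : I.S.eqs.length ≤ (I.S.eqs.flatMap LinEq2.encode).length := by
    induction I.S.eqs with
    | nil => simp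
    | cons e l ih =>
      have : 1 ≤ e.encode.length := by simp [LinEq2.encode]
      simp only [List.flatMap_cons, List.length_append, List.length_cons]
      omega
  have h3 : ((maxLin2B 2).encode I).length = 3 + (I.S.eqs.flatMap LinEq2.encode).length := by
    simp [maxLin2B]
    omega
  have h4 : I.S.m = I.S.eqs.length := rfl
  omega

theorem computable_two_pow_mul_sq (C : ℕ) : Computable fun k : ℕ => C * (2 ^ k * max k 1 ^ 2) := by
  have h1 : Primrec fun k : ℕ => 2 ^ k := by
    have : Primrec fun k : ℕ => Nat.rec (motive := fun _ => ℕ) 1 (fun _ x => x * 2) k :=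
      Primrec.nat_rec₁ 1 (Primrec.nat_mul.comp Primrec.snd (Primrec.const 2))
    refine this.of_eq fun k => ?_
    induction k with
    | zero => rfl
    | succ k ih => rw [pow_succ, ← ih]
  have h2 : Primrec fun k : ℕ => max k 1 := Primrec.nat_max.comp Primrec.id (Primrec.const 1)
  have h3 : Primrec fun k : ℕ => max k 1 ^ 2 :=
    (Primrec.nat_mul.comp h2 h2).of_eq fun k => (sq _).symm
  exact (Primrec.nat_mul.comp (Primrec.const C) (Primrec.nat_mul.comp h1 h3)).to_comp

theorem theorem3p1 :
    (∃ C : ℕ, (maxLin2B 2).SolvableInTime fun I : MaxLin2BInst 2 =>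
      C * (2 ^ I.k * (max I.k 1 * max I.S.m 1) ^ 2)) ∧
    (maxLin2B 2).FixedParameterTractable := by
  refine ⟨⟨1000000, RAM.maxLin2Prog, 4, maxLin2B_run⟩,
    fun k => 1000000 * (2 ^ k * max k 1 ^ 2), 2, computable_two_pow_mul_sq _,
    RAM.maxLin2Prog, 4, fun I => ?_⟩
  obtain ⟨t, s, hr, ht, h1, h2⟩ := maxLin2B_run I
  refine ⟨t, s, hr, ht.trans ?_, h1, h2⟩
  have hm := Nat.pow_le_pow_left I.m_le_size 2
  calc 1000000 * (2 ^ I.k * (max I.k 1 * max I.S.m 1) ^ 2)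
      = 1000000 * (2 ^ I.k * max I.k 1 ^ 2) * max I.S.m 1 ^ 2 := by ring
    _ ≤ 1000000 * (2 ^ I.k * max I.k 1 ^ 2) * (maxLin2B 2).size I ^ 2 := Nat.mul_le_mul_left _ hm
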